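/- **Setting.** Time is divided into slots $0,1,2,\dots$; in every slot there are a data channel and a control channel. An adaptive adversary decides for each slot, knowing everything that happened in earlier slots (and possibly using its own randomness), the finite number of packets injected in that slot and whether the data channel and/or the control channel is disrupted. A slot is *disrupted* if at least one of its channels is. A disrupted channel appears full, and every packet broadcast on it fails. A packet broadcast on the data channel *succeeds* if it is the only one broadcast there and the data channel is not disrupted. A packet is *live* from its injection until it succeeds; slots without live packets are ignored in all counts. **Re-Backoff** (with a constant $c>0$). A packet is initially inactive. An inactive packet that observes an empty control slot becomes active in the next slot. In the $s$-th slot of its current active period, an active packet, independently of everything else, broadcasts on the data channel with probability $\frac{1}{2s}$ and on the control channel with probability $\min\{1,\,c\max\{\ln s,1\}/s\}$. If its data broadcast succeeds it terminates; otherwise, if at least a $15/16$-fraction of the data slots of its current active period (including the current one) were empty, it becomes inactive again. A slot is *wasted* if it is neither disrupted nor contains a successful transmission; the *waste* at time $t$ is the fraction of wasted slots among the slots before $t$. Let $D_t$ be the number of disrupted slots before $t$, $\mathcal N_t$ the maximum number of packets concurrently live in a slot before $t$, and $A_t$ the total number of broadcasts (on either channel) before $t$ divided by the number of packets injected before $t$.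 **Theorem.** There is a $c_0$ such that for every $c\ge c_0$ there are constants $w<1$ and $C$, depending only on $c$, for which the following holds. Consider any adversary that, with probability $1$, injects infinitely many packets in total. Then for every $s\in\mathbb N$ there is a random time $T$ (a time that may depend on the execution) such that 1. with probability $1$, at least $s$ slots precede $T$ (in particular $T\ge s$) and the waste at time $T$ is at most $w$; and 2. the expected average number of access attempts per packet at time $T$ is $O(\log^2\mathcal N_T+\log^2 D_T)$, in the sense that for all $n,m\in\mathbb N$ $$\mathbb E\big[A_T\,\mathbf 1\{\mathcal N_T=n,\ D_T=m\}\big]\le C\,(1+\log^2 n+\log^2 m)\,\Pr[\mathcal N_T=n,\ D_T=m],$$ where $\log 0$ is read as $0$. In particular $\mathbb E[A_T]\le C\,\mathbb E[1+\log^2\mathcal N_T+\log^2 D_T]$. -/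

import Mathlib

open MeasureTheory ProbabilityTheory

noncomputable section

namespace ReBackoff

/-- The two channels that can be used simultaneously in every slot. -/
inductive Channel
  | data
  | control

/-- The condition of a packet at the beginning of a slot. `active s e` means that the coming slot
is the `s`-th slot of the current active period (so `s ≥ 1` is the age used in that slot), and that
`e` of the preceding `s - 1` data slots of this period were empty. A packet that has not arrived
yet is recorded as `inactive`. -/
inductive Packet
  | inactive
  | active (age empties : ℕ)
  | done

/-- The system at the beginning of a slot. Packets are numbered in order of injection: those with
number `< injected` have been injected in earlier slots. -/
structure State where
  injected : ℕ
  packet : ℕ → Packet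

/-- What drives one slot: the adversary's decisions (number of newly arriving packets, and whether
it disrupts the data channel and the control channel), and the coins of the packets. -/
structure SlotInput where
  arrivals : ℕ
  jamData : Bool
  jamControl : Bool
  coin : Channel → ℕ → ℝ

/-- The slot is disrupted if the adversary disrupts at least one of the channels. -/
def SlotInput.Disrupted (x : SlotInput) : Prop :=
  x.jamData = true ∨ x.jamControl = true

/-- The broadcast probabilities of an active packet of age `s`, with `d = 1 / 2`. -/
def sendProb (c : ℝ) : Channel → ℕ → ℝ
  | .data, s => (1 / 2) / (s : ℝ)
  | .control, s => min 1 (c * max (Real.log (s : ℝ)) 1 / (s : ℝ))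

section Slot

variable (c : ℝ) (x : SlotInput) (q : State)

/-- Number of packets injected up to and including the current slot. -/
def population : ℕ := q.injected + x.arrivals

open Classical in
/-- The packets that are live in the slot. -/
def livePackets : Finset ℕ :=
  (Finset.range (population x q)).filter fun i => q.packet i ≠ Packet.done

open Classical in
/-- The packets that broadcast on channel `ch` in the slot. -/
def senders (ch : Channel) : Finset ℕ :=
  (Finset.range (population x q)).filter fun i =>
    ∃ s e, q.packet i = Packet.active s e ∧ x.coin ch i < sendProb c ch s

/-- Packet `i` transmits successfully. -/
def Succeeds (i : ℕ) : Prop :=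
  x.jamData = false ∧ senders c x q Channel.data = {i}

/-- The data channel is empty (a disruption appears as a full slot). -/
def DataEmpty : Prop :=
  x.jamData = false ∧ senders c x q Channel.data = ∅

/-- The control channel is empty. -/
def ControlEmpty : Prop :=
  x.jamControl = false ∧ senders c x q Channel.control = ∅

/-- At least one packet is live; only such slots are taken into account. -/
def SlotLive : Prop := (livePackets x q).Nonempty

/-- The slot is wasted: it is neither disrupted nor successful, i.e. it is undisrupted, and no
packet or more than one packet is broadcast on the data channel. -/
def SlotWasted : Prop :=
  ¬ x.Disrupted ∧ ¬ ∃ i, Succeeds c x q i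

open Classical in
/-- The protocol. An inactive packet that sees an empty control slot is active from the next slot
on. An active packet terminates if it transmits successfully; otherwise, if at least `15 / 16` of
the data slots since it became active, including the current one, were empty, it becomes
inactive. -/
def nextPacket (i : ℕ) : Packet :=
  match q.packet i with
  | .done => .done
  | .inactive =>
      if i < population x q ∧ ControlEmpty c x q then .active 1 0 else .inactive
  | .active s e =>
      if Succeeds c x q i then .done
      else if 15 * s ≤ 16 * (e + if DataEmpty c x q then 1 else 0) then .inactive
      else .active (s + 1) (e + if DataEmpty c x q then 1 else 0)

/-- The system at the beginning of the next slot. -/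
def nextState : State where
  injected := population x q
  packet := nextPacket c x q

end Slot

section Run

variable (c : ℝ) (x : ℕ → SlotInput)

/-- The system at the beginning of slot `t`. -/
def run : ℕ → State
  | 0 => ⟨0, fun _ => Packet.inactive⟩
  | t + 1 => nextState c (x t) (run t)

/-- Number of packets injected before time `t`. -/
def packetsBefore (t : ℕ) : ℕ := (run c x t).injected

open Classical in
/-- Number of slots before time `t` with at least one live packet. -/
def slotsBefore (t : ℕ) : ℕ :=
  ((Finset.range t).filter fun r => SlotLive (x r) (run c x r)).card

open Classical in
/-- `D_t`: number of disrupted slots before time `t`. -/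
def disruptedBefore (t : ℕ) : ℕ :=
  ((Finset.range t).filter fun r => SlotLive (x r) (run c x r) ∧ (x r).Disrupted).card

open Classical in
/-- Number of wasted slots before time `t`. -/
def wastedBefore (t : ℕ) : ℕ :=
  ((Finset.range t).filter fun r =>
    SlotLive (x r) (run c x r) ∧ SlotWasted c (x r) (run c x r)).card

/-- The waste of the execution up to time `t`. -/
def waste (t : ℕ) : ℝ := (wastedBefore c x t : ℝ) / (slotsBefore c x t : ℝ)

/-- `𝒩_t`: maximum number of packets concurrently in the system before time `t`. -/
def maxConcurrent (t : ℕ) : ℕ :=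
  (Finset.range t).sup fun r => (livePackets (x r) (run c x r)).card

/-- Number of access attempts, on either channel, made by all packets before time `t`. -/
def attemptsBefore (t : ℕ) : ℕ :=
  ∑ r ∈ Finset.range t, ((senders c (x r) (run c x r) Channel.data).card +
    (senders c (x r) (run c x r) Channel.control).card)

/-- Average number of access attempts before time `t` per packet injected before time `t`. -/
def averageAttempts (t : ℕ) : ℝ :=
  (attemptsBefore c x t : ℝ) / (packetsBefore c x t : ℝ)

end Run

section Probability

variable {Ω : Type*} [mΩ : MeasurableSpace Ω]

/-- The packets' coins: with `ℱ t` the information available before slot `t`, the coins of slot `t`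
are independent of each other and of `ℱ t`, uniform on `[0, 1]`, and known after the slot. -/
structure FairCoins (μ : Measure Ω) (ℱ : Filtration ℕ mΩ)
    (coin : ℕ → Channel → ℕ → Ω → ℝ) : Prop where
  measurable : ∀ t ch i, Measurable[ℱ (t + 1)] (coin t ch i)
  uniform : ∀ t ch i, μ.map (coin t ch i) = volume.restrict (Set.Icc (0 : ℝ) 1)
  independent : ∀ t, iIndepFun (fun p : Channel × ℕ => coin t p.1 p.2) μ
  independent_past : ∀ t,
    Indep (⨆ p : Channel × ℕ, MeasurableSpace.comap (coin t p.1 p.2) (borel ℝ)) (ℱ t) μ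

/-- An adaptive adversary: its decisions for slot `t` may depend in any way on what is known before
slot `t`, i.e. on everything that has happened in earlier slots and on its own randomness. -/
structure Adversary (ℱ : Filtration ℕ mΩ) where
  arrivals : ℕ → Ω → ℕ
  jamData : ℕ → Ω → Bool
  jamControl : ℕ → Ω → Bool
  measurable_arrivals : ∀ t, Measurable[ℱ t] (arrivals t)
  measurable_jamData : ∀ t, Measurable[ℱ t] (jamData t)
  measurable_jamControl : ∀ t, Measurable[ℱ t] (jamControl t)

/-- The inputs of all slots in the outcome `ω`. -/
def Adversary.inputs {ℱ : Filtration ℕ mΩ} (adv : Adversary ℱ)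
    (coin : ℕ → Channel → ℕ → Ω → ℝ) (ω : Ω) : ℕ → SlotInput := fun t =>
  { arrivals := adv.arrivals t ω
    jamData := adv.jamData t ω
    jamControl := adv.jamControl t ω
    coin := fun ch i => coin t ch i ω }

end Probability

end ReBackoff

end

noncomputable section

namespace ReBackoff

/-! Every estimate compares two counts along a single outcome, up to an additive constant that
depends on the outcome. Infinitely many packets arrive, so these constants become negligible at late
times. The bound on the average number of broadcasts then holds almost surely at a suitable time,
outcome by outcome, and the statement about expectations follows at once.

Randomness enters through one principle (`ae_bddAbove_of_exp`, `ae_cum_le`). If every increment has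
conditional exponential moment at most 1, the exponential of the partial sums is a supermartingale,
and the partial sums are almost surely bounded above. The adversary's decisions are fixed by the
past, so each such moment is a computation for one slot with a fixed state. `Typical` collects the
resulting facts; what follows is deterministic.

Slots. Let `X` be the sum of 1/age over active packets; X/2 is the expected number of data
broadcasts. For 1/64 ≤ X ≤ 16 an undisrupted slot succeeds with constant probability. Below 1/64
slots are mostly empty, but an active packet tolerates only a 15/16-fraction of empty slots
(`active_slots_le`). A slot with only inactive packets forces X ≥ 1 in the next one
(`idle_slots_le`). High contention is followed by a clock, reset at every moment when packets might
change between active and inactive. Between resets X falls no faster than 1/k in the clock value k,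
apart from successes, so slots with X > 16 are matched by slots with 8 ≤ X ≤ 16 (`high_slots_le`).
Early resets could spoil this, but the logarithmic factor on the control channel makes an empty
control slot at clock value k have probability O(k⁻⁴), and the total loss is a small fraction of the
slots with high contention (`bad_le`). At settled times, which occur arbitrarily late
(`exists_settled`), live slots are therefore O(successes + disruptions) (`slots_le`); this bounds
the waste.

Broadcasts. Each inactivation is paid for by contention in empty slots (`inact_le`). Success has
probability at least X/2 times that of an empty slot, so this payment is comparable to the number of
successes, and inactivations are O(packets) (`inact_le_inj`). A period makes O(log² A) expected
broadcasts at ages up to A. With A = (1+N+D)⁴ older packets matter little: at most N are live in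
each of O(packets + D) slots, each broadcasting with probability O((1+N+D)⁻²) (`cum_psum_pr_le`,
`attempts_le`). -/

open Classical in
/-- The real indicator of a proposition. -/
def ind (p : Prop) : ℝ := if p then 1 else 0

lemma ind_pos {p : Prop} (h : p) : ind p = 1 := by simp [ind, h]

lemma ind_neg {p : Prop} (h : ¬ p) : ind p = 0 := by simp [ind, h]

lemma ind_nonneg (p : Prop) : 0 ≤ ind p := by unfold ind; split_ifs <;> norm_num

lemma ind_le_one (p : Prop) : ind p ≤ 1 := by unfold ind; split_ifs <;> norm_num

lemma ind_mono {p q : Prop} (h : p → q) : ind p ≤ ind q := by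
  by_cases hp : p
  · rw [ind_pos hp, ind_pos (h hp)]
  · rw [ind_neg hp]; exact ind_nonneg q

/-! ### Views of a slot and the transitions of a packet -/

/-- What can be observed of a slot: arrivals, disruptions, and the senders on the two channels. -/
structure View where
  arr : ℕ
  jd : Bool
  jc : Bool
  sd : Finset ℕ
  sc : Finset ℕ

namespace View

variable (v : View)

/-- The data channel is empty. -/
def Emp : Prop := v.jd = false ∧ v.sd = ∅

/-- The control channel is empty. -/
def CEmp : Prop := v.jc = false ∧ v.sc = ∅

/-- Packet `i` succeeds. -/
def Succ (i : ℕ) : Prop := v.jd = false ∧ v.sd = {i}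

/-- The slot is disrupted. -/
def Dis : Prop := v.jd = true ∨ v.jc = true

/-- Some packet succeeds. -/
def Suc : Prop := ∃ i, v.Succ i

end View

/-- The observable part of a slot. -/
def viewOf (c : ℝ) (x : SlotInput) (q : State) : View :=
  ⟨x.arrivals, x.jamData, x.jamControl, senders c x q .data, senders c x q .control⟩

open Classical in
/-- The condition of a packet after a slot with view `v`. -/
def stepPacket (q : State) (v : View) (i : ℕ) : Packet :=
  match q.packet i with
  | .done => .done
  | .inactive => if i < q.injected + v.arr ∧ v.CEmp then .active 1 0 else .inactive
  | .active s e =>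
      if v.Succ i then .done
      else if 15 * s ≤ 16 * (e + if v.Emp then 1 else 0) then .inactive
      else .active (s + 1) (e + if v.Emp then 1 else 0)

/-- The state after a slot with view `v`. -/
def step (q : State) (v : View) : State := ⟨q.injected + v.arr, stepPacket q v⟩

/-- Invariants of the reachable states. -/
structure Inv (q : State) : Prop where
  inactive : ∀ i, q.injected ≤ i → q.packet i = .inactive
  active : ∀ i s e, q.packet i = .active s e → (s = 1 ∧ e = 0) ∨ 16 * e + 15 < 15 * s

/-- The senders of a view are active packets. -/
structure Compat (q : State) (v : View) : Prop where
  sd : ∀ i ∈ v.sd, ∃ s e, q.packet i = .active s e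
  sc : ∀ i ∈ v.sc, ∃ s e, q.packet i = .active s e

lemma Inv.age_pos {q : State} (h : Inv q) {i s e : ℕ} (hi : q.packet i = .active s e) : 1 ≤ s := by
  rcases h.active i s e hi with h | h <;> omega

lemma Inv.lt_injected {q : State} (h : Inv q) {i s e : ℕ} (hi : q.packet i = .active s e) :
    i < q.injected := by
  by_contra hlt
  rw [h.inactive i (not_lt.mp hlt)] at hi
  exact absurd hi (by simp)

lemma stepPacket_done {q : State} {v : View} {i : ℕ} (h : q.packet i = .done) :
    stepPacket q v i = .done := by simp [stepPacket, h]

lemma stepPacket_inactive {q : State} {v : View} {i : ℕ} (h : q.packet i = .inactive) :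
    stepPacket q v i = .inactive ∨
      (v.CEmp ∧ i < q.injected + v.arr ∧ stepPacket q v i = .active 1 0) := by
  by_cases hc : i < q.injected + v.arr ∧ v.CEmp
  · right; exact ⟨hc.2, hc.1, by simp [stepPacket, h, hc]⟩
  · left; simp only [stepPacket, h, if_neg hc]

open Classical in
/-- `1` in slots with empty data channel. -/
def View.e (v : View) : ℕ := if v.Emp then 1 else 0

lemma View.e_cast (v : View) : (v.e : ℝ) = ind v.Emp := by unfold View.e ind; split_ifs <;> simp

lemma stepPacket_active {q : State} {v : View} {i s e : ℕ} (h : q.packet i = .active s e) :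
    (v.Succ i ∧ stepPacket q v i = .done) ∨
    (¬ v.Succ i ∧ 15 * s ≤ 16 * (e + v.e) ∧ stepPacket q v i = .inactive) ∨
    (¬ v.Succ i ∧ 16 * (e + v.e) < 15 * s ∧ stepPacket q v i = .active (s + 1) (e + v.e)) := by
  by_cases h1 : v.Succ i
  · left; exact ⟨h1, by simp [stepPacket, h, h1]⟩
  · by_cases h2 : 15 * s ≤ 16 * (e + v.e)
    · right; left
      refine ⟨h1, h2, ?_⟩
      unfold View.e at h2
      simp only [stepPacket, h, if_neg h1, if_pos h2]
    · right; right
      refine ⟨h1, not_le.mp h2, ?_⟩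
      unfold View.e at h2 ⊢
      simp only [stepPacket, h, if_neg h1, if_neg h2]

lemma Inv.step {q : State} (h : Inv q) (v : View) : Inv (step q v) := by
  constructor
  · intro i hi
    have hi' : q.injected + v.arr ≤ i := hi
    rcases stepPacket_inactive (v := v) (h.inactive i (by omega)) with h1 | h1
    · exact h1
    · omega
  · intro i s e hse
    have hse' : stepPacket q v i = .active s e := hse
    cases hp : q.packet i with
    | done => rw [stepPacket_done hp] at hse'; simp at hse'
    | inactive =>
      rcases stepPacket_inactive (v := v) hp with h1 | ⟨_, _, h1⟩
      · rw [h1] at hse'; simp at hse'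
      · rw [h1] at hse'; simp at hse'; omega
    | active s' e' =>
      rcases stepPacket_active (v := v) hp with ⟨_, h1⟩ | ⟨_, _, h1⟩ | ⟨_, h2, h1⟩
      · rw [h1] at hse'; simp at hse'
      · rw [h1] at hse'; simp at hse'
      -- Staying active means 16(e + new) < 15s. At the new age s + 1 only s slots lie in the past,
      -- whence the shift by 15 in the invariant.
      · rw [h1] at hse'; simp at hse'; omega

/-- A path of the system, as a sequence of states and views. -/
structure IsPath (q : ℕ → State) (v : ℕ → View) : Prop where
  zero : q 0 = ⟨0, fun _ => .inactive⟩
  succ : ∀ t, q (t + 1) = step (q t) (v t)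
  compat : ∀ t, Compat (q t) (v t)

lemma IsPath.inv {q : ℕ → State} {v : ℕ → View} (h : IsPath q v) (t : ℕ) : Inv (q t) := by
  induction t with
  | zero => rw [h.zero]; constructor <;> simp
  | succ t ih => rw [h.succ]; exact ih.step _

lemma isPath_run (c : ℝ) (x : ℕ → SlotInput) :
    IsPath (run c x) (fun t => viewOf c (x t) (run c x t)) where
  zero := rfl
  succ _ := rfl
  compat t := by
    constructor <;>
    · intro i hi
      simp only [viewOf, senders, Finset.mem_filter] at hi
      obtain ⟨_, s, e, h, _⟩ := hi
      exact ⟨s, e, h⟩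

/-! ### Sums over packets and contention -/

/-- Sum of a function of the age over the active packets. -/
def Packet.wt (w : ℕ → ℝ) : Packet → ℝ
  | .active s _ => w s
  | _ => 0

/-- Sum of a packet function over the injected packets. -/
def psum (q : State) (Φ : Packet → ℝ) : ℝ := ∑ i ∈ Finset.range q.injected, Φ (q.packet i)

/-- Sum of a function of the age over the active packets. -/
def wsum (q : State) (w : ℕ → ℝ) : ℝ := psum q (Packet.wt w)

/-- Twice the contention on the data channel. -/
def X (q : State) : ℝ := wsum q fun s => 1 / (s : ℝ)

/-- Some packet is active. -/
def HasActive (q : State) : Prop := ∃ i s e, q.packet i = .active s e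

lemma Packet.wt_nonneg {w : ℕ → ℝ} (hw : ∀ s, 0 ≤ w s) (p : Packet) : 0 ≤ p.wt w := by
  cases p <;> simp [Packet.wt, hw]

lemma wsum_nonneg {q : State} {w : ℕ → ℝ} (hw : ∀ s, 0 ≤ w s) : 0 ≤ wsum q w := by
  unfold wsum psum
  exact Finset.sum_nonneg fun i _ => Packet.wt_nonneg hw _

lemma X_nonneg (q : State) : 0 ≤ X q := wsum_nonneg fun s => by positivity

lemma wsum_eq_zero {q : State} (h : ¬ HasActive q) (w : ℕ → ℝ) : wsum q w = 0 := by
  unfold wsum psum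
  refine Finset.sum_eq_zero fun i _ => ?_
  cases hp : q.packet i with
  | active s e => exact absurd ⟨i, s, e, hp⟩ h
  | _ => rfl

lemma le_wsum {q : State} (hq : Inv q) {w : ℕ → ℝ} (hw : ∀ s, 0 ≤ w s) {i s e : ℕ}
    (h : q.packet i = .active s e) : w s ≤ wsum q w := by
  have := Finset.single_le_sum (f := fun i => (q.packet i).wt w)
    (fun j _ => Packet.wt_nonneg hw _) (Finset.mem_range.mpr (hq.lt_injected h))
  simp only [h] at this
  exact this

/-- New arrivals enlarge the index range. If the potential vanishes on them, the sum stays over the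
old range and can be compared packet by packet. -/
lemma psum_step_of {q : State} {v : View} {Φ : Packet → ℝ}
    (h : ∀ i, q.injected ≤ i → Φ (stepPacket q v i) = 0) :
    psum (step q v) Φ = ∑ i ∈ Finset.range q.injected, Φ (stepPacket q v i) := by
  have hsub : Finset.range q.injected ⊆ Finset.range (q.injected + v.arr) :=
    Finset.range_subset_range.mpr (by omega)
  exact (Finset.sum_subset hsub fun i _ hi => h i (by simpa using hi)).symm

lemma psum_step {q : State} {v : View} (hq : Inv q) {Φ : Packet → ℝ} (h0 : Φ .inactive = 0)
    (h1 : Φ (.active 1 0) = 0) :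
    psum (step q v) Φ = ∑ i ∈ Finset.range q.injected, Φ (stepPacket q v i) := by
  refine psum_step_of fun i hi => ?_
  rcases stepPacket_inactive (v := v) (hq.inactive i hi) with h | ⟨_, _, h⟩ <;> rw [h]
  exacts [h0, h1]

open Classical in
/-- Number of packets that become inactive in the slot. -/
def inactN (q : State) (v : View) : ℕ :=
  ((Finset.range q.injected).filter fun i =>
    (∃ s e, q.packet i = .active s e) ∧ stepPacket q v i = .inactive).card

lemma inactN_cast (q : State) (v : View) : (inactN q v : ℝ) = ∑ i ∈ Finset.range q.injected,
    ind ((∃ s e, q.packet i = .active s e) ∧ stepPacket q v i = .inactive) := by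
  unfold inactN ind
  simp only [Finset.sum_boole]
  congr

/-! ### Cumulative counts and charging by potentials -/

section Path

variable {q : ℕ → State} {v : ℕ → View}

/-- Number of injected packets. -/
def inj (q : ℕ → State) (t : ℕ) : ℕ := (q t).injected

/-- Number of inactivations. -/
def inact (q : ℕ → State) (v : ℕ → View) (t : ℕ) : ℕ := ∑ r ∈ Finset.range t, inactN (q r) (v r)

/-- Cumulative sum. -/
def cum (f : ℕ → ℝ) (t : ℕ) : ℝ := ∑ r ∈ Finset.range t, f r

@[simp] lemma cum_zero (f : ℕ → ℝ) : cum f 0 = 0 := by simp [cum]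

lemma cum_succ (f : ℕ → ℝ) (t : ℕ) : cum f (t + 1) = cum f t + f t := by
  simp [cum, Finset.sum_range_succ]

lemma cum_nonneg {f : ℕ → ℝ} (h : ∀ t, 0 ≤ f t) (t : ℕ) : 0 ≤ cum f t :=
  Finset.sum_nonneg fun r _ => h r

lemma cum_mono_time {f : ℕ → ℝ} (h : ∀ t, 0 ≤ f t) : Monotone (cum f) :=
  monotone_nat_of_le_succ fun t => by rw [cum_succ]; linarith [h t]

lemma cum_le_cum {f g : ℕ → ℝ} (h : ∀ t, f t ≤ g t) (t : ℕ) : cum f t ≤ cum g t :=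
  Finset.sum_le_sum fun r _ => h r

lemma cum_add (f g : ℕ → ℝ) (t : ℕ) : cum (fun r => f r + g r) t = cum f t + cum g t :=
  Finset.sum_add_distrib

lemma cum_sub (f g : ℕ → ℝ) (t : ℕ) : cum (fun r => f r - g r) t = cum f t - cum g t :=
  Finset.sum_sub_distrib ..

lemma cum_mul (a : ℝ) (f : ℕ → ℝ) (t : ℕ) : cum (fun r => a * f r) t = a * cum f t :=
  (Finset.mul_sum ..).symm

/-- Number of slots before `t` in which `p` holds. -/
def cnt (p : ℕ → Prop) (t : ℕ) : ℝ := cum (fun r => ind (p r)) t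

lemma cnt_succ (p : ℕ → Prop) (t : ℕ) : cnt p (t + 1) = cnt p t + ind (p t) := cum_succ _ _

lemma cnt_nonneg (p : ℕ → Prop) (t : ℕ) : 0 ≤ cnt p t := cum_nonneg (fun _ => ind_nonneg _) t

lemma cnt_mono (p : ℕ → Prop) : Monotone (cnt p) := cum_mono_time fun _ => ind_nonneg _

lemma cnt_le_cnt {p p' : ℕ → Prop} (h : ∀ t, p t → p' t) (t : ℕ) : cnt p t ≤ cnt p' t :=
  cum_le_cum (fun r => ind_mono (h r)) t

lemma cnt_le_add {p p₁ p₂ : ℕ → Prop} (h : ∀ t, p t → p₁ t ∨ p₂ t) (t : ℕ) :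
    cnt p t ≤ cnt p₁ t + cnt p₂ t := by
  unfold cnt
  rw [← cum_add]
  refine cum_le_cum (fun r => ?_) t
  by_cases hp : p r
  · rw [ind_pos hp]
    rcases h r hp with h' | h' <;> rw [ind_pos h'] <;> linarith [ind_nonneg (p₁ r), ind_nonneg (p₂ r)]
  · rw [ind_neg hp]; linarith [ind_nonneg (p₁ r), ind_nonneg (p₂ r)]

open Classical in
lemma cnt_eq_card (p : ℕ → Prop) (t : ℕ) : cnt p t = (((Finset.range t).filter p).card : ℝ) := by
  unfold cnt cum ind
  simp

/-- A potential argument over the packets: if the potential of each packet changes by at most its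
budget, and inactivation gains are counted apart. -/
lemma potential_bound (h : IsPath q v) {Φ : Packet → ℝ} (h0 : Φ .inactive = 0)
    (h1 : Φ (.active 1 0) = 0) (a : ℝ) (g : ℕ → ℕ → ℝ)
    (hstep : ∀ t, ∀ i < (q t).injected, Φ (stepPacket (q t) (v t) i) +
      a * ind ((∃ s e, (q t).packet i = .active s e) ∧ stepPacket (q t) (v t) i = .inactive)
        ≤ Φ ((q t).packet i) + g t i) (t : ℕ) :
    psum (q t) Φ + a * inact q v t ≤
      cum (fun r => ∑ i ∈ Finset.range (q r).injected, g r i) t := by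
  induction t with
  | zero => simp [psum, h.zero, inact]
  | succ t ih =>
    have hs := Finset.sum_le_sum (s := Finset.range (q t).injected)
      fun i hi => hstep t i (Finset.mem_range.mp hi)
    rw [Finset.sum_add_distrib, Finset.sum_add_distrib, ← Finset.mul_sum, ← inactN_cast,
      ← psum_step (h.inv t) h0 h1, ← h.succ] at hs
    rw [cum_succ]
    have h3 : (inact q v (t + 1) : ℝ) = inact q v t + inactN (q t) (v t) := by
      simp [inact, Finset.sum_range_succ]
    rw [h3]
    have h4 : psum (q t) Φ = ∑ i ∈ Finset.range (q t).injected, Φ ((q t).packet i) := rfl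
    linarith

/-- The total weight of all active periods is at most the weight of one period times the number of
periods. -/
lemma cum_wsum_le (h : IsPath q v) {w : ℕ → ℝ} (hw : ∀ s, 0 ≤ w s) {W : ℝ}
    (hW : ∀ n, ∑ a ∈ Finset.range n, w a ≤ W) (t : ℕ) :
    cum (fun r => wsum (q r) w) t ≤ W * (inj q t + inact q v t) := by
  have hW0 : 0 ≤ W := by simpa using hW 0
  -- The potential is minus the weight already used in the current period. Each inactivation refunds
  -- a full W, and a finished packet has spent at most W on its last period.
  let Φ : Packet → ℝ := fun p => match p with
    | .inactive => 0
    | .active s _ => - ∑ a ∈ Finset.Ico 1 s, w a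
    | .done => - W
  have hle : ∀ s, ∑ a ∈ Finset.Ico 1 s, w a ≤ W := fun s =>
    (Finset.sum_le_sum_of_subset_of_nonneg (fun a ha => by
      simp at ha ⊢; omega) (fun a _ _ => hw a)).trans (hW s)
  have key := potential_bound h (Φ := Φ) rfl (by simp [Φ]) (-W)
    (fun t i => - ((q t).packet i).wt w) ?_ t
  · have h1 : cum (fun r => ∑ i ∈ Finset.range (q r).injected, -((q r).packet i).wt w) t
        = - cum (fun r => wsum (q r) w) t := by
      simp [cum, wsum, psum]
    rw [h1] at key
    have h2 : - (W * inj q t) ≤ psum (q t) Φ := by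
      have : ∑ i ∈ Finset.range (q t).injected, (-W) ≤ psum (q t) Φ := by
        refine Finset.sum_le_sum fun i _ => ?_
        cases (q t).packet i with
        | inactive => simp [Φ, hW0]
        | active s e => simpa [Φ] using hle s
        | done => simp [Φ]
      simp only [Finset.sum_const, Finset.card_range, nsmul_eq_mul] at this
      unfold inj; linarith
    linarith
  · intro t i _
    cases hp : (q t).packet i with
    | done => rw [stepPacket_done hp]; simp [Φ, Packet.wt, ind]
    | inactive =>
      rcases stepPacket_inactive (v := v t) hp with h1 | ⟨_, _, h1⟩ <;>
        rw [h1] <;> simp [Φ, Packet.wt, ind]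
    | active s e =>
      have hs : ∑ a ∈ Finset.Ico 1 (s + 1), w a = ∑ a ∈ Finset.Ico 1 s, w a + w s :=
        Finset.sum_Ico_succ_top ((h.inv t).age_pos hp) _
      have := hle (s + 1)
      rcases stepPacket_active (v := v t) hp with ⟨_, h1⟩ | ⟨_, _, h1⟩ | ⟨_, _, h1⟩ <;>
        rw [h1] <;> simp [Φ, Packet.wt, ind] <;> linarith

/-- Every inactivation is paid for by contention in empty slots. -/
lemma inact_le (h : IsPath q v) (t : ℕ) :
    (15 / 32) * (inact q v t : ℝ) ≤ cum (fun r => X (q r) / 2 * ind (v r).Emp) t := by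
  -- Half the ratio of empty slots to age. An empty slot adds 1/(2s), the packet's share of X/2, and
  -- ageing only lowers the ratio. At an inactivation the ratio of empty slots is at least 15/16, so
  -- 15/32 has been collected.
  let Φ : Packet → ℝ := fun p => match p with
    | .active s e => e / (2 * s)
    | _ => 0
  have key := potential_bound h (Φ := Φ) rfl (by simp [Φ]) (15 / 32)
    (fun t i => ((q t).packet i).wt (fun s => 1 / (s : ℝ)) / 2 * ind (v t).Emp) ?_ t
  · have h1 : 0 ≤ psum (q t) Φ := Finset.sum_nonneg fun i _ => by
      cases (q t).packet i <;> simp only [Φ] <;> positivity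
    have h2 : ∀ r, ∑ i ∈ Finset.range (q r).injected,
        ((q r).packet i).wt (fun s => 1 / (s : ℝ)) / 2 * ind (v r).Emp
        = X (q r) / 2 * ind (v r).Emp := fun r => by
      rw [← Finset.sum_mul, ← Finset.sum_div]; rfl
    simp only [h2] at key
    linarith
  · intro t i _
    have hi0 := ind_nonneg (v t).Emp
    cases hp : (q t).packet i with
    | done => rw [stepPacket_done hp]; simp [Φ, Packet.wt, ind]
    | inactive =>
      rcases stepPacket_inactive (v := v t) hp with h1 | ⟨_, _, h1⟩ <;>
        rw [h1] <;> simp [Φ, Packet.wt, ind]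
    | active s e =>
      have hs : (1 : ℝ) ≤ s := by exact_mod_cast (h.inv t).age_pos hp
      rcases stepPacket_active (v := v t) hp with ⟨_, h1⟩ | ⟨_, h2, h1⟩ | ⟨_, _, h1⟩
      · rw [h1, ind_neg (p := _ ∧ _) (by simp)]
        simp only [Φ, Packet.wt, mul_zero, add_zero]
        positivity
      · rw [h1, ind_pos ⟨⟨s, e, rfl⟩, rfl⟩]
        simp only [Φ, Packet.wt]
        have h3 : (15 : ℝ) * s ≤ 16 * (e + ind (v t).Emp) := by
          rw [← View.e_cast]; exact_mod_cast h2
        have h4 : (e : ℝ) / (2 * s) + 1 / s / 2 * ind (v t).Emp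
            = (e + ind (v t).Emp) / (2 * s) := by field_simp
        rw [h4, zero_add, mul_one, div_le_div_iff₀ (by norm_num) (by positivity)]
        linarith
      · rw [h1, ind_neg (p := _ ∧ _) (by simp)]
        simp only [Φ, Packet.wt]
        have h4 : (e : ℝ) / (2 * s) + 1 / s / 2 * ind (v t).Emp
            = (e + ind (v t).Emp) / (2 * s) := by field_simp
        rw [h4, mul_zero, add_zero, Nat.cast_add, View.e_cast]
        push_cast
        gcongr
        linarith

/-- Successes are counted by distinct packets. -/
lemma succ_count_le (h : IsPath q v) (t : ℕ) :
    cnt (fun r => (v r).Suc) t + ind (v t).Suc ≤ inj q t := by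
  classical
  -- A finished packet stays finished, and each success finishes a packet that was still active.
  have hdone : ∀ t, cnt (fun r => (v r).Suc) t ≤ psum (q t) (fun p => ind (p = .done)) := by
    intro t
    induction t with
    | zero => simp [cnt, psum, h.zero]
    | succ t ih =>
      rw [cnt_succ, h.succ, psum_step (h.inv t) (by simp [ind]) (by simp [ind])]
      have hmono : ∀ i, ind ((q t).packet i = .done) ≤ ind (stepPacket (q t) (v t) i = .done) :=
        fun i => ind_mono stepPacket_done
      by_cases hs : (v t).Suc
      · obtain ⟨j, hj⟩ := hs
        rw [ind_pos ⟨j, hj⟩]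
        obtain ⟨s, e, hp⟩ := (h.compat t).sd j (by simp [hj.2])
        have hj' : stepPacket (q t) (v t) j = .done := by
          rcases stepPacket_active (v := v t) hp with ⟨_, h1⟩ | ⟨h1, _⟩ | ⟨h1, _⟩
          exacts [h1, absurd hj h1, absurd hj h1]
        have hmem := Finset.mem_range.mpr ((h.inv t).lt_injected hp)
        simp only [psum] at ih ⊢
        rw [← Finset.add_sum_erase _ _ hmem] at ih ⊢
        rw [ind_pos hj']
        rw [ind_neg (p := (q t).packet j = .done) (by simp [hp])] at ih
        have := Finset.sum_le_sum (s := (Finset.range (q t).injected).erase j)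
          fun i _ => hmono i
        linarith
      · rw [ind_neg hs, add_zero]
        exact ih.trans (Finset.sum_le_sum fun i _ => hmono i)
  refine le_trans (add_le_add_left (hdone t) _) ?_
  have hcard : ∑ i ∈ Finset.range (q t).injected, (1 : ℝ) = inj q t := by simp [inj]
  rw [← hcard]
  -- The packet that succeeds in the current slot is injected but not yet finished, which leaves
  -- room for the extra unit.
  by_cases hs : (v t).Suc
  · obtain ⟨j, hj⟩ := hs
    rw [ind_pos ⟨j, hj⟩]
    obtain ⟨s, e, hp⟩ := (h.compat t).sd j (by simp [hj.2])
    have hmem := Finset.mem_range.mpr ((h.inv t).lt_injected hp)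
    simp only [psum]
    rw [← Finset.add_sum_erase _ _ hmem, ← Finset.add_sum_erase _ (fun _ => (1 : ℝ)) hmem]
    rw [ind_neg (p := (q t).packet j = .done) (by simp [hp])]
    have := Finset.sum_le_sum (s := (Finset.range (q t).injected).erase j)
      fun i _ => ind_le_one ((q t).packet i = .done)
    linarith
  · rw [ind_neg hs, add_zero]
    exact Finset.sum_le_sum fun i _ => ind_le_one _

end Path

/-! ### Live slots with little or no activity -/

/-- Some packet is live in the slot. -/
def Live (q : State) (v : View) : Prop := ∃ i, i < q.injected + v.arr ∧ q.packet i ≠ .done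

lemma HasActive.live {q : State} (hq : Inv q) (h : HasActive q) (v : View) : Live q v := by
  obtain ⟨i, s, e, hi⟩ := h
  exact ⟨i, (hq.lt_injected hi).trans_le (by omega), by simp [hi]⟩

lemma hasActive_of_X_pos {q : State} (h : 0 < X q) : HasActive q := by
  by_contra hn
  rw [X, wsum_eq_zero hn] at h
  exact lt_irrefl _ h

lemma one_le_X {q : State} (hq : Inv q) {i e : ℕ} (h : q.packet i = .active 1 e) : 1 ≤ X q := by
  have := le_wsum hq (w := fun s => 1 / (s : ℝ)) (fun s => by positivity) h
  rwa [Nat.cast_one, div_one] at this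

section Path

variable {q : ℕ → State} {v : ℕ → View}

/-- Most of the slots with active packets have a nonempty data channel, apart from slots with
high contention. -/
lemma active_slots_le (h : IsPath q v) (t : ℕ) :
    cnt (fun r => HasActive (q r)) t ≤
      16 * cnt (fun r => HasActive (q r) ∧ ¬ (v r).Emp) t +
        cnt (fun r => (v r).Emp ∧ 1 ≤ X (q r)) t := by
  -- The excess of the left side over the right is compared with 16e − 15(s − 1) for every active
  -- packet. Both grow by at most 1 in an empty slot and fall by at least 15 in a nonempty one; a
  -- fresh packet starts from 0.
  suffices hs : ∀ t, (cnt (fun r => HasActive (q r)) t ≤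
      16 * cnt (fun r => HasActive (q r) ∧ ¬ (v r).Emp) t +
        cnt (fun r => (v r).Emp ∧ 1 ≤ X (q r)) t) ∧
      ∀ i s e, (q t).packet i = .active s e → cnt (fun r => HasActive (q r)) t -
        16 * cnt (fun r => HasActive (q r) ∧ ¬ (v r).Emp) t -
        cnt (fun r => (v r).Emp ∧ 1 ≤ X (q r)) t ≤ 16 * e - 15 * (s - 1) from (hs t).1
  intro t
  induction t with
  | zero => simp [cnt, h.zero]
  | succ t ih =>
    obtain ⟨ih1, ih2⟩ := ih
    have hmain : cnt (fun r => HasActive (q r)) (t + 1) ≤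
        16 * cnt (fun r => HasActive (q r) ∧ ¬ (v r).Emp) (t + 1) +
          cnt (fun r => (v r).Emp ∧ 1 ≤ X (q r)) (t + 1) := by
      simp only [cnt_succ]
      by_cases ha : HasActive (q t)
      · by_cases he : (v t).Emp
        · rw [ind_pos ha, ind_neg (p := _ ∧ _) (by simp [he])]
          obtain ⟨i, s, e, hi⟩ := ha
          have h2 := ih2 i s e hi
          -- An empty slot raises the excess by one. A packet of age 1 forces X ≥ 1, so the last
          -- count compensates. An older packet satisfies 16e + 16 ≤ 15s by integrality, so the
          -- excess was at most −1.
          rcases (h.inv t).active i s e hi with ⟨rfl, rfl⟩ | h3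
          · rw [ind_pos ⟨he, one_le_X (h.inv t) hi⟩]
            linarith
          · have h4 : (16 : ℝ) * e + 16 ≤ 15 * s := by exact_mod_cast h3
            have := ind_nonneg ((v t).Emp ∧ 1 ≤ X (q t))
            linarith
        · rw [ind_pos ha, ind_pos ⟨ha, he⟩]
          have := ind_nonneg ((v t).Emp ∧ 1 ≤ X (q t))
          linarith
      · rw [ind_neg ha, ind_neg (p := HasActive (q t) ∧ _) (by simp [ha])]
        have := ind_nonneg ((v t).Emp ∧ 1 ≤ X (q t))
        linarith
    refine ⟨hmain, fun i s e hi => ?_⟩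
    rw [h.succ] at hi
    have hi' : stepPacket (q t) (v t) i = .active s e := hi
    cases hp : (q t).packet i with
    | done => rw [stepPacket_done hp] at hi'; simp at hi'
    | inactive =>
      rcases stepPacket_inactive (v := v t) hp with h1 | ⟨_, _, h1⟩
      · rw [h1] at hi'; simp at hi'
      · rw [h1] at hi'
        simp only [Packet.active.injEq] at hi'
        obtain ⟨rfl, rfl⟩ := hi'
        simp only [Nat.cast_one, Nat.cast_zero]
        linarith
    | active s' e' =>
      have h2 := ih2 i s' e' hp
      rcases stepPacket_active (v := v t) hp with ⟨_, h1⟩ | ⟨_, _, h1⟩ | ⟨_, h3, h1⟩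
      · rw [h1] at hi'; simp at hi'
      · rw [h1] at hi'; simp at hi'
      · rw [h1] at hi'
        simp only [Packet.active.injEq] at hi'
        obtain ⟨rfl, rfl⟩ := hi'
        simp only [cnt_succ]
        push_cast
        rw [View.e_cast]
        have ha : HasActive (q t) := ⟨i, s', e', hp⟩
        rw [ind_pos ha]
        have := ind_nonneg ((v t).Emp ∧ 1 ≤ X (q t))
        by_cases he : (v t).Emp
        · rw [ind_pos (p := (v t).Emp) he, ind_neg (p := HasActive (q t) ∧ _) (by simp [he])]
          linarith
        · rw [ind_neg (p := (v t).Emp) he, ind_pos (p := HasActive (q t) ∧ _) ⟨ha, he⟩]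
          linarith

/-- With no active packet the undisrupted control channel is empty, so every live packet has age 1
in the next slot and X ≥ 1 there. Each idle slot is charged to its successor; the final indicator
covers a successor that is not yet counted. -/
lemma idle_slots_le (h : IsPath q v) (t : ℕ) :
    cnt (fun r => Live (q r) (v r) ∧ ¬ (v r).Dis ∧ ¬ HasActive (q r)) t ≤
      cnt (fun r => HasActive (q r) ∧ (v r).Dis) t + cnt (fun r => ¬ (v r).Dis ∧ 1 ≤ X (q r)) t
        + ind (1 ≤ X (q t)) := by
  induction t with
  | zero => simp [cnt, ind_nonneg]
  | succ t ih =>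
    simp only [cnt_succ]
    have h0 := ind_nonneg (1 ≤ X (q (t + 1)))
    by_cases hn : Live (q t) (v t) ∧ ¬ (v t).Dis ∧ ¬ HasActive (q t)
    · obtain ⟨⟨i, hi, hd⟩, hdis, hna⟩ := hn
      have hce : (v t).CEmp := by
        refine ⟨by by_contra hj; exact hdis (Or.inr (by simpa using hj)), ?_⟩
        refine Finset.eq_empty_of_forall_notMem fun j hj => hna ?_
        exact ⟨j, (h.compat t).sc j hj⟩
      have hp : (q t).packet i = .inactive := by
        cases hp : (q t).packet i with
        | done => exact absurd hp hd
        | inactive => rfl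
        | active s e => exact absurd ⟨i, s, e, hp⟩ hna
      have hX : 1 ≤ X (q (t + 1)) := by
        refine one_le_X (h.inv (t + 1)) (i := i) (e := 0) ?_
        rw [h.succ]
        show stepPacket (q t) (v t) i = _
        simp [stepPacket, hp, hi, hce]
      have hX0 : X (q t) = 0 := wsum_eq_zero hna _
      rw [ind_pos hX]
      rw [ind_neg (p := 1 ≤ X (q t)) (by simp [hX0])] at ih
      have h1 := ind_le_one (Live (q t) (v t) ∧ ¬(v t).Dis ∧ ¬HasActive (q t))
      have h2 := ind_nonneg (HasActive (q t) ∧ (v t).Dis)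
      have h3 := ind_nonneg (¬ (v t).Dis ∧ 1 ≤ X (q t))
      linarith
    · rw [ind_neg hn]
      have h2 := ind_nonneg (HasActive (q t) ∧ (v t).Dis)
      have h3 := ind_nonneg (¬ (v t).Dis ∧ 1 ≤ X (q t))
      by_cases hX : 1 ≤ X (q t)
      · rw [ind_pos (p := 1 ≤ X (q t)) hX] at ih
        by_cases hd : (v t).Dis
        · rw [ind_pos (p := HasActive (q t) ∧ _) ⟨hasActive_of_X_pos (by linarith), hd⟩]
          linarith
        · rw [ind_pos (p := ¬ (v t).Dis ∧ _) ⟨hd, hX⟩]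
          linarith
      · rw [ind_neg (p := 1 ≤ X (q t)) hX] at ih
        linarith

/-! ### The clock and the decay of high contention -/

/-- The clock is reset after the slot: the control channel is empty, or at least `15 / 16` of the
data slots since the last reset were empty. -/
def Reset (v : View) (k : ℕ × ℕ) : Prop := v.CEmp ∨ 15 * k.1 ≤ 16 * (k.2 + v.e)

open Classical in
def clockStep (v : View) (k : ℕ × ℕ) : ℕ × ℕ :=
  if Reset v k then (1, 0) else (k.1 + 1, k.2 + v.e)

/-- The index of the slot since the last reset, and the number of empty data slots before it. -/
def clock (v : ℕ → View) : ℕ → ℕ × ℕ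
  | 0 => (1, 0)
  | t + 1 => clockStep (v t) (clock v t)

/-- Each active packet is at least as old as the clock, and before the last reset it saw at most a
15/16-fraction of empty slots. Hence a packet can become inactive only if the clock's own fraction
reaches 15/16, that is, at a reset. -/
structure ClockInv (q : State) (k : ℕ × ℕ) : Prop where
  pos : 1 ≤ k.1
  active : ∀ i s e, q.packet i = .active s e → k.1 ≤ s ∧ 16 * e + 15 * k.1 ≤ 15 * s + 16 * k.2

/-- Without a reset, no packet changes between active and inactive. -/
lemma stepPacket_of_not_reset {q : State} {v : View} {k : ℕ × ℕ} (hk : ClockInv q k)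
    (hr : ¬ Reset v k) (i : ℕ) :
    (∃ s e, q.packet i = .active s e ∧ ((v.Succ i ∧ stepPacket q v i = .done) ∨
      (¬ v.Succ i ∧ stepPacket q v i = .active (s + 1) (e + v.e)))) ∨
    ((∀ s e, q.packet i ≠ .active s e) ∧ stepPacket q v i = q.packet i) := by
  simp only [Reset, not_or, not_le] at hr
  cases hp : q.packet i with
  | done => right; simp [stepPacket_done hp]
  | inactive =>
    right
    rcases stepPacket_inactive (v := v) hp with h1 | ⟨h1, _⟩
    · simp [h1]
    · exact absurd h1 hr.1
  | active s e =>
    left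
    refine ⟨s, e, rfl, ?_⟩
    have := (hk.active i s e hp).2
    rcases stepPacket_active (v := v) hp with h1 | ⟨_, h1, _⟩ | ⟨h1, _, h2⟩
    · exact Or.inl h1
    · omega
    · exact Or.inr ⟨h1, h2⟩

lemma clockInv (h : IsPath q v) (t : ℕ) : ClockInv (q t) (clock v t) := by
  induction t with
  | zero => constructor <;> simp [clock, h.zero]
  | succ t ih =>
    by_cases hr : Reset (v t) (clock v t)
    · have hc : clock v (t + 1) = (1, 0) := by simp [clock, clockStep, hr]
      rw [hc]
      refine ⟨le_rfl, fun i s e hi => ?_⟩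
      rcases (h.inv (t + 1)).active i s e hi with h1 | h1 <;> constructor <;> simp <;> omega
    · have hc : clock v (t + 1) = ((clock v t).1 + 1, (clock v t).2 + (v t).e) := by
        simp [clock, clockStep, hr]
      rw [hc]
      refine ⟨by simp, fun i s e hi => ?_⟩
      rw [h.succ] at hi
      have hi' : stepPacket (q t) (v t) i = .active s e := hi
      rcases stepPacket_of_not_reset ih hr i with ⟨s', e', hp, h1 | h1⟩ | h1
      · rw [h1.2] at hi'; simp at hi'
      · rw [h1.2] at hi'
        simp only [Packet.active.injEq] at hi'
        have := ih.active i s' e' hp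
        simp; omega
      · rw [h1.2] at hi'
        exact absurd hi' (h1.1 s e)

lemma wsum_step_of_not_reset {q : State} {v : View} (hq : Inv q) {k : ℕ × ℕ} (hk : ClockInv q k)
    (hr : ¬ Reset v k) (w : ℕ → ℝ) :
    wsum (step q v) w = ∑ i ∈ Finset.range q.injected, (stepPacket q v i).wt w := by
  refine psum_step_of fun i hi => ?_
  rcases stepPacket_of_not_reset hk hr i with ⟨s, e, hp, _⟩ | h1
  · rw [hq.inactive i hi] at hp; simp at hp
  · rw [h1.2, hq.inactive i hi]; rfl

lemma wsum_step_le {q : State} {v : View} (hq : Inv q) {k : ℕ × ℕ} (hk : ClockInv q k)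
    (hr : ¬ Reset v k) {w : ℕ → ℝ} (hw : ∀ s, 0 ≤ w s) (ha : ∀ s, 1 ≤ s → w (s + 1) ≤ w s) :
    wsum (step q v) w ≤ wsum q w := by
  rw [wsum_step_of_not_reset hq hk hr]
  refine Finset.sum_le_sum fun i _ => ?_
  rcases stepPacket_of_not_reset hk hr i with ⟨s, e, hp, h1 | h1⟩ | h1
  · rw [h1.2, hp]; exact hw s
  · rw [h1.2, hp]; exact ha s (hq.age_pos hp)
  · rw [h1.2]

lemma X_step_le {q : State} {v : View} (hq : Inv q) {k : ℕ × ℕ} (hk : ClockInv q k)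
    (hr : ¬ Reset v k) : X (step q v) ≤ X q := by
  refine wsum_step_le hq hk hr (fun s => by positivity) fun s hs => ?_
  have : (0 : ℝ) < s := by exact_mod_cast hs
  push_cast
  gcongr
  linarith

/-- Ages are at least k, so k/s ≤ (k + 1)/(s + 1) for every packet that stays, and a successful
packet takes away at most k/s ≤ 1. Thus X cannot decay faster than 1/k except through successes. -/
lemma clock_mul_X_le {q : State} {v : View} (hq : Inv q) {k : ℕ × ℕ} (hk : ClockInv q k)
    (hr : ¬ Reset v k) : k.1 * X q ≤ (k.1 + 1) * X (step q v) + ind v.Suc := by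
  have h1 : ∑ i ∈ Finset.range q.injected, ind (v.Succ i) ≤ ind v.Suc := by
    by_cases hs : v.Suc
    · obtain ⟨j, hj⟩ := hs
      rw [ind_pos ⟨j, hj⟩]
      have h2 : ∀ i ∈ Finset.range q.injected, ind (v.Succ i) ≤ if i = j then 1 else 0 := by
        intro i _
        split_ifs with hij
        · exact ind_le_one _
        · rw [ind_neg]
          intro hi
          have := hi.2.symm.trans hj.2
          exact hij (Finset.singleton_injective this)
      refine (Finset.sum_le_sum h2).trans ?_
      rw [Finset.sum_ite_eq']
      split_ifs <;> norm_num
    · rw [ind_neg hs]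
      exact Finset.sum_nonpos fun i _ => (ind_neg (fun hi => hs ⟨i, hi⟩)).le
  refine le_trans ?_ (add_le_add_right h1 _)
  rw [show X (step q v) = _ from wsum_step_of_not_reset hq hk hr _, X, wsum, psum, Finset.mul_sum, Finset.mul_sum,
    ← Finset.sum_add_distrib]
  refine Finset.sum_le_sum fun i _ => ?_
  have hi0 := ind_nonneg (v.Succ i)
  rcases stepPacket_of_not_reset hk hr i with ⟨s, e, hp, h1 | h1⟩ | h1
  · rw [h1.2, hp, ind_pos h1.1]
    have hs : (1 : ℝ) ≤ s := by exact_mod_cast hq.age_pos hp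
    have hks : (k.1 : ℝ) ≤ s := by exact_mod_cast (hk.active i s e hp).1
    simp only [Packet.wt]
    rw [mul_one_div, mul_zero, zero_add, div_le_one (by linarith)]
    exact hks
  · rw [h1.2, hp]
    have hs : (1 : ℝ) ≤ s := by exact_mod_cast hq.age_pos hp
    have hks : (k.1 : ℝ) ≤ s := by exact_mod_cast (hk.active i s e hp).1
    simp only [Packet.wt]
    have : (k.1 : ℝ) * (1 / s) ≤ (k.1 + 1) * (1 / ((s + 1 : ℕ) : ℝ)) := by
      rw [mul_one_div, mul_one_div, div_le_div_iff₀ (by linarith) (by push_cast; linarith)]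
      push_cast
      linarith
    linarith
  · rw [h1.2]
    have : 0 ≤ (q.packet i).wt (fun s => 1 / (s : ℝ)) := Packet.wt_nonneg (fun s => by positivity) _
    linarith

/-- The amount of time lost by resets under high contention. -/
def bad (b : ℝ) (q : ℕ → State) (v : ℕ → View) (p : ℕ → Prop) : ℕ → ℝ :=
  cum fun r => ind (b ≤ X (q r) ∧ p r) * (clock v r).1

lemma exists_int_ind (p : Prop) : ∃ z : ℤ, ind p = z := by
  by_cases h : p
  · exact ⟨1, by simp [ind_pos h]⟩
  · exact ⟨0, by simp [ind_neg h]⟩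

/-- Slots of very high contention are followed by slots of high contention, unless there is a
reset. -/
lemma high_slots_le {b : ℝ} (hb : 1 ≤ b) (h : IsPath q v) {t : ℕ}
    (ht : (clock v t).1 = 1 ∨ X (q t) < b) :
    cnt (fun r => 2 * b < X (q r)) t ≤ cnt (fun r => b ≤ X (q r) ∧ X (q r) ≤ 2 * b) t +
      cnt (fun r => (v r).Suc) t + bad b q v (fun r => Reset (v r) (clock v r)) t := by
  set L : ℕ → ℝ := fun t => cnt (fun r => b ≤ X (q r) ∧ X (q r) ≤ 2 * b) t +
      cnt (fun r => (v r).Suc) t + bad b q v (fun r => Reset (v r) (clock v r)) t -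
      cnt (fun r => 2 * b < X (q r)) t with hL
  -- Integrality turns L > −1 into L ≥ 0 when X drops below b.
  have hint : ∀ t, ∃ z : ℤ, L t = z := by
    intro t
    induction t with
    | zero => exact ⟨0, by simp [hL, cnt, bad]⟩
    | succ t ih =>
      obtain ⟨z, hz⟩ := ih
      obtain ⟨z1, h1⟩ := exists_int_ind (b ≤ X (q t) ∧ X (q t) ≤ 2 * b)
      obtain ⟨z2, h2⟩ := exists_int_ind (v t).Suc
      obtain ⟨z3, h3⟩ := exists_int_ind (b ≤ X (q t) ∧ Reset (v t) (clock v t))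
      obtain ⟨z4, h4⟩ := exists_int_ind (2 * b < X (q t))
      refine ⟨z + z1 + z2 + z3 * (clock v t).1 - z4, ?_⟩
      push_cast
      rw [← hz, ← h1, ← h2, ← h3, ← h4]
      simp only [hL, cnt_succ, bad, cum_succ]
      ring
  -- In a phase with X ≥ b the deficit is at most kX/b − (k − 1), which is less than 1 once X passes
  -- below b. The cruder bound k − 1 is what the charge k at a reset repays.
  suffices hs : ∀ t, -(((clock v t).1 : ℝ) - 1) ≤ L t ∧
      (b ≤ X (q t) → ((clock v t).1 : ℝ) - 1 - (clock v t).1 * X (q t) / b ≤ L t) ∧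
      (X (q t) < b → 0 ≤ L t) by
    have : 0 ≤ L t := by
      rcases ht with h1 | h1
      · have := (hs t).1
        rw [h1] at this
        simpa using this
      · exact (hs t).2.2 h1
    simp only [hL] at this
    linarith
  have hb0 : 0 < b := by linarith
  intro t
  induction t with
  | zero =>
    have hL0 : L 0 = 0 := by simp [hL, cnt, bad]
    have hX0 : X (q 0) = 0 := by simp [X, wsum, psum, h.zero]
    rw [hL0, hX0]
    simp [clock]
  | succ t ih =>
    obtain ⟨ih1, ih2, ih3⟩ := ih
    have hk1 : (1 : ℝ) ≤ (clock v t).1 := by exact_mod_cast (clockInv h t).pos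
    have hXn := X_nonneg (q (t + 1))
    have hLs : L (t + 1) = L t + ind (b ≤ X (q t) ∧ X (q t) ≤ 2 * b) + ind (v t).Suc +
        ind (b ≤ X (q t) ∧ Reset (v t) (clock v t)) * (clock v t).1 - ind (2 * b < X (q t)) := by
      simp only [hL, cnt_succ, bad, cum_succ]
      ring
    have i1 := ind_nonneg (b ≤ X (q t) ∧ X (q t) ≤ 2 * b)
    have i2 := ind_nonneg (v t).Suc
    have i3 := ind_nonneg (b ≤ X (q t) ∧ Reset (v t) (clock v t))
    have i4 := ind_le_one (2 * b < X (q t))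
    by_cases hX : b ≤ X (q t)
    · have ih2 := ih2 hX
      by_cases hr : Reset (v t) (clock v t)
      · have hc : clock v (t + 1) = (1, 0) := by simp [clock, clockStep, hr]
        rw [ind_pos (p := b ≤ X (q t) ∧ _) ⟨hX, hr⟩] at hLs
        have hnn : 0 ≤ L (t + 1) := by linarith
        rw [hc]
        refine ⟨by simpa using hnn, fun _ => ?_, fun _ => hnn⟩
        have : 0 ≤ X (q (t + 1)) / b := by positivity
        simp only [Nat.cast_one, one_mul]
        linarith
      · have hc : clock v (t + 1) = ((clock v t).1 + 1, (clock v t).2 + (v t).e) := by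
          simp [clock, clockStep, hr]
        rw [ind_neg (p := _ ∧ Reset _ _) (by simp [hr]), zero_mul, add_zero] at hLs
        have hmul := clock_mul_X_le (h.inv t) (clockInv h t) hr
        rw [← h.succ] at hmul
        have hsb : ind (v t).Suc / b ≤ ind (v t).Suc := div_le_self i2 hb
        have hdiv : (clock v t).1 * X (q t) / b ≤
            ((clock v t).1 + 1) * X (q (t + 1)) / b + ind (v t).Suc / b := by
          rw [← add_div]; gcongr
        -- For b ≤ X ≤ 2b the unit gained by L matches the growth of k. For X > 2b a unit is lost,
        -- but kX/b ≥ 2k, so the crude bound −(k − 1) ≤ L is already enough.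
        have target : ((clock v t).1 : ℝ) - ((clock v t).1 + 1) * X (q (t + 1)) / b
            ≤ L (t + 1) := by
          by_cases hX2 : X (q t) ≤ 2 * b
          · rw [ind_pos (p := b ≤ X (q t) ∧ _) ⟨hX, hX2⟩, ind_neg (p := 2 * b < X (q t))
              (not_lt.mpr hX2)] at hLs
            linarith
          · have : 2 * ((clock v t).1 : ℝ) ≤ (clock v t).1 * X (q t) / b := by
              rw [le_div_iff₀ hb0]
              nlinarith [not_le.mp hX2]
            linarith
        rw [hc]
        simp only [Nat.cast_add, Nat.cast_one]
        refine ⟨by linarith, fun _ => by linarith, fun hlt => ?_⟩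
        have h3 : ((clock v t).1 + 1) * X (q (t + 1)) / b < (clock v t).1 + 1 := by
          rw [div_lt_iff₀ hb0]
          nlinarith
        obtain ⟨z, hz⟩ := hint (t + 1)
        rw [hz] at target ⊢
        have h4 : (-1 : ℝ) < z := by linarith
        have h5 : (-1 : ℤ) < z := by exact_mod_cast h4
        exact_mod_cast (by omega : (0 : ℤ) ≤ z)
    · have hX' := not_le.mp hX
      have hLt := ih3 hX'
      rw [ind_neg (p := 2 * b < X (q t)) (by linarith), ind_neg (p := _ ∧ _) (by simp [hX]),
        ind_neg (p := b ≤ X (q t) ∧ _) (by simp [hX])] at hLs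
      have hnn : 0 ≤ L (t + 1) := by linarith
      have hk2 : (1 : ℝ) ≤ (clock v (t + 1)).1 := by exact_mod_cast (clockInv h (t + 1)).pos
      refine ⟨by linarith, fun hge => ?_, fun _ => hnn⟩
      by_cases hr : Reset (v t) (clock v t)
      · have hc : clock v (t + 1) = (1, 0) := by simp [clock, clockStep, hr]
        rw [hc]
        have : 0 ≤ X (q (t + 1)) / b := by positivity
        simp only [Nat.cast_one, one_mul]
        linarith
      · have := X_step_le (h.inv t) (clockInv h t) hr
        rw [← h.succ] at this
        linarith

/-- Time lost by resets due to empty data slots is bounded by the number of such slots. -/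
lemma bad_data_le (h : IsPath q v) (b : ℝ) (t : ℕ) :
    15 * bad b q v (fun r => ¬ (v r).CEmp ∧ Reset (v r) (clock v r)) t +
      16 * ((clock v t).2 * ind (b ≤ X (q t))) ≤ 16 * cnt (fun r => (v r).Emp ∧ b ≤ X (q r)) t := by
  induction t with
  | zero => simp [bad, cnt, clock]
  | succ t ih =>
    simp only [bad, cum_succ, cnt_succ] at ih ⊢
    have i1 := ind_nonneg ((v t).Emp ∧ b ≤ X (q t))
    by_cases hr : Reset (v t) (clock v t)
    · have hc : clock v (t + 1) = (1, 0) := by simp [clock, clockStep, hr]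
      rw [hc]
      by_cases hX : b ≤ X (q t)
      · rw [ind_pos (p := b ≤ X (q t)) hX] at ih
        by_cases hce : (v t).CEmp
        · rw [ind_neg (p := _ ∧ _ ∧ _) (by simp [hce])]
          have : (0 : ℝ) ≤ (clock v t).2 := by positivity
          simp only [Nat.cast_zero, zero_mul, mul_zero, add_zero]
          linarith
        · rw [ind_pos (p := _ ∧ _ ∧ _) ⟨hX, hce, hr⟩]
          have h1 : 15 * (clock v t).1 ≤ 16 * ((clock v t).2 + (v t).e) := hr.resolve_left hce
          have h2 : (15 : ℝ) * (clock v t).1 ≤ 16 * ((clock v t).2 + ind (v t).Emp) := by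
            rw [← View.e_cast]; exact_mod_cast h1
          have h3 : ind (v t).Emp ≤ ind ((v t).Emp ∧ b ≤ X (q t)) := ind_mono fun he => ⟨he, hX⟩
          simp only [Nat.cast_zero, zero_mul, mul_zero, add_zero]
          linarith
      · rw [ind_neg (p := b ≤ X (q t) ∧ _) (by simp [hX])]
        have : (0 : ℝ) ≤ (clock v t).2 * ind (b ≤ X (q t)) := mul_nonneg (by positivity) (ind_nonneg _)
        simp only [Nat.cast_zero, zero_mul, mul_zero, add_zero]
        linarith
    · have hc : clock v (t + 1) = ((clock v t).1 + 1, (clock v t).2 + (v t).e) := by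
        simp [clock, clockStep, hr]
      rw [hc, ind_neg (p := b ≤ X (q t) ∧ _) (by simp [hr])]
      have hle := X_step_le (h.inv t) (clockInv h t) hr
      rw [← h.succ] at hle
      simp only [Nat.cast_add, View.e_cast, zero_mul, add_zero]
      by_cases hX : b ≤ X (q t)
      · rw [ind_pos (p := b ≤ X (q t)) hX] at ih
        have h3 : ind (v t).Emp ≤ ind ((v t).Emp ∧ b ≤ X (q t)) := ind_mono fun he => ⟨he, hX⟩
        have h4 : ((clock v t).2 + ind (v t).Emp) * ind (b ≤ X (q (t + 1))) ≤
            (clock v t).2 + ind (v t).Emp :=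
          mul_le_of_le_one_right (add_nonneg (by positivity) (ind_nonneg _)) (ind_le_one _)
        linarith
      -- Without a reset X cannot rise back to b. So if X ≥ b when a phase ends, all its empty slots
      -- had X ≥ b and may be charged.
      · rw [ind_neg (p := b ≤ X (q (t + 1))) (by intro h'; exact hX (h'.trans hle))]
        have : (0 : ℝ) ≤ (clock v t).2 * ind (b ≤ X (q t)) := mul_nonneg (by positivity) (ind_nonneg _)
        linarith

/-- High contention does not persist without a reset. -/
lemma exists_settled (h : IsPath q v) {b : ℝ} (hb : 1 ≤ b) (t₀ : ℕ) :
    ∃ t, t₀ ≤ t ∧ ((clock v t).1 = 1 ∨ X (q t) < b) := by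
  by_contra hcon
  push Not at hcon
  have hr : ∀ t, t₀ ≤ t → ¬ Reset (v t) (clock v t) := by
    intro t ht hr
    refine (hcon (t + 1) (by omega)).1 ?_
    simp [clock, clockStep, hr]
  have hk : ∀ j, j ≤ (clock v (t₀ + j)).1 := by
    intro j
    induction j with
    | zero => omega
    | succ j ih =>
      rw [← add_assoc]
      have := hr (t₀ + j) (by omega)
      simp only [clock, clockStep, if_neg this]
      omega
  have hA : ∀ j, wsum (q (t₀ + j)) (fun _ => 1) ≤ wsum (q t₀) (fun _ => 1) := by
    intro j
    induction j with
    | zero => simp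
    | succ j ih =>
      rw [← add_assoc, h.succ]
      exact (wsum_step_le (h.inv _) (clockInv h _) (hr _ (by omega)) (fun _ => zero_le_one)
        fun _ _ => le_rfl).trans ih
  -- kX is at most the number of active packets, which does not grow without a reset, while k tends
  -- to infinity; so X ≥ b ≥ 1 cannot last.
  have hXA : ∀ t, (clock v t).1 * X (q t) ≤ wsum (q t) (fun _ => 1) := by
    intro t
    rw [X, wsum, psum, Finset.mul_sum]
    refine Finset.sum_le_sum fun i _ => ?_
    cases hp : (q t).packet i with
    | active s e =>
      have hs : (1 : ℝ) ≤ s := by exact_mod_cast (h.inv t).age_pos hp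
      have hks : ((clock v t).1 : ℝ) ≤ s := by exact_mod_cast ((clockInv h t).active i s e hp).1
      simp only [Packet.wt]
      rw [mul_one_div, div_le_one (by linarith)]
      exact hks
    | _ => simp [Packet.wt]
  obtain ⟨j, hj⟩ := exists_nat_gt (wsum (q t₀) fun _ => 1)
  have h1 := hXA (t₀ + j)
  have h2 := hA j
  have h3 := (hcon (t₀ + j) (by omega)).2
  have h4 : (j : ℝ) ≤ (clock v (t₀ + j)).1 := by exact_mod_cast hk j
  have h5 : (0 : ℝ) ≤ (clock v (t₀ + j)).1 := by positivity
  nlinarith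

end Path

/-! ### Measurability through countable ranges -/

section Adapt

variable {Ω : Type*} {m m' : MeasurableSpace Ω} {β γ : Type*}

/-- A function with countable range and measurable fibres. -/
def Adapt (m : MeasurableSpace Ω) (f : Ω → β) : Prop :=
  (Set.range f).Countable ∧ ∀ b, MeasurableSet[m] (f ⁻¹' {b})

/-- The preimage of any set is a countable union of fibres. States and views therefore need no
σ-algebra, and every function of them is measurable. -/
lemma Adapt.measurableSet {f : Ω → β} (hf : Adapt m f) (s : Set β) : MeasurableSet[m] (f ⁻¹' s) := by
  have : f ⁻¹' s = ⋃ b ∈ s ∩ Set.range f, f ⁻¹' {b} := by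
    ext ω; simp
  rw [this]
  exact MeasurableSet.biUnion (hf.1.mono Set.inter_subset_right) fun b _ => hf.2 b

lemma Adapt.comp {f : Ω → β} (hf : Adapt m f) (g : β → γ) : Adapt m fun ω => g (f ω) := by
  refine ⟨?_, fun b => hf.measurableSet (g ⁻¹' {b})⟩
  have : Set.range (fun ω => g (f ω)) = g '' Set.range f := (Set.range_comp g f)
  rw [this]
  exact hf.1.image g

lemma Adapt.prodMk {f : Ω → β} {g : Ω → γ} (hf : Adapt m f) (hg : Adapt m g) :
    Adapt m fun ω => (f ω, g ω) := by
  refine ⟨(hf.1.prod hg.1).mono ?_, fun b => ?_⟩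
  · rintro _ ⟨ω, rfl⟩
    exact ⟨⟨ω, rfl⟩, ⟨ω, rfl⟩⟩
  · have : (fun ω => (f ω, g ω)) ⁻¹' {b} = f ⁻¹' {b.1} ∩ g ⁻¹' {b.2} := by
      ext ω; simp [Prod.ext_iff]
    rw [this]
    exact (hf.2 _).inter (hg.2 _)

lemma Adapt.mono (h : m ≤ m') {f : Ω → β} (hf : Adapt m f) : Adapt m' f :=
  ⟨hf.1, fun b => h _ (hf.2 b)⟩

lemma adapt_const (b : β) : Adapt m fun _ : Ω => b :=
  ⟨(Set.countable_singleton b).mono Set.range_const_subset, fun _ => MeasurableSet.const _⟩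

lemma Adapt.measurable [MeasurableSpace β] {f : Ω → β} (hf : Adapt m f) : Measurable[m] f :=
  fun s _ => hf.measurableSet s

lemma adapt_of_measurable [Countable β] [MeasurableSpace β] [MeasurableSingletonClass β] {f : Ω → β}
    (hf : Measurable[m] f) : Adapt m f :=
  ⟨Set.to_countable _, fun b => hf (measurableSet_singleton b)⟩

lemma adapt_finset {f : Ω → Finset ℕ} (hf : ∀ i, MeasurableSet[m] {ω | i ∈ f ω}) : Adapt m f := by
  refine ⟨Set.to_countable _, fun b => ?_⟩
  have : f ⁻¹' {b} = ⋂ i, {ω | i ∈ f ω ↔ i ∈ b} := by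
    ext ω; simp [Finset.ext_iff]
  rw [this]
  refine MeasurableSet.iInter fun i => ?_
  by_cases hi : i ∈ b
  · simpa [hi] using hf i
  · have h : {ω | i ∈ f ω ↔ i ∈ b} = {ω | i ∈ f ω}ᶜ := by ext ω; simp [hi]
    rw [h]
    exact (hf i).compl

end Adapt

/-! ### Exponential supermartingales and conditioning on the past -/

section Ville

variable {Ω : Type*} [mΩ : MeasurableSpace Ω] {μ : Measure Ω}
  {ℱ : Filtration ℕ mΩ}

/-- The partial sums of `u`, frozen once they exceed `N`. -/
def frozen (u : ℕ → Ω → ℝ) (N : ℝ) : ℕ → Ω → ℝ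
  | 0, _ => 0
  | t + 1, ω => frozen u N t ω + Set.indicator {ω | frozen u N t ω ≤ N} (u t) ω

lemma measurable_frozen {u : ℕ → Ω → ℝ} (hu : ∀ t, Measurable[ℱ (t + 1)] (u t)) (N : ℝ) (t : ℕ) :
    Measurable[ℱ t] (frozen u N t) := by
  induction t with
  | zero => exact measurable_const
  | succ t ih =>
    have ih' : Measurable[ℱ (t + 1)] (frozen u N t) := ih.mono (ℱ.mono (Nat.le_succ t)) le_rfl
    exact ih'.add ((hu t).indicator (measurableSet_le ih' measurable_const))

/-- If the conditional exponential moments of the increments are at most one, the partial sums are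
almost surely bounded above. -/
theorem ae_bddAbove_of_exp [IsProbabilityMeasure μ] {u : ℕ → Ω → ℝ} (hu : ∀ t, Measurable[ℱ (t + 1)] (u t))
    (H : ∀ t (f : Ω → ENNReal), Measurable[ℱ t] f →
      ∫⁻ ω, f ω * ENNReal.ofReal (Real.exp (u t ω)) ∂μ ≤ ∫⁻ ω, f ω ∂μ) :
    ∀ᵐ ω ∂μ, ∃ B, ∀ t, cum (fun r => u r ω) t ≤ B := by
  have hfro := fun N t => measurable_frozen hu N t
  have hfro' : ∀ N t, Measurable (frozen u N t) := fun N t => (hfro N t).mono (ℱ.le t) le_rfl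
  -- The exponential of the frozen sum has nonincreasing expectation: where the sum still moves, the
  -- hypothesis applies with the past as weight; elsewhere nothing changes.
  have h1 : ∀ N t, ∫⁻ ω, ENNReal.ofReal (Real.exp (frozen u N t ω)) ∂μ ≤ 1 := by
    intro N t
    induction t with
    | zero => simp [frozen]
    | succ t ih =>
      refine le_trans ?_ ih
      set S := {ω | frozen u N t ω ≤ N} with hS
      have hSm : MeasurableSet[ℱ t] S := measurableSet_le (hfro N t) measurable_const
      have hSm' : MeasurableSet S := ℱ.le t _ hSm
      set g : Ω → ENNReal := fun ω => ENNReal.ofReal (Real.exp (frozen u N t ω)) with hg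
      have hgm : Measurable[ℱ t] g :=
        ENNReal.measurable_ofReal.comp (Real.measurable_exp.comp (hfro N t))
      have hgm' : Measurable g := hgm.mono (ℱ.le t) le_rfl
      have hsplit : ∀ ω, ENNReal.ofReal (Real.exp (frozen u N (t + 1) ω)) =
          S.indicator g ω * ENNReal.ofReal (Real.exp (u t ω)) + Sᶜ.indicator g ω := by
        intro ω
        by_cases hω : ω ∈ S
        · have : frozen u N (t + 1) ω = frozen u N t ω + u t ω := by
            simp only [frozen]; rw [Set.indicator_of_mem (by exact hω)]
          rw [this, Real.exp_add, ENNReal.ofReal_mul (Real.exp_pos _).le]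
          simp [hω, hg]
        · have : frozen u N (t + 1) ω = frozen u N t ω := by
            simp only [frozen]; rw [Set.indicator_of_notMem (by exact hω), add_zero]
          rw [this]
          simp [hω, hg]
      rw [lintegral_congr hsplit]
      rw [lintegral_add_right _ (hgm'.indicator hSm'.compl)]
      calc _ ≤ ∫⁻ ω, S.indicator g ω ∂μ + ∫⁻ ω, Sᶜ.indicator g ω ∂μ := by
            refine add_le_add_left ?_ _
            exact H t _ (hgm.indicator hSm)
        _ = ∫⁻ ω, g ω ∂μ := by
            rw [lintegral_indicator hSm', lintegral_indicator hSm'.compl,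
              lintegral_add_compl _ hSm']
  -- A sum frozen above N stays there, so the events increase in t and Markov's inequality at each
  -- fixed time bounds their union.
  have h2 : ∀ N : ℝ, μ (⋃ t, {ω | N < frozen u N t ω}) ≤ ENNReal.ofReal (Real.exp (-N)) := by
    intro N
    have hmono : Monotone fun t => {ω | N < frozen u N t ω} := by
      refine monotone_nat_of_le_succ fun t ω hω => ?_
      have hω' : N < frozen u N t ω := hω
      show N < frozen u N (t + 1) ω
      simp only [frozen]
      rw [Set.indicator_of_notMem (by simpa using hω'), add_zero]
      exact hω'
    rw [hmono.measure_iUnion]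
    refine iSup_le fun t => ?_
    have hsub : {ω | N < frozen u N t ω} ⊆ {ω | ENNReal.ofReal (Real.exp N) ≤
        ENNReal.ofReal (Real.exp (frozen u N t ω))} := fun ω hω =>
      ENNReal.ofReal_le_ofReal (Real.exp_le_exp.mpr (le_of_lt hω))
    refine (measure_mono hsub).trans ?_
    have hm := meas_ge_le_lintegral_div (μ := μ)
      (f := fun ω => ENNReal.ofReal (Real.exp (frozen u N t ω)))
      (ENNReal.measurable_ofReal.comp (Real.measurable_exp.comp (hfro' N t))).aemeasurable
      (ε := ENNReal.ofReal (Real.exp N)) (by simp [Real.exp_pos]) ENNReal.ofReal_ne_top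
    refine hm.trans ((ENNReal.div_le_div_right (h1 N t) _).trans ?_)
    rw [Real.exp_neg, ENNReal.ofReal_inv_of_pos (Real.exp_pos _), one_div]
  have h3 : μ {ω | ¬ ∃ B, ∀ t, cum (fun r => u r ω) t ≤ B} ≤ 0 := by
    have hlim : Filter.Tendsto (fun N : ℝ => ENNReal.ofReal (Real.exp (-N))) Filter.atTop
        (nhds 0) := by
      have := ENNReal.tendsto_ofReal (Real.tendsto_exp_neg_atTop_nhds_zero)
      simpa using this
    refine ge_of_tendsto' hlim fun N => (measure_mono ?_).trans (h2 N)
    intro ω hω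
    by_contra hn
    simp only [Set.mem_iUnion, Set.mem_ofPred_eq, not_exists, not_lt] at hn
    refine hω ⟨N, fun t => ?_⟩
    have : ∀ t, frozen u N t ω = cum (fun r => u r ω) t := by
      intro t
      induction t with
      | zero => simp [frozen]
      | succ t ih =>
        rw [cum_succ, ← ih]
        simp only [frozen]
        rw [Set.indicator_of_mem (by exact hn t)]
    rw [← this t]
    exact hn t
  exact le_antisymm h3 zero_le

/-- Conditioning on the past: functions of an adapted quantity and of an independent source. -/
theorem lintegral_mul_le_of_indep {m₁ m₂ : MeasurableSpace Ω} (h₁ : m₁ ≤ mΩ) (h₂ : m₂ ≤ mΩ)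
    (hind : Indep m₁ m₂ μ) {α : Type*} {a : Ω → α} (ha : Adapt m₁ a) {F : α → Ω → ENNReal}
    (hF : ∀ x, Measurable[m₂] (F x)) (hF1 : ∀ ω, ∫⁻ ω', F (a ω) ω' ∂μ ≤ 1) {f : Ω → ENNReal}
    (hf : Measurable[m₁] f) : ∫⁻ ω, f ω * F (a ω) ω ∂μ ≤ ∫⁻ ω, f ω ∂μ := by
  have : Countable (Set.range a) := ha.1.to_subtype
  -- Splitting over the countably many values of a replaces F (a ω) by a fixed function in each
  -- term, to which independence applies.
  have hdec : ∀ g : Set.range a → Ω → ENNReal, ∀ ω,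
      ∑' x : Set.range a, (a ⁻¹' {x.1}).indicator f ω * g x ω = f ω * g ⟨a ω, ω, rfl⟩ ω := by
    intro g ω
    rw [tsum_eq_single ⟨a ω, ω, rfl⟩]
    · simp
    · intro x hx
      rw [Set.indicator_of_notMem, zero_mul]
      intro h
      exact hx (Subtype.ext h.symm)
  have hfm : ∀ x : Set.range a, Measurable[m₁] ((a ⁻¹' {x.1}).indicator f) := fun x =>
    hf.indicator (ha.2 _)
  calc ∫⁻ ω, f ω * F (a ω) ω ∂μ
      = ∫⁻ ω, ∑' x : Set.range a, (a ⁻¹' {x.1}).indicator f ω * F x ω ∂μ :=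
        lintegral_congr fun ω => (hdec (fun x => F x) ω).symm
    _ = ∑' x : Set.range a, ∫⁻ ω, (a ⁻¹' {x.1}).indicator f ω * F x ω ∂μ :=
        lintegral_tsum fun x => (((hfm x).mono h₁ le_rfl).mul ((hF x).mono h₂ le_rfl)).aemeasurable
    _ ≤ ∑' x : Set.range a, ∫⁻ ω, (a ⁻¹' {x.1}).indicator f ω * 1 ∂μ := by
        refine ENNReal.tsum_le_tsum fun x => ?_
        rw [lintegral_mul_eq_lintegral_mul_lintegral_of_independent_measurableSpace h₁ h₂ hind
          (hfm x) (hF x)]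
        obtain ⟨_, ω, rfl⟩ := x
        simp only [mul_one]
        exact mul_le_of_le_one_right zero_le (hF1 ω)
    _ = ∫⁻ ω, ∑' x : Set.range a, (a ⁻¹' {x.1}).indicator f ω * 1 ∂μ :=
        (lintegral_tsum fun x => (((hfm x).mono h₁ le_rfl).mul measurable_const).aemeasurable).symm
    _ = ∫⁻ ω, f ω ∂μ := lintegral_congr fun ω => by
        rw [hdec (fun _ _ => 1) ω, mul_one]

end Ville

/-! ### One slot with a fixed state: probabilities of the channel outcomes -/

section Coins

variable {Ω : Type*} [mΩ : MeasurableSpace Ω] {μ : Measure Ω}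

/-- The coins of one slot. -/
structure SlotCoins (μ : Measure Ω) (ξ : Channel → ℕ → Ω → ℝ) : Prop where
  measurable : ∀ ch i, Measurable (ξ ch i)
  uniform : ∀ ch i, μ.map (ξ ch i) = volume.restrict (Set.Icc (0 : ℝ) 1)
  independent : ∀ ch, iIndepFun (ξ ch) μ

lemma FairCoins.slotCoins {ℱ : Filtration ℕ mΩ} {coin : ℕ → Channel → ℕ → Ω → ℝ}
    (h : FairCoins μ ℱ coin) (t : ℕ) : SlotCoins μ (coin t) where
  measurable ch i := (h.measurable t ch i).mono (ℱ.le _) le_rfl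
  uniform := h.uniform t
  independent ch := (h.independent t).precomp (g := fun i => (ch, i))
    fun _ _ hij => (Prod.ext_iff.mp hij).2

lemma SlotCoins.real_lt {ξ : Channel → ℕ → Ω → ℝ} (h : SlotCoins μ ξ) (ch : Channel) (i : ℕ)
    {p : ℝ} (h0 : 0 ≤ p) (h1 : p ≤ 1) : μ.real (ξ ch i ⁻¹' Set.Iio p) = p := by
  rw [← map_measureReal_apply (h.measurable ch i) measurableSet_Iio, h.uniform, measureReal_def,
    Measure.restrict_apply measurableSet_Iio]
  have : Set.Iio p ∩ Set.Icc (0 : ℝ) 1 = Set.Ico 0 p := by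
    ext x
    simp only [Set.mem_inter_iff, Set.mem_Iio, Set.mem_Icc, Set.mem_Ico]
    constructor
    · rintro ⟨a, b, _⟩; exact ⟨b, a⟩
    · rintro ⟨a, b⟩; exact ⟨b, a, by linarith⟩
  rw [this, Real.volume_Ico, ENNReal.toReal_ofReal (by linarith), sub_zero]

lemma sendProb_nonneg {c : ℝ} (hc : 0 ≤ c) (ch : Channel) (s : ℕ) : 0 ≤ sendProb c ch s := by
  cases ch
  · simp only [sendProb]; positivity
  · simp only [sendProb]; positivity

lemma sendProb_le_one (c : ℝ) (ch : Channel) (s : ℕ) : sendProb c ch s ≤ 1 := by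
  cases ch
  · rcases Nat.eq_zero_or_pos s with rfl | hs
    · simp [sendProb]
    · have : (1 : ℝ) ≤ s := by exact_mod_cast hs
      simp only [sendProb]
      rw [div_le_one (by linarith)]
      linarith
  · exact min_le_left _ _

/-- The broadcast probability of a packet. -/
def Packet.pr (c : ℝ) (ch : Channel) (p : Packet) : ℝ := p.wt (sendProb c ch)

lemma Packet.pr_nonneg {c : ℝ} (hc : 0 ≤ c) (ch : Channel) (p : Packet) : 0 ≤ p.pr c ch :=
  Packet.wt_nonneg (sendProb_nonneg hc ch) p

lemma Packet.pr_le_one (c : ℝ) (ch : Channel) (p : Packet) : p.pr c ch ≤ 1 := by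
  cases p <;> simp [Packet.pr, Packet.wt, sendProb_le_one]

lemma Packet.pr_data_le (c : ℝ) (p : Packet) : p.pr c .data ≤ 1 / 2 := by
  cases p with
  | active s e =>
    rcases Nat.eq_zero_or_pos s with rfl | hs
    · simp [Packet.pr, Packet.wt, sendProb]
    · have : (1 : ℝ) ≤ s := by exact_mod_cast hs
      simp only [Packet.pr, Packet.wt, sendProb]
      exact div_le_self (by norm_num) this
  | _ => simp [Packet.pr, Packet.wt]

lemma psum_pr_data (c : ℝ) (q : State) : psum q (Packet.pr c .data) = X q / 2 := by
  rw [X, wsum, psum, psum, Finset.sum_div]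
  refine Finset.sum_congr rfl fun i _ => ?_
  cases q.packet i with
  | active s e => simp only [Packet.pr, Packet.wt, sendProb]; ring
  | _ => simp [Packet.pr, Packet.wt]

/-- The values of the coin with which a packet broadcasts. -/
def Packet.sendSet (c : ℝ) (ch : Channel) (p : Packet) : Set ℝ :=
  {y | (∃ s e, p = .active s e) ∧ y < p.pr c ch}

lemma Packet.sendSet_active (c : ℝ) (ch : Channel) (s e : ℕ) :
    (Packet.active s e).sendSet c ch = Set.Iio ((Packet.active s e).pr c ch) := by
  ext y; simp [Packet.sendSet]

lemma Packet.measurableSet_sendSet (c : ℝ) (ch : Channel) (p : Packet) :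
    MeasurableSet (p.sendSet c ch) := by
  cases p with
  | active s e => rw [Packet.sendSet_active]; exact measurableSet_Iio
  | _ => simp [Packet.sendSet]

variable {ξ : Channel → ℕ → Ω → ℝ} (h : SlotCoins μ ξ) {c : ℝ} (hc : 0 ≤ c) {q : State} (hq : Inv q)
  (a : ℕ) (jd jc : Bool)

/-- The view of a slot with given decisions of the adversary. -/
def rview (c : ℝ) (q : State) (a : ℕ) (jd jc : Bool) (ξ : Channel → ℕ → Ω → ℝ) (ω : Ω) : View :=
  viewOf c ⟨a, jd, jc, fun ch i => ξ ch i ω⟩ q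

/-- The senders on a channel. -/
def snd (v : View) : Channel → Finset ℕ
  | .data => v.sd
  | .control => v.sc

omit mΩ in
include hq in
lemma mem_snd (ch : Channel) (ω : Ω) (i : ℕ) : i ∈ snd (rview c q a jd jc ξ ω) ch ↔
    i < q.injected ∧ ξ ch i ω ∈ (q.packet i).sendSet c ch := by
  have hs : snd (rview c q a jd jc ξ ω) ch =
      senders c ⟨a, jd, jc, fun ch i => ξ ch i ω⟩ q ch := by cases ch <;> rfl
  rw [hs]
  simp only [senders, population, Finset.mem_filter, Finset.mem_range, Packet.sendSet]
  constructor
  · rintro ⟨_, s, e, hp, hlt⟩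
    refine ⟨hq.lt_injected hp, ⟨s, e, hp⟩, ?_⟩
    rw [hp]; exact hlt
  · rintro ⟨hi, ⟨s, e, hp⟩, hlt⟩
    refine ⟨by omega, s, e, hp, ?_⟩
    rw [hp] at hlt; exact hlt

include h hc in
lemma real_sendSet (ch : Channel) (i : ℕ) (p : Packet) :
    μ.real (ξ ch i ⁻¹' p.sendSet c ch) = p.pr c ch := by
  cases p with
  | active s e =>
    rw [Packet.sendSet_active, h.real_lt ch i (Packet.pr_nonneg hc _ _) (Packet.pr_le_one _ _ _)]
  | _ => simp [Packet.sendSet, Packet.pr, Packet.wt]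

variable [IsProbabilityMeasure μ]

include h hc in
lemma real_sendSet_compl (ch : Channel) (i : ℕ) (p : Packet) :
    μ.real (ξ ch i ⁻¹' (p.sendSet c ch)ᶜ) = 1 - p.pr c ch := by
  rw [Set.preimage_compl, probReal_compl_eq_one_sub
    (h.measurable ch i (p.measurableSet_sendSet c ch)), real_sendSet h hc]

omit [IsProbabilityMeasure μ] in
include h in
lemma real_iInter (ch : Channel) (n : ℕ) {S : ℕ → Set ℝ} (hS : ∀ i, MeasurableSet (S i)) :
    μ.real (⋂ i ∈ Finset.range n, ξ ch i ⁻¹' S i) =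
      ∏ i ∈ Finset.range n, μ.real (ξ ch i ⁻¹' S i) := by
  rw [measureReal_def, (h.independent ch).measure_inter_preimage_eq_mul (Finset.range n)
    (fun i _ => hS i), ENNReal.toReal_prod]
  rfl

/-- The probability of an empty channel. -/
def noneProb (c : ℝ) (q : State) (ch : Channel) : ℝ :=
  ∏ i ∈ Finset.range q.injected, (1 - (q.packet i).pr c ch)

lemma noneProb_nonneg (ch : Channel) : 0 ≤ noneProb c q ch :=
  Finset.prod_nonneg fun i _ => by linarith [Packet.pr_le_one c ch (q.packet i)]

include h hc hq in
lemma real_snd_empty (ch : Channel) :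
    μ.real {ω | snd (rview c q a jd jc ξ ω) ch = ∅} = noneProb c q ch := by
  have : {ω | snd (rview c q a jd jc ξ ω) ch = ∅} =
      ⋂ i ∈ Finset.range q.injected, ξ ch i ⁻¹' ((q.packet i).sendSet c ch)ᶜ := by
    ext ω
    simp [Finset.eq_empty_iff_forall_notMem, mem_snd hq]
  rw [this, real_iInter h ch _ fun i => ((q.packet i).measurableSet_sendSet c ch).compl]
  exact Finset.prod_congr rfl fun i _ => real_sendSet_compl h hc ch i _

include h hc hq in
-- The exact probability omits the factor 1 − p of the lone sender; putting this factor back only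
-- lowers the value and leaves a product that does not depend on j.
lemma le_real_snd_singleton (ch : Channel) {j : ℕ} (hj : j < q.injected) :
    (q.packet j).pr c ch * noneProb c q ch ≤
      μ.real {ω | snd (rview c q a jd jc ξ ω) ch = {j}} := by
  classical
  have : {ω | snd (rview c q a jd jc ξ ω) ch = {j}} = ⋂ i ∈ Finset.range q.injected, ξ ch i ⁻¹'
      (if i = j then (q.packet i).sendSet c ch else ((q.packet i).sendSet c ch)ᶜ) := by
    ext ω
    simp only [Finset.ext_iff, mem_snd hq, Set.mem_iInter, Finset.mem_range, Set.mem_preimage,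
      Set.mem_ofPred_eq, Finset.mem_singleton]
    constructor
    · intro hω i hi
      split_ifs with hij
      · exact ((hω i).mpr hij).2
      · exact fun hmem => hij ((hω i).mp ⟨hi, hmem⟩)
    · intro hω i
      constructor
      · rintro ⟨hi, hmem⟩
        by_contra hij
        have := hω i hi
        rw [if_neg hij] at this
        exact this hmem
      · rintro rfl
        have := hω i hj
        rw [if_pos rfl] at this
        exact ⟨hj, this⟩
  rw [this, real_iInter h ch _ fun i => by
    split_ifs
    exacts [(q.packet i).measurableSet_sendSet c ch,
      ((q.packet i).measurableSet_sendSet c ch).compl]]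
  have hmem := Finset.mem_range.mpr hj
  rw [noneProb, ← Finset.mul_prod_erase _ _ hmem, ← Finset.mul_prod_erase (Finset.range _) _ hmem,
    if_pos rfl, real_sendSet h hc]
  have herase : ∏ i ∈ (Finset.range q.injected).erase j, μ.real (ξ ch i ⁻¹'
      (if i = j then (q.packet i).sendSet c ch else ((q.packet i).sendSet c ch)ᶜ)) =
      ∏ i ∈ (Finset.range q.injected).erase j, (1 - (q.packet i).pr c ch) := by
    refine Finset.prod_congr rfl fun i hi => ?_
    rw [if_neg (Finset.ne_of_mem_erase hi), real_sendSet_compl h hc]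
  rw [herase]
  have h0 := Packet.pr_nonneg hc ch (q.packet j)
  refine mul_le_mul_of_nonneg_left ?_ h0
  refine mul_le_of_le_one_left (Finset.prod_nonneg fun i _ => ?_) (by linarith)
  linarith [Packet.pr_le_one c ch (q.packet i)]

include h hq in
omit [IsProbabilityMeasure μ] in
lemma measurableSet_snd (ch : Channel) (A : Finset ℕ) :
    MeasurableSet {ω | snd (rview c q a jd jc ξ ω) ch = A} := by
  have := (adapt_finset (m := mΩ) (f := fun ω => snd (rview c q a jd jc ξ ω) ch) fun i => by
    simp only [mem_snd hq]
    by_cases hi : i < q.injected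
    · have hs : {ω | i < q.injected ∧ ξ ch i ω ∈ (q.packet i).sendSet c ch} =
          ξ ch i ⁻¹' (q.packet i).sendSet c ch := by ext ω; simp [hi]
      rw [hs]
      exact h.measurable ch i ((q.packet i).measurableSet_sendSet c ch)
    · simp [hi]).2 A
  exact this

omit [IsProbabilityMeasure μ] in
include h hq in
lemma measurableSet_emp : MeasurableSet {ω | (rview c q a jd jc ξ ω).Emp} :=
  (MeasurableSet.const (jd = false)).inter (measurableSet_snd h hq a jd jc .data ∅)

omit [IsProbabilityMeasure μ] in
include h hq in
lemma measurableSet_cemp : MeasurableSet {ω | (rview c q a jd jc ξ ω).CEmp} :=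
  (MeasurableSet.const (jc = false)).inter (measurableSet_snd h hq a jd jc .control ∅)

omit [IsProbabilityMeasure μ] in
include h hq in
lemma measurableSet_suc : MeasurableSet {ω | (rview c q a jd jc ξ ω).Suc} := by
  have : {ω | (rview c q a jd jc ξ ω).Suc} =
      ⋃ i, ({_ω : Ω | jd = false} ∩ {ω | snd (rview c q a jd jc ξ ω) .data = {i}}) := by
    ext ω; simp [View.Suc, View.Succ, snd, rview, viewOf]
  rw [this]
  exact MeasurableSet.iUnion fun i =>
    (MeasurableSet.const (jd = false)).inter (measurableSet_snd h hq a jd jc .data {i})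

include h hc hq in
lemma real_emp_le : μ.real {ω | (rview c q a jd jc ξ ω).Emp} ≤ noneProb c q .data := by
  rw [← real_snd_empty h hc hq a jd jc]
  exact measureReal_mono fun ω hω => hω.2

include h hc hq in
lemma real_emp : μ.real {ω | (rview c q a false jc ξ ω).Emp} = noneProb c q .data := by
  rw [← real_snd_empty h hc hq a false jc]
  congr 1
  ext ω
  simp [View.Emp, snd, rview, viewOf]

include h hc hq in
lemma real_cemp_le : μ.real {ω | (rview c q a jd jc ξ ω).CEmp} ≤ noneProb c q .control := by
  rw [← real_snd_empty h hc hq a jd jc]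
  exact measureReal_mono fun ω hω => hω.2

include h hc hq in
-- The events of a given lone sender are disjoint, so their bounds add up to the expected number of
-- senders times the probability of emptiness. This comparison lets successes pay for inactivations.
lemma le_real_suc : X q / 2 * noneProb c q .data ≤ μ.real {ω | (rview c q a false jc ξ ω).Suc} := by
  have hsub : (⋃ j ∈ Finset.range q.injected, {ω | snd (rview c q a false jc ξ ω) .data = {j}}) ⊆
      {ω | (rview c q a false jc ξ ω).Suc} := by
    intro ω hω
    simp only [Set.mem_iUnion] at hω
    obtain ⟨j, _, hj⟩ := hω
    exact ⟨j, rfl, hj⟩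
  refine le_trans ?_ (measureReal_mono hsub)
  rw [measureReal_biUnion_finset]
  · rw [← psum_pr_data c, psum, Finset.sum_mul]
    exact Finset.sum_le_sum fun j hj =>
      le_real_snd_singleton h hc hq a false jc .data (Finset.mem_range.mp hj)
  · intro i _ j _ hij
    refine Set.disjoint_left.mpr fun ω hi hj => hij ?_
    have hi' : snd (rview c q a false jc ξ ω) .data = {i} := hi
    have hj' : snd (rview c q a false jc ξ ω) .data = {j} := hj
    exact Finset.singleton_injective (hi'.symm.trans hj')
  · exact fun i _ => measurableSet_snd h hq a false jc .data {i}

lemma noneProb_data_le : noneProb c q .data ≤ Real.exp (-(X q / 2)) := by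
  rw [← psum_pr_data c, psum, ← Finset.sum_neg_distrib, Real.exp_sum]
  refine Finset.prod_le_prod (fun i _ => by linarith [Packet.pr_le_one c .data (q.packet i)])
    fun i _ => ?_
  linarith [Real.add_one_le_exp (-((q.packet i).pr c .data))]

include hc in
-- Data broadcasts have probability p ≤ 1/2, and then 1 − p ≥ exp(−2p).
lemma le_noneProb_data : Real.exp (-X q) ≤ noneProb c q .data := by
  have : X q = ∑ i ∈ Finset.range q.injected, 2 * (q.packet i).pr c .data := by
    rw [← Finset.mul_sum, show ∑ i ∈ Finset.range q.injected, (q.packet i).pr c .data =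
      X q / 2 from psum_pr_data c q]
    ring
  rw [this, ← Finset.sum_neg_distrib, Real.exp_sum]
  refine Finset.prod_le_prod (fun i _ => (Real.exp_pos _).le) fun i _ => ?_
  have h0 := Packet.pr_nonneg hc .data (q.packet i)
  have h1 := Packet.pr_data_le c (q.packet i)
  set p := (q.packet i).pr c .data
  rw [Real.exp_neg, inv_le_comm₀ (Real.exp_pos _) (by linarith)]
  refine le_trans ?_ (Real.add_one_le_exp _)
  rw [inv_le_iff_one_le_mul₀ (by linarith)]
  nlinarith

include hc hq in
-- All ages are at least the clock value k, so ln s ≥ ln k can be pulled out of the sum. A truncated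
-- probability of 1 makes its factor vanish.
lemma noneProb_control_le {k : ℕ × ℕ} (hk : ClockInv q k) :
    noneProb c q .control ≤ Real.exp (-(c * max (Real.log k.1) 1 * X q)) := by
  rw [X, wsum, psum, Finset.mul_sum, ← Finset.sum_neg_distrib, Real.exp_sum]
  refine Finset.prod_le_prod (fun i _ => by linarith [Packet.pr_le_one c .control (q.packet i)])
    fun i _ => ?_
  cases hp : q.packet i with
  | active s e =>
    have hs : (1 : ℝ) ≤ s := by exact_mod_cast hq.age_pos hp
    have hk1 : (1 : ℝ) ≤ k.1 := by exact_mod_cast hk.pos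
    have hks : (k.1 : ℝ) ≤ s := by exact_mod_cast (hk.active i s e hp).1
    simp only [Packet.pr, Packet.wt, sendProb]
    rcases le_total 1 (c * max (Real.log s) 1 / s) with h1 | h1
    · rw [min_eq_left h1]
      simp [(Real.exp_pos _).le]
    · rw [min_eq_right h1]
      have h2 : c * max (Real.log k.1) 1 * (1 / s) ≤ c * max (Real.log s) 1 / s := by
        rw [mul_one_div]
        have := Real.log_le_log (by linarith) hks
        gcongr
      have := Real.add_one_le_exp (-(c * max (Real.log k.1) 1 * (1 / s)))
      have h3 := Real.add_one_le_exp (-(c * max (Real.log s) 1 / s))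
      have h4 : Real.exp (-(c * max (Real.log s) 1 / s)) ≤
          Real.exp (-(c * max (Real.log k.1) 1 * (1 / s))) := Real.exp_le_exp.mpr (by linarith)
      linarith
  | _ => simp [Packet.pr, Packet.wt]

include h hc hq in
-- The senders are independent indicators, and 1 + (e − 1)p ≤ exp(2p).
lemma lintegral_exp_card_le (ch : Channel) :
    ∫⁻ ω, ENNReal.ofReal (Real.exp (((snd (rview c q a jd jc ξ ω) ch).card : ℝ) -
      2 * psum q (Packet.pr c ch))) ∂μ ≤ 1 := by
  classical
  let g : ℕ → ℝ → ENNReal := fun i y =>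
    ENNReal.ofReal (Real.exp (if y ∈ (q.packet i).sendSet c ch then 1 else 0))
  have hg : ∀ i, Measurable (g i) := fun i => by
    refine ENNReal.measurable_ofReal.comp (Real.measurable_exp.comp ?_)
    exact Measurable.ite ((q.packet i).measurableSet_sendSet c ch) measurable_const measurable_const
  have hcard : ∀ ω, ENNReal.ofReal (Real.exp (((snd (rview c q a jd jc ξ ω) ch).card : ℝ) -
      2 * psum q (Packet.pr c ch))) = ENNReal.ofReal (Real.exp (-(2 * psum q (Packet.pr c ch)))) *
      ∏ i ∈ Finset.range q.injected, (g i ∘ ξ ch i) ω := by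
    intro ω
    have : snd (rview c q a jd jc ξ ω) ch = (Finset.range q.injected).filter
        fun i => ξ ch i ω ∈ (q.packet i).sendSet c ch := by
      ext i; simp [mem_snd hq]
    rw [this, sub_eq_neg_add, Real.exp_add, ENNReal.ofReal_mul (Real.exp_pos _).le]
    congr 1
    simp only [g, Function.comp]
    rw [← ENNReal.ofReal_prod_of_nonneg (fun i _ => (Real.exp_pos _).le), ← Real.exp_sum]
    simp
  rw [lintegral_congr hcard, lintegral_const_mul _ (Finset.measurable_fun_prod _ fun i _ =>
    (hg i).comp (h.measurable ch i)),
    lintegral_prod_eq_prod_lintegral_of_indepFun _ _ ((h.independent ch).comp g hg)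
    fun i => (hg i).comp (h.measurable ch i)]
  have hone : ∀ i, ∫⁻ ω, (g i ∘ ξ ch i) ω ∂μ ≤
      ENNReal.ofReal (Real.exp (2 * (q.packet i).pr c ch)) := by
    intro i
    set S := ξ ch i ⁻¹' (q.packet i).sendSet c ch with hS
    have hSm : MeasurableSet S := h.measurable ch i ((q.packet i).measurableSet_sendSet c ch)
    have hpt : ∀ ω, (g i ∘ ξ ch i) ω =
        1 + S.indicator (fun _ => ENNReal.ofReal (Real.exp 1 - 1)) ω := by
      intro ω
      by_cases hω : ω ∈ S
      · have hω' : ξ ch i ω ∈ (q.packet i).sendSet c ch := hω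
        simp only [g, Function.comp, if_pos hω', Set.indicator_of_mem hω]
        rw [← ENNReal.ofReal_one, ← ENNReal.ofReal_add zero_le_one
          (by linarith [Real.add_one_le_exp (1 : ℝ)])]
        congr 1; ring
      · have hω' : ξ ch i ω ∉ (q.packet i).sendSet c ch := hω
        simp [g, hω', Set.indicator_of_notMem hω]
    rw [lintegral_congr hpt, lintegral_add_left measurable_const, lintegral_indicator hSm]
    simp only [lintegral_const, measure_univ, mul_one, MeasurableSet.univ, Measure.restrict_apply,
      Set.univ_inter]
    have hμ : μ S = ENNReal.ofReal ((q.packet i).pr c ch) := by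
      rw [← real_sendSet h hc ch i, ofReal_measureReal]
    have h0 := Packet.pr_nonneg hc ch (q.packet i)
    have he := Real.exp_one_lt_d9
    rw [hμ, ← ENNReal.ofReal_mul (by linarith [Real.add_one_le_exp (1 : ℝ)]), ← ENNReal.ofReal_one,
      ← ENNReal.ofReal_add zero_le_one (mul_nonneg (by linarith [Real.add_one_le_exp (1 : ℝ)]) h0)]
    refine ENNReal.ofReal_le_ofReal ?_
    have := Real.add_one_le_exp (2 * (q.packet i).pr c ch)
    nlinarith
  refine (mul_le_mul_right (Finset.prod_le_prod' fun i _ => hone i) _).trans ?_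
  rw [← ENNReal.ofReal_prod_of_nonneg (fun i _ => (Real.exp_pos _).le), ← Real.exp_sum,
    ← ENNReal.ofReal_mul (Real.exp_pos _).le, ← Real.exp_add, ← Finset.mul_sum, psum]
  simp

lemma lintegral_exp_le {u : Ω → ℝ} {A B : Ω → Prop} (hA : MeasurableSet {ω | A ω})
    (hB : MeasurableSet {ω | B ω}) {x α β : ℝ}
    (hu : ∀ ω, Real.exp (u ω) ≤ x + α * ind (A ω) - β * ind (B ω))
    (h1 : x + α * μ.real {ω | A ω} - β * μ.real {ω | B ω} ≤ 1) :
    ∫⁻ ω, ENNReal.ofReal (Real.exp (u ω)) ∂μ ≤ 1 := by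
  have hi : ∀ {A : Ω → Prop}, MeasurableSet {ω | A ω} →
      Integrable (fun ω => ind (A ω)) μ ∧ ∫ ω, ind (A ω) ∂μ = μ.real {ω | A ω} := by
    intro A hA
    have : (fun ω => ind (A ω)) = Set.indicator {ω | A ω} 1 := by
      ext ω
      by_cases hω : A ω
      · rw [ind_pos hω, Set.indicator_of_mem (by exact hω)]; rfl
      · rw [ind_neg hω, Set.indicator_of_notMem (by exact hω)]
    rw [this]
    exact ⟨(integrable_const (1 : ℝ)).indicator hA, integral_indicator_one hA⟩
  have hint1 : Integrable (fun ω => x + α * ind (A ω)) μ :=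
    (integrable_const x).add ((hi hA).1.const_mul α)
  have hint : Integrable (fun ω => x + α * ind (A ω) - β * ind (B ω)) μ :=
    hint1.sub ((hi hB).1.const_mul β)
  calc ∫⁻ ω, ENNReal.ofReal (Real.exp (u ω)) ∂μ
      ≤ ∫⁻ ω, ENNReal.ofReal (x + α * ind (A ω) - β * ind (B ω)) ∂μ :=
        lintegral_mono fun ω => ENNReal.ofReal_le_ofReal (hu ω)
    _ = ENNReal.ofReal (∫ ω, (x + α * ind (A ω) - β * ind (B ω)) ∂μ) :=
        (ofReal_integral_eq_lintegral_ofReal hint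
          (Filter.Eventually.of_forall fun ω => (Real.exp_pos _).le.trans (hu ω))).symm
    _ ≤ 1 := by
        rw [integral_sub hint1 ((hi hB).1.const_mul β), integral_add (integrable_const x)
          ((hi hA).1.const_mul α), integral_const_mul, integral_const_mul, (hi hA).2, (hi hB).2]
        simp only [integral_const, probReal_univ, smul_eq_mul, one_mul]
        exact ENNReal.ofReal_le_one.mpr h1

end Coins

/-! ### From one slot to the execution -/

section Execution

variable {Ω : Type*} [mΩ : MeasurableSpace Ω]

omit mΩ in
lemma adapt_viewOf {m : MeasurableSpace Ω} {ξ : Channel → ℕ → Ω → ℝ}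
    (hξ : ∀ ch i, Measurable[m] (ξ ch i)) (c : ℝ) {Q : Ω → State} (hQ : Adapt m Q) {a : Ω → ℕ}
    (ha : Adapt m a) {jd jc : Ω → Bool} (hjd : Adapt m jd) (hjc : Adapt m jc) :
    Adapt m fun ω => viewOf c ⟨a ω, jd ω, jc ω, fun ch i => ξ ch i ω⟩ (Q ω) := by
  have hs : ∀ ch, Adapt m fun ω => senders c ⟨a ω, jd ω, jc ω, fun ch i => ξ ch i ω⟩ (Q ω) ch := by
    intro ch
    refine adapt_finset fun i => ?_
    have : {ω | i ∈ senders c ⟨a ω, jd ω, jc ω, fun ch i => ξ ch i ω⟩ (Q ω) ch} =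
        (fun ω => (a ω, Q ω)) ⁻¹' {x | i < x.2.injected + x.1 ∧
          ∃ s e, x.2.packet i = .active s e} ∩ {ω | ξ ch i ω < ((Q ω).packet i).pr c ch} := by
      ext ω
      simp only [senders, population, Finset.mem_filter, Finset.mem_range, Set.mem_ofPred_eq,
        Set.mem_inter_iff, Set.mem_preimage]
      constructor
      · rintro ⟨h1, s, e, hp, h2⟩
        refine ⟨⟨h1, s, e, hp⟩, ?_⟩
        rw [hp]; exact h2
      · rintro ⟨⟨h1, s, e, hp⟩, h2⟩
        refine ⟨h1, s, e, hp, ?_⟩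
        rw [hp] at h2; exact h2
    rw [this]
    refine ((ha.prodMk hQ).measurableSet _).inter (measurableSet_lt (hξ ch i) ?_)
    exact (hQ.comp fun Q => (Q.packet i).pr c ch).measurable
  exact ((ha.prodMk (hjd.prodMk (hjc.prodMk ((hs .data).prodMk (hs .control))))).comp
    fun x => View.mk x.1 x.2.1 x.2.2.1 x.2.2.2.1 x.2.2.2.2)

variable {μ : Measure Ω} {ℱ : Filtration ℕ mΩ} {coin : ℕ → Channel → ℕ → Ω → ℝ}

/-- The states of the system in the outcome `ω`. -/
def qs (c : ℝ) (adv : Adversary ℱ) (coin : ℕ → Channel → ℕ → Ω → ℝ) (ω : Ω) : ℕ → State :=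
  run c (adv.inputs coin ω)

/-- The views of the slots in the outcome `ω`. -/
def vs (c : ℝ) (adv : Adversary ℱ) (coin : ℕ → Channel → ℕ → Ω → ℝ) (ω : Ω) : ℕ → View := fun t =>
  viewOf c (adv.inputs coin ω t) (qs c adv coin ω t)

lemma isPath (c : ℝ) (adv : Adversary ℱ) (coin : ℕ → Channel → ℕ → Ω → ℝ) (ω : Ω) :
    IsPath (qs c adv coin ω) (vs c adv coin ω) := isPath_run c _

variable (hfc : FairCoins μ ℱ coin) (c : ℝ) (adv : Adversary ℱ)

include hfc in
lemma adapt_state_view (t : ℕ) : Adapt (ℱ t) (fun ω => qs c adv coin ω t) ∧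
    Adapt (ℱ (t + 1)) (fun ω => vs c adv coin ω t) := by
  have hview : ∀ t, Adapt (ℱ t) (fun ω => qs c adv coin ω t) →
      Adapt (ℱ (t + 1)) (fun ω => vs c adv coin ω t) := fun t ht =>
    have hle := ℱ.mono (Nat.le_succ t)
    adapt_viewOf (hfc.measurable t) c (ht.mono hle)
      ((adapt_of_measurable (adv.measurable_arrivals t)).mono hle)
      ((adapt_of_measurable (adv.measurable_jamData t)).mono hle)
      ((adapt_of_measurable (adv.measurable_jamControl t)).mono hle)
  induction t with
  | zero =>
    have : Adapt (ℱ 0) (fun ω => qs c adv coin ω 0) := adapt_const _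
    exact ⟨this, hview 0 this⟩
  | succ t ih =>
    have h1 : Adapt (ℱ (t + 1)) (fun ω => qs c adv coin ω (t + 1)) := by
      have := ((ih.1.mono (ℱ.mono (Nat.le_succ t))).prodMk ih.2).comp fun x => step x.1 x.2
      exact this
    exact ⟨h1, hview _ h1⟩

include hfc in
lemma adapt_rec {β : Type*} {f : ℕ → Ω → β} {b : β} (h0 : ∀ ω, f 0 ω = b) (G : β → State → View → β)
    (hs : ∀ t ω, f (t + 1) ω = G (f t ω) (qs c adv coin ω t) (vs c adv coin ω t)) (t : ℕ) :
    Adapt (ℱ t) (f t) := by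
  induction t with
  | zero =>
    have : f 0 = fun _ => b := funext h0
    rw [this]; exact adapt_const b
  | succ t ih =>
    have h1 := adapt_state_view hfc c adv t
    have hle := ℱ.mono (Nat.le_succ t)
    have := ((ih.mono hle).prodMk ((h1.1.mono hle).prodMk h1.2)).comp fun x => G x.1 x.2.1 x.2.2
    have he : f (t + 1) = fun ω => G (f t ω) (qs c adv coin ω t) (vs c adv coin ω t) :=
      funext (hs t)
    rw [he]; exact this

include hfc in
lemma adapt_clock (t : ℕ) : Adapt (ℱ t) fun ω => clock (vs c adv coin ω) t :=
  adapt_rec hfc c adv (f := fun t ω => clock (vs c adv coin ω) t) (fun _ => rfl)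
    (fun k _ v => clockStep v k) (fun _ _ => rfl) t

include hfc in
lemma adapt_inact (t : ℕ) :
    Adapt (ℱ t) fun ω => inact (qs c adv coin ω) (vs c adv coin ω) t :=
  adapt_rec hfc c adv (f := fun t ω => inact (qs c adv coin ω) (vs c adv coin ω) t)
    (b := 0) (fun _ => rfl) (fun n q v => n + inactN q v)
    (fun _ _ => by simp [inact, Finset.sum_range_succ]) t

open Classical in
/-- Number of slots before `t` with high contention. -/
def highCount (b : ℝ) (q : ℕ → State) : ℕ → ℕ
  | 0 => 0
  | t + 1 => highCount b q t + if b ≤ X (q t) then 1 else 0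

lemma highCount_cast (b : ℝ) (q : ℕ → State) (t : ℕ) :
    (highCount b q t : ℝ) = cnt (fun r => b ≤ X (q r)) t := by
  induction t with
  | zero => simp [highCount, cnt]
  | succ t ih =>
    rw [cnt_succ, ← ih, highCount]
    push_cast
    rfl

include hfc in
lemma adapt_highCount (b : ℝ) (t : ℕ) :
    Adapt (ℱ t) fun ω => highCount b (qs c adv coin ω) t := by
  classical
  exact adapt_rec hfc c adv (f := fun t ω => highCount b (qs c adv coin ω) t)
    (b := 0) (fun _ => rfl) (fun n q _ => n + if b ≤ X q then 1 else 0)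
    (fun _ _ => rfl) t

/-- The view that slot `t` would have with the coins of the outcome `ω'`, when the past is that of
the outcome `ω`. -/
def fview (c : ℝ) (adv : Adversary ℱ) (coin : ℕ → Channel → ℕ → Ω → ℝ) (t : ℕ) (ω ω' : Ω) : View :=
  rview c (qs c adv coin ω t) (adv.arrivals t ω) (adv.jamData t ω) (adv.jamControl t ω) (coin t) ω'

/-- The information carried by the coins of a slot. -/
@[reducible] def coinSpace (coin : ℕ → Channel → ℕ → Ω → ℝ) (t : ℕ) : MeasurableSpace Ω :=
  ⨆ p : Channel × ℕ, MeasurableSpace.comap (coin t p.1 p.2) (borel ℝ)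

include hfc in
-- State, adversary decisions and the auxiliary datum e are all fixed before the slot, so only the
-- coins are random in the hypothesis. The datum lets an increment depend on the clock or be
-- rescaled by a quantity known from the past.
theorem ae_cum_le [IsProbabilityMeasure μ] {ι : Type*} {e : ℕ → Ω → ι}
    (he : ∀ t, Adapt (ℱ t) (e t)) (U : State → View → ι → ℝ)
    (hU : ∀ t ω, ∫⁻ ω', ENNReal.ofReal (Real.exp
      (U (qs c adv coin ω t) (fview c adv coin t ω ω') (e t ω))) ∂μ ≤ 1) :
    ∀ᵐ ω ∂μ, ∃ B, ∀ t,
      cum (fun r => U (qs c adv coin ω r) (vs c adv coin ω r) (e r ω)) t ≤ B := by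
  refine ae_bddAbove_of_exp (ℱ := ℱ)
    (u := fun t ω => U (qs c adv coin ω t) (vs c adv coin ω t) (e t ω)) (fun t => ?_) ?_
  · have h1 := adapt_state_view hfc c adv t
    have hle := ℱ.mono (Nat.le_succ t)
    exact (((h1.1.mono hle).prodMk (h1.2.prodMk ((he t).mono hle))).comp
      fun x => U x.1 x.2.1 x.2.2).measurable
  · intro t f hf
    have hcoin : ∀ ch i, Measurable[coinSpace coin t] (coin t ch i) := by
      intro ch i
      have h1 : MeasurableSpace.comap (coin t ch i) (borel ℝ) ≤ coinSpace coin t :=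
        le_iSup (fun p : Channel × ℕ => MeasurableSpace.comap (coin t p.1 p.2) (borel ℝ)) (ch, i)
      rw [BorelSpace.measurable_eq (α := ℝ)]
      exact measurable_iff_comap_le.mpr h1
    have hm₂le : coinSpace coin t ≤ mΩ := by
      refine iSup_le fun p => ?_
      have := (hfc.slotCoins t).measurable p.1 p.2
      rw [BorelSpace.measurable_eq (α := ℝ)] at this
      exact measurable_iff_comap_le.mp this
    have ha : Adapt (ℱ t) fun ω => (qs c adv coin ω t, adv.arrivals t ω, adv.jamData t ω,
        adv.jamControl t ω, e t ω) :=
      (adapt_state_view hfc c adv t).1.prodMk ((adapt_of_measurable (adv.measurable_arrivals t)).prodMk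
        ((adapt_of_measurable (adv.measurable_jamData t)).prodMk
          ((adapt_of_measurable (adv.measurable_jamControl t)).prodMk (he t))))
    exact lintegral_mul_le_of_indep (ℱ.le t) hm₂le (hfc.independent_past t).symm ha
      (F := fun x ω' => ENNReal.ofReal (Real.exp
        (U x.1 (rview c x.1 x.2.1 x.2.2.1 x.2.2.2.1 (coin t) ω') x.2.2.2.2)))
      (fun x => ((adapt_viewOf hcoin c (adapt_const x.1) (adapt_const x.2.1)
        (adapt_const x.2.2.1) (adapt_const x.2.2.2.1)).comp
          fun v => ENNReal.ofReal (Real.exp (U x.1 v x.2.2.2.2))).measurable)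
      (fun ω => hU t ω) hf

end Execution

/-! ### Exponential moments for a single slot -/

section SlotBounds

variable {Ω : Type*} [mΩ : MeasurableSpace Ω] {μ : Measure Ω} [IsProbabilityMeasure μ]
  {ξ : Channel → ℕ → Ω → ℝ} (h : SlotCoins μ ξ) {c : ℝ} (hc : 0 ≤ c) {q : State} (hq : Inv q)
  (a : ℕ) (jd jc : Bool)

lemma exp_neg_four_le : Real.exp (-4) ≤ 1 / 50 := by
  have h1 : Real.exp (-4) = (Real.exp 1 ^ 4)⁻¹ := by
    rw [← Real.exp_nat_mul, Real.exp_neg]; norm_num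
  rw [h1, ← one_div]
  have : (2.7 : ℝ) ^ 4 ≤ Real.exp 1 ^ 4 := by
    gcongr
    linarith [Real.exp_one_gt_d9]
  exact one_div_le_one_div_of_le (by norm_num) (le_trans (by norm_num) this)

lemma exp_ind (x : ℝ) (p : Prop) : Real.exp (x * ind p) = 1 + (Real.exp x - 1) * ind p := by
  by_cases hp : p
  · rw [ind_pos hp]; simp
  · rw [ind_neg hp]; simp

lemma lintegral_exp_le_of_nonpos {u : Ω → ℝ} (hu : ∀ ω, u ω ≤ 0) :
    ∫⁻ ω, ENNReal.ofReal (Real.exp (u ω)) ∂μ ≤ 1 := by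
  calc _ ≤ ∫⁻ _ω : Ω, 1 ∂μ := lintegral_mono fun ω =>
        ENNReal.ofReal_le_one.mpr (Real.exp_le_one_iff.mpr (hu ω))
    _ = 1 := by simp

/-- The expectation is at most exp(−y)(1 + (exp x − 1)·P(A)) ≤ exp(−y)(1 + y) ≤ 1. -/
lemma lintegral_exp_le_one {u : Ω → ℝ} {A : Ω → Prop} (hA : MeasurableSet {ω | A ω}) {x y : ℝ}
    (hu : ∀ ω, u ω ≤ x * ind (A ω) - y)
    (h1 : (Real.exp x - 1) * μ.real {ω | A ω} ≤ y) :
    ∫⁻ ω, ENNReal.ofReal (Real.exp (u ω)) ∂μ ≤ 1 := by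
  refine lintegral_exp_le hA MeasurableSet.empty (B := fun _ => False) (x := Real.exp (-y))
    (α := Real.exp (-y) * (Real.exp x - 1)) (β := 0) (fun ω => ?_) ?_
  · refine (Real.exp_le_exp.mpr (hu ω)).trans ?_
    rw [sub_eq_neg_add, Real.exp_add, exp_ind]
    apply le_of_eq
    ring
  · have h2 : Real.exp (-y) * (y + 1) ≤ 1 := by
      rw [Real.exp_neg, inv_mul_le_iff₀ (Real.exp_pos y), mul_one]
      exact Real.add_one_le_exp y
    have h3 := mul_le_mul_of_nonneg_left h1 (Real.exp_pos (-y)).le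
    linarith

/-- Undisrupted slots with active packets and low contention. -/
def Low (q : State) (v : View) : Prop := ¬ v.Dis ∧ HasActive q ∧ X q < 1 / 64

include h hc hq in
-- A nonempty data slot has probability at most 1 − exp(−X) ≤ X < 1/64, and (e − 1)/64 < 1/32.
lemma low_bound : ∫⁻ ω, ENNReal.ofReal (Real.exp
    (ind (Low q (rview c q a jd jc ξ ω) ∧ ¬ (rview c q a jd jc ξ ω).Emp) -
      1 / 32 * ind (Low q (rview c q a jd jc ξ ω)))) ∂μ ≤ 1 := by
  by_cases hL : ¬ (jd = true ∨ jc = true) ∧ HasActive q ∧ X q < 1 / 64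
  · have hL' : ∀ ω, Low q (rview c q a jd jc ξ ω) := fun ω => hL
    have hjd : jd = false := by by_contra hj; exact hL.1 (Or.inl (by simpa using hj))
    refine lintegral_exp_le_one (measurableSet_emp (c := c) h hq a jd jc).compl (x := 1) (y := 1 / 32)
      (A := fun ω => ¬ (rview c q a jd jc ξ ω).Emp) (fun ω => ?_) ?_
    · rw [ind_pos (hL' ω), one_mul, mul_one]
      exact sub_le_sub_right (ind_mono fun hh => hh.2) _
    · have hs : {ω | ¬ (rview c q a jd jc ξ ω).Emp} = {ω | (rview c q a jd jc ξ ω).Emp}ᶜ := rfl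
      rw [hs, probReal_compl_eq_one_sub (measurableSet_emp (c := c) h hq a jd jc)]
      subst hjd
      rw [real_emp h hc hq]
      have h1 := le_noneProb_data (q := q) hc
      have h2 := Real.add_one_le_exp (-X q)
      have h3 := hL.2.2
      have h4 := X_nonneg q
      have h5 := Real.exp_one_lt_d9
      have h6 := Real.add_one_le_exp 1
      nlinarith
  · refine lintegral_exp_le_of_nonpos fun ω => ?_
    rw [ind_neg (p := Low q (rview c q a jd jc ξ ω) ∧ _) (fun hh => hL hh.1)]
    have := ind_nonneg (Low q (rview c q a jd jc ξ ω))
    linarith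

/-- Undisrupted slots with moderate contention. -/
def Mid (b : ℝ) (q : State) (v : View) : Prop := ¬ v.Dis ∧ 1 / 64 ≤ X q ∧ X q ≤ 2 * b

/-- A lower bound for the success probability in slots with moderate contention. -/
def midProb (b : ℝ) : ℝ := 1 / 128 * Real.exp (-(2 * b))

lemma midProb_pos (b : ℝ) : 0 < midProb b := by unfold midProb; positivity

include h hc hq in
lemma mid_bound (b : ℝ) : ∫⁻ ω, ENNReal.ofReal (Real.exp
    (midProb b / 2 * ind (Mid b q (rview c q a jd jc ξ ω)) -
      ind (rview c q a jd jc ξ ω).Suc)) ∂μ ≤ 1 := by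
  by_cases hL : ¬ (jd = true ∨ jc = true) ∧ 1 / 64 ≤ X q ∧ X q ≤ 2 * b
  · have hL' : ∀ ω, Mid b q (rview c q a jd jc ξ ω) := fun ω => hL
    have hjd : jd = false := by by_contra hj; exact hL.1 (Or.inl (by simpa using hj))
    refine lintegral_exp_le_one (measurableSet_suc (c := c) h hq a jd jc) (x := -1) (y := -(midProb b / 2))
      (fun ω => ?_) ?_
    · rw [ind_pos (hL' ω)]
      linarith
    · subst hjd
      have h1 := le_real_suc h hc hq a jc
      have h2 := le_noneProb_data (q := q) hc
      have h3 : Real.exp (-(2 * b)) ≤ Real.exp (-X q) := Real.exp_le_exp.mpr (by linarith [hL.2.2])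
      have h4 : midProb b ≤ X q / 2 * noneProb c q .data := by
        unfold midProb
        exact mul_le_mul (by linarith [hL.2.1]) (by linarith) (Real.exp_pos _).le
          (by linarith [hL.2.1])
      have h5 : Real.exp (-1) ≤ 1 / 2 := by
        rw [Real.exp_neg, inv_le_comm₀ (Real.exp_pos 1) (by norm_num)]
        linarith [Real.add_one_le_exp 1]
      have := midProb_pos b
      nlinarith
  · refine lintegral_exp_le_of_nonpos fun ω => ?_
    rw [ind_neg (p := Mid b q (rview c q a jd jc ξ ω)) hL]
    have := ind_nonneg (rview c q a jd jc ξ ω).Suc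
    linarith

include h hc hq in
-- X ≥ 8 gives P(empty) ≤ exp(−4) ≤ 1/50, and (e − 1)/50 ≤ 1/16.
lemma high_empty_bound {b : ℝ} (hb : 8 ≤ b) : ∫⁻ ω, ENNReal.ofReal (Real.exp
    (ind ((rview c q a jd jc ξ ω).Emp ∧ b ≤ X q) - 1 / 16 * ind (b ≤ X q))) ∂μ ≤ 1 := by
  by_cases hX : b ≤ X q
  · refine lintegral_exp_le_one (measurableSet_emp (c := c) h hq a jd jc) (x := 1) (y := 1 / 16)
      (fun ω => ?_) ?_
    · rw [ind_pos hX, one_mul, mul_one]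
      exact sub_le_sub_right (ind_mono fun hh => hh.1) _
    · have h1 := real_emp_le h hc hq a jd jc
      have h2 := noneProb_data_le (c := c) (q := q)
      have h3 : Real.exp (-(X q / 2)) ≤ Real.exp (-4) := Real.exp_le_exp.mpr (by linarith)
      have h4 := exp_neg_four_le
      have h5 := Real.exp_one_lt_d9
      have h6 := Real.add_one_le_exp 1
      have h7 : 0 ≤ μ.real {ω | (rview c q a jd jc ξ ω).Emp} := measureReal_nonneg
      nlinarith
  · refine lintegral_exp_le_of_nonpos fun ω => ?_
    rw [ind_neg (p := _ ∧ _) (fun hh => hX hh.2), ind_neg hX]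
    norm_num

include h hq in
-- The exponent is at least 8·max(ln k, 1) ≥ 4 + 4 ln k. The power k⁻⁴ is what keeps the expected
-- loss k·P(reset) small.
lemma real_cemp_high {b : ℝ} (hb : 8 ≤ b) (hc1 : 1 ≤ c) (hX : b ≤ X q) {k : ℕ × ℕ}
    (hk : ClockInv q k) :
    μ.real {ω | (rview c q a jd jc ξ ω).CEmp} ≤ 1 / 50 / (k.1 : ℝ) ^ 4 := by
  have hk1 : (1 : ℝ) ≤ k.1 := by exact_mod_cast hk.pos
  have h1 := real_cemp_le h (by linarith : (0 : ℝ) ≤ c) hq a jd jc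
  have h2 := noneProb_control_le (c := c) (by linarith) hq hk
  refine (h1.trans h2).trans ?_
  have hl : 0 ≤ Real.log k.1 := Real.log_nonneg hk1
  have h3 : Real.exp (-(c * max (Real.log k.1) 1 * X q)) ≤
      Real.exp (-4) * Real.exp (-(4 * Real.log k.1)) := by
    rw [← Real.exp_add]
    refine Real.exp_le_exp.mpr ?_
    have h4 : 1 ≤ max (Real.log k.1) 1 := le_max_right _ _
    have h5 : Real.log k.1 ≤ max (Real.log k.1) 1 := le_max_left _ _
    have h6 : 1 * max (Real.log k.1) 1 ≤ c * max (Real.log k.1) 1 := by gcongr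
    have h7 : max (Real.log k.1) 1 * 8 ≤ c * max (Real.log k.1) 1 * X q := by
      rw [one_mul] at h6
      exact mul_le_mul h6 (hb.trans hX) (by norm_num) (by positivity)
    linarith
  have h4 : Real.exp (-(4 * Real.log k.1)) = 1 / (k.1 : ℝ) ^ 4 := by
    rw [Real.exp_neg, show 4 * Real.log k.1 = ((4 : ℕ) : ℝ) * Real.log k.1 by norm_num,
      Real.exp_nat_mul, Real.exp_log (by linarith), one_div]
  rw [h4] at h3
  refine h3.trans ?_
  rw [div_eq_mul_one_div (1 / 50 : ℝ)]
  exact mul_le_mul_of_nonneg_right exp_neg_four_le (by positivity)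

include h hq in
-- A reset costs k, which is unbounded. Dividing by √n and keeping only k ≤ √n makes the exponent at
-- most 1, where exp x − 1 ≤ 2x linearises the moment.
lemma reset_bound {b : ℝ} (hb : 8 ≤ b) (hc1 : 1 ≤ c) {k : ℕ × ℕ} (hk : ClockInv q k) {n : ℕ}
    (hn : 1 ≤ n) : ∫⁻ ω, ENNReal.ofReal (Real.exp
    (k.1 / √n * ind (b ≤ X q ∧ (rview c q a jd jc ξ ω).CEmp ∧ k.1 ^ 2 ≤ n) -
      1 / 16 / √n * ind (b ≤ X q))) ∂μ ≤ 1 := by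
  have hk1 : (1 : ℝ) ≤ k.1 := by exact_mod_cast hk.pos
  have hsn : (0 : ℝ) < √n := Real.sqrt_pos.mpr (by exact_mod_cast hn)
  by_cases hX : b ≤ X q ∧ k.1 ^ 2 ≤ n
  · refine lintegral_exp_le_one (measurableSet_cemp (c := c) h hq a jd jc) (x := k.1 / √n)
      (y := 1 / 16 / √n) (fun ω => ?_) ?_
    · rw [ind_pos hX.1, mul_one]
      refine sub_le_sub_right ?_ _
      exact mul_le_mul_of_nonneg_left (ind_mono fun hh => hh.2.1) (by positivity)
    · have h1 := real_cemp_high h hq a jd jc hb hc1 hX.1 hk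
      have h2 : k.1 / √n ≤ (1 : ℝ) := by
        rw [div_le_one hsn]
        exact Real.le_sqrt_of_sq_le (by exact_mod_cast hX.2)
      have h0 : 0 ≤ k.1 / √n := by positivity
      have h3 : Real.exp (k.1 / √n) - 1 ≤ 2 * (k.1 / √n) := by
        have h4 := Real.abs_exp_sub_one_le (x := k.1 / √n) (by rw [abs_of_nonneg h0]; exact h2)
        rw [abs_of_nonneg h0] at h4
        exact (le_abs_self _).trans h4
      have h7 : 0 ≤ μ.real {ω | (rview c q a jd jc ξ ω).CEmp} := measureReal_nonneg
      calc _ ≤ 2 * (k.1 / √n) * (1 / 50 / (k.1 : ℝ) ^ 4) := by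
            gcongr
        _ = (1 / 25 / (k.1 : ℝ) ^ 3) / √n := by field_simp; norm_num
        _ ≤ 1 / 16 / √n := by
            refine div_le_div_of_nonneg_right ?_ hsn.le
            rw [div_le_iff₀ (by positivity)]
            have : (1 : ℝ) ≤ (k.1 : ℝ) ^ 3 := one_le_pow₀ hk1
            linarith
  · refine lintegral_exp_le_of_nonpos fun ω => ?_
    rw [ind_neg (p := _ ∧ _ ∧ _) (fun hh => hX ⟨hh.1, hh.2.2⟩), mul_zero, zero_sub]
    have := ind_nonneg (b ≤ X q)
    have : 0 ≤ 1 / 16 / √n * ind (b ≤ X q) := by positivity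
    linarith

include h hq in
-- For k² > n the probability is at most 1/(50n²). When n is one more than the number of earlier
-- slots with high contention, these charges are summable, so late resets are finitely many.
lemma late_reset_bound {b : ℝ} (hb : 8 ≤ b) (hc1 : 1 ≤ c) {k : ℕ × ℕ} (hk : ClockInv q k) {n : ℕ}
    (hn : 1 ≤ n) : ∫⁻ ω, ENNReal.ofReal (Real.exp
    (ind (b ≤ X q ∧ (rview c q a jd jc ξ ω).CEmp ∧ n < k.1 ^ 2) -
      1 / (n : ℝ) ^ 2 * ind (b ≤ X q))) ∂μ ≤ 1 := by
  have hn1 : (1 : ℝ) ≤ n := by exact_mod_cast hn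
  by_cases hX : b ≤ X q ∧ n < k.1 ^ 2
  · refine lintegral_exp_le_one (measurableSet_cemp (c := c) h hq a jd jc) (x := 1)
      (y := 1 / (n : ℝ) ^ 2) (fun ω => ?_) ?_
    · rw [ind_pos hX.1, mul_one, one_mul]
      exact sub_le_sub_right (ind_mono fun hh => hh.2.1) _
    · have h1 := real_cemp_high h hq a jd jc hb hc1 hX.1 hk
      have h2 : (n : ℝ) ≤ (k.1 : ℝ) ^ 2 := by exact_mod_cast hX.2.le
      have h5 := Real.exp_one_lt_d9
      have h6 := Real.add_one_le_exp 1
      calc _ ≤ 2 * (1 / 50 / (k.1 : ℝ) ^ 4) := by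
            gcongr
            linarith
        _ ≤ 2 * (1 / 50 / (n : ℝ) ^ 2) := by
            have : (n : ℝ) ^ 2 ≤ (k.1 : ℝ) ^ 4 := by
              calc (n : ℝ) ^ 2 ≤ ((k.1 : ℝ) ^ 2) ^ 2 := by gcongr
                _ = _ := by ring
            gcongr
        _ ≤ 1 / (n : ℝ) ^ 2 := by
            have : 0 ≤ 1 / (n : ℝ) ^ 2 := by positivity
            rw [div_eq_mul_one_div (1 / 50 : ℝ)]
            linarith
  · refine lintegral_exp_le_of_nonpos fun ω => ?_
    rw [ind_neg (p := _ ∧ _ ∧ _) (fun hh => hX ⟨hh.1, hh.2.2⟩), zero_sub]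
    have := ind_nonneg (b ≤ X q)
    have : 0 ≤ 1 / (n : ℝ) ^ 2 * ind (b ≤ X q) := by positivity
    linarith

lemma not_emp_of_suc {v : View} (h : v.Suc) : ¬ v.Emp := by
  rintro ⟨_, he⟩
  obtain ⟨i, _, hi⟩ := h
  rw [he] at hi
  exact absurd hi.symm (Finset.singleton_ne_empty i)

include h hc hq in
/-- Empty slots are compared with successes, on a scale `√n`. -/
lemma empty_suc_bound {n : ℕ} (hn : q.injected ≤ n) : ∫⁻ ω, ENNReal.ofReal (Real.exp
    ((X q / 2 * ind (rview c q a jd jc ξ ω).Emp / 4 - ind (rview c q a jd jc ξ ω).Suc) / √n -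
      Real.exp (-√n) * ind (2 * √n < X q / 2))) ∂μ ≤ 1 := by
  have hexp : 0 ≤ Real.exp (-√n) * ind (2 * √n < X q / 2) :=
    mul_nonneg (Real.exp_pos _).le (ind_nonneg _)
  have hS := fun ω => ind_nonneg (rview c q a jd jc ξ ω).Suc
  by_cases hjd : jd = true ∨ ¬ HasActive q
  · refine lintegral_exp_le_of_nonpos fun ω => ?_
    have h0 : X q / 2 * ind (rview c q a jd jc ξ ω).Emp = 0 := by
      rcases hjd with hj | hj
      · rw [ind_neg (p := View.Emp _), mul_zero]
        rintro ⟨he, _⟩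
        exact absurd (hj.symm.trans he) (by simp)
      · rw [X, wsum_eq_zero hj]; simp
    rw [h0]
    have : (0 / 4 - ind (rview c q a jd jc ξ ω).Suc) / √n ≤ 0 :=
      div_nonpos_of_nonpos_of_nonneg (by linarith [hS ω]) (Real.sqrt_nonneg _)
    linarith
  · push Not at hjd
    obtain ⟨hj, i, s, e, hi⟩ := hjd
    have hj : jd = false := by simpa using hj
    have hn1 : (1 : ℝ) ≤ n := by
      have := hq.lt_injected hi
      exact_mod_cast (by omega : 1 ≤ n)
    have hsn : 1 ≤ √n := Real.one_le_sqrt.mpr hn1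
    have hX0 := X_nonneg q
    set l := X q / 2 with hl
    have hl0 : 0 ≤ l := by positivity
    set y := l / 4 / √n with hy
    set z := 1 / √n with hz
    set d := Real.exp (-√n) * ind (2 * √n < l) with hd
    refine lintegral_exp_le (measurableSet_emp (c := c) h hq a jd jc) (measurableSet_suc (c := c) h hq a jd jc)
      (x := Real.exp (-d)) (α := Real.exp (-d) * (Real.exp y - 1))
      (β := Real.exp (-d) * (1 - Real.exp (-z))) (fun ω => ?_) ?_
    · rw [sub_eq_neg_add _ d, Real.exp_add]
      have : Real.exp ((l * ind (rview c q a jd jc ξ ω).Emp / 4 -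
          ind (rview c q a jd jc ξ ω).Suc) / √n) ≤ 1 + (Real.exp y - 1) *
            ind (rview c q a jd jc ξ ω).Emp - (1 - Real.exp (-z)) *
            ind (rview c q a jd jc ξ ω).Suc := by
        by_cases hs : (rview c q a jd jc ξ ω).Suc
        · rw [ind_pos hs, ind_neg (not_emp_of_suc hs)]
          have : (l * 0 / 4 - 1) / √n = -z := by rw [hz]; ring
          rw [this]
          linarith
        · rw [ind_neg hs]
          have : (l * ind (rview c q a jd jc ξ ω).Emp / 4 - 0) / √n =
              y * ind (rview c q a jd jc ξ ω).Emp := by rw [hy]; ring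
          rw [this, exp_ind]
          linarith
      calc _ ≤ Real.exp (-d) * _ := mul_le_mul_of_nonneg_left this (Real.exp_pos _).le
        _ = _ := by ring
    · subst hj
      have h1 := le_real_suc h hc hq a jc
      rw [real_emp h hc hq] at *
      set p := noneProb c q .data
      have hp0 : 0 ≤ p := noneProb_nonneg .data
      have hp1 : p ≤ Real.exp (-l) := noneProb_data_le
      set S := μ.real {ω | (rview c q a false jc ξ ω).Suc}
      have hz0 : 0 < z := by positivity
      have hz1 : z ≤ 1 := by rw [hz, div_le_one (by linarith)]; exact hsn
      have hzexp : z / 2 ≤ 1 - Real.exp (-z) := by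
        have h2 : Real.exp (-z) ≤ 1 / (1 + z) := by
          rw [Real.exp_neg, ← one_div]
          exact one_div_le_one_div_of_le (by linarith) (by linarith [Real.add_one_le_exp z])
        have h3 : 1 / (1 + z) ≤ 1 - z / 2 := by
          rw [div_le_iff₀ (by linarith)]
          nlinarith
        linarith
      have hS0 : 0 ≤ S := measureReal_nonneg
      have hkey : p * (Real.exp y - 1) - S * (1 - Real.exp (-z)) ≤ d := by
        -- For l > 2√n the gain exp(l/4) is beaten by P(empty) ≤ exp(−l), leaving at most exp(−√n),
        -- which is the extra charge.
        by_cases hbig : 2 * √n < l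
        · rw [hd, ind_pos hbig, mul_one]
          have hyl : y ≤ l / 4 := div_le_self (by positivity) hsn
          have h4 : p * (Real.exp y - 1) ≤ Real.exp (-l) * Real.exp y := by
            have : 0 ≤ Real.exp y - 1 := by
              have := Real.add_one_le_exp y
              have : 0 ≤ y := by positivity
              linarith
            exact mul_le_mul hp1 (by linarith) this (Real.exp_pos _).le
          have h5 : Real.exp (-l) * Real.exp y ≤ Real.exp (-√n) := by
            rw [← Real.exp_add]
            exact Real.exp_le_exp.mpr (by linarith)
          have : 0 ≤ S * (1 - Real.exp (-z)) := mul_nonneg hS0 (by linarith)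
          linarith
        -- Here y ≤ 1/2, so exp y − 1 ≤ 2y = lz/2. Against it stand P(success) ≥ l·p and 1 − exp(−z)
        -- ≥ z/2.
        · rw [hd, ind_neg hbig, mul_zero]
          have hbig := not_lt.mp hbig
          have hy1 : y ≤ 1 / 2 := by
            rw [hy, div_le_iff₀ (by linarith)]
            linarith
          have hy0 : 0 ≤ y := by positivity
          have h4 : Real.exp y - 1 ≤ 2 * y := by
            have := Real.abs_exp_sub_one_le (x := y) (by rw [abs_of_nonneg hy0]; linarith)
            rw [abs_of_nonneg hy0] at this
            exact (le_abs_self _).trans this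
          have h5 : 2 * y = l * (z / 2) := by rw [hy, hz]; ring
          have h6 : p * (Real.exp y - 1) ≤ p * (l * (z / 2)) :=
            mul_le_mul_of_nonneg_left (by linarith) hp0
          have h7 : l * p * (z / 2) ≤ S * (1 - Real.exp (-z)) :=
            mul_le_mul h1 hzexp (by linarith) hS0
          nlinarith
      have h8 : Real.exp (-d) * (d + 1) ≤ 1 := by
        rw [Real.exp_neg, inv_mul_le_iff₀ (Real.exp_pos d), mul_one]
        exact Real.add_one_le_exp d
      have h9 := mul_le_mul_of_nonneg_left hkey (Real.exp_pos (-d)).le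
      nlinarith

end SlotBounds

/-! ### Almost sure properties of an execution -/

/-- Number of periods of activity that have been started or may start. -/
def periods (q : ℕ → State) (v : ℕ → View) (t : ℕ) : ℕ := inj q t + inact q v t

/-- The almost sure properties of a path. -/
structure Typical (c : ℝ) (q : ℕ → State) (v : ℕ → View) : Prop where
  low : ∃ B, ∀ t, cum (fun r => ind (Low (q r) (v r) ∧ ¬ (v r).Emp) -
    1 / 32 * ind (Low (q r) (v r))) t ≤ B
  mid : ∃ B, ∀ t, cum (fun r => midProb 8 / 2 * ind (Mid 8 (q r) (v r)) - ind (v r).Suc) t ≤ B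
  highEmpty : ∃ B, ∀ t, cum (fun r => ind ((v r).Emp ∧ 8 ≤ X (q r)) -
    1 / 16 * ind (8 ≤ X (q r))) t ≤ B
  reset : ∃ B, ∀ t, cum (fun r => (clock v r).1 / √((highCount 8 q r + 1 : ℕ) : ℝ) *
      ind (8 ≤ X (q r) ∧ (v r).CEmp ∧ (clock v r).1 ^ 2 ≤ highCount 8 q r + 1) -
    1 / 16 / √((highCount 8 q r + 1 : ℕ) : ℝ) * ind (8 ≤ X (q r))) t ≤ B
  lateReset : ∃ B, ∀ t, cum (fun r =>
      ind (8 ≤ X (q r) ∧ (v r).CEmp ∧ highCount 8 q r + 1 < (clock v r).1 ^ 2) -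
    1 / ((highCount 8 q r + 1 : ℕ) : ℝ) ^ 2 * ind (8 ≤ X (q r))) t ≤ B
  emptySuc : ∃ B, ∀ t, cum (fun r =>
      (X (q r) / 2 * ind (v r).Emp / 4 - ind (v r).Suc) / √(periods q v r : ℝ) -
    Real.exp (-√(periods q v r : ℝ)) * ind (2 * √(periods q v r : ℝ) < X (q r) / 2)) t ≤ B
  attempts : ∀ ch, ∃ B, ∀ t, cum (fun r => ((snd (v r) ch).card : ℝ) -
    2 * psum (q r) (Packet.pr c ch)) t ≤ B

section Typical

variable {Ω : Type*} [mΩ : MeasurableSpace Ω] {μ : Measure Ω} [IsProbabilityMeasure μ]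
  {ℱ : Filtration ℕ mΩ} {coin : ℕ → Channel → ℕ → Ω → ℝ}

theorem ae_typical (hfc : FairCoins μ ℱ coin) {c : ℝ} (hc : 1 ≤ c) (adv : Adversary ℱ) :
    ∀ᵐ ω ∂μ, Typical c (qs c adv coin ω) (vs c adv coin ω) := by
  have hc0 : 0 ≤ c := by linarith
  have hS := hfc.slotCoins
  have hI : ∀ ω t, Inv (qs c adv coin ω t) := fun ω => (isPath c adv coin ω).inv
  have hK : ∀ ω t, ClockInv (qs c adv coin ω t) (clock (vs c adv coin ω) t) := fun ω =>
    clockInv (isPath c adv coin ω)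
  have hunit : ∀ t, Adapt (ℱ t) fun _ : Ω => () := fun t => adapt_const ()
  have hkn : ∀ t, Adapt (ℱ t) fun ω =>
      (clock (vs c adv coin ω) t, highCount 8 (qs c adv coin ω) t + 1) := fun t =>
    (adapt_clock hfc c adv t).prodMk ((adapt_highCount hfc c adv 8 t).comp (· + 1))
  have hper : ∀ t, Adapt (ℱ t) fun ω => periods (qs c adv coin ω) (vs c adv coin ω) t := fun t =>
    (((adapt_state_view hfc c adv t).1.comp State.injected).prodMk (adapt_inact hfc c adv t)).comp
      fun x => x.1 + x.2
  have h1 := ae_cum_le hfc c adv hunit (fun q v _ => ind (Low q v ∧ ¬ v.Emp) - 1 / 32 * ind (Low q v))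
    fun t ω => low_bound (hS t) hc0 (hI ω t) _ _ _
  have h2 := ae_cum_le hfc c adv hunit (fun q v _ => midProb 8 / 2 * ind (Mid 8 q v) - ind v.Suc)
    fun t ω => mid_bound (hS t) hc0 (hI ω t) _ _ _ 8
  have h3 := ae_cum_le hfc c adv hunit
    (fun q v _ => ind (v.Emp ∧ 8 ≤ X q) - 1 / 16 * ind (8 ≤ X q))
    fun t ω => high_empty_bound (hS t) hc0 (hI ω t) _ _ _ le_rfl
  have h4 := ae_cum_le hfc c adv hkn (fun q v (e : (ℕ × ℕ) × ℕ) => e.1.1 / √(e.2 : ℝ) *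
      ind (8 ≤ X q ∧ v.CEmp ∧ e.1.1 ^ 2 ≤ e.2) - 1 / 16 / √(e.2 : ℝ) * ind (8 ≤ X q))
    fun t ω => reset_bound (hS t) (hI ω t) _ _ _ le_rfl hc (hK ω t) (by omega)
  have h5 := ae_cum_le hfc c adv hkn (fun q v (e : (ℕ × ℕ) × ℕ) =>
      ind (8 ≤ X q ∧ v.CEmp ∧ e.2 < e.1.1 ^ 2) - 1 / (e.2 : ℝ) ^ 2 * ind (8 ≤ X q))
    fun t ω => late_reset_bound (hS t) (hI ω t) _ _ _ le_rfl hc (hK ω t) (by omega)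
  have h6 := ae_cum_le hfc c adv hper (fun q v (n : ℕ) =>
      (X q / 2 * ind v.Emp / 4 - ind v.Suc) / √(n : ℝ) -
        Real.exp (-√(n : ℝ)) * ind (2 * √(n : ℝ) < X q / 2))
    fun t ω => empty_suc_bound (hS t) hc0 (hI ω t) _ _ _ (by unfold periods inj; omega)
  have h7 := fun ch => ae_cum_le hfc c adv hunit
    (fun q v _ => ((snd v ch).card : ℝ) - 2 * psum q (Packet.pr c ch))
    fun t ω => lintegral_exp_card_le (hS t) hc0 (hI ω t) _ _ _ ch
  filter_upwards [h1, h2, h3, h4, h5, h6, h7 .data, h7 .control] with ω g1 g2 g3 g4 g5 g6 g7 g8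
  exact ⟨g1, g2, g3, g4, g5, g6, fun ch => by cases ch; exacts [g7, g8]⟩

end Typical

/-! ### Sums of slowly decaying charges -/

section Sums

/-- Telescoping: 1/√(x+1) ≤ 2(√(x+1) − √x). -/
lemma cum_div_sqrt_le (p : ℕ → Prop) (t : ℕ) :
    cum (fun r => 1 / √(cnt p r + 1) * ind (p r)) t ≤ 2 * √(cnt p t) := by
  induction t with
  | zero => simp
  | succ t ih =>
    rw [cum_succ, cnt_succ]
    have hx := cnt_nonneg p t
    by_cases hp : p t
    · rw [ind_pos hp, mul_one]
      set x := cnt p t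
      have h1 : 0 < √(x + 1) := Real.sqrt_pos.mpr (by linarith)
      have h2 := Real.sqrt_nonneg x
      have h3 : √(x + 1) ^ 2 = x + 1 := Real.sq_sqrt (by linarith)
      have h4 : √x ^ 2 = x := Real.sq_sqrt hx
      have h5 : √x ≤ √(x + 1) := Real.sqrt_le_sqrt (by linarith)
      have h6 : 1 / √(x + 1) ≤ 2 * (√(x + 1) - √x) := by
        rw [div_le_iff₀ h1]
        nlinarith
      linarith
    · rw [ind_neg hp]; simpa using ih

lemma cum_div_sq_le (p : ℕ → Prop) (t : ℕ) :
    cum (fun r => 1 / (cnt p r + 1) ^ 2 * ind (p r)) t ≤ 2 := by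
  suffices h : cum (fun r => 1 / (cnt p r + 1) ^ 2 * ind (p r)) t ≤ 2 - 2 / (cnt p t + 1) by
    have : 0 ≤ 2 / (cnt p t + 1) := div_nonneg (by norm_num) (by linarith [cnt_nonneg p t])
    linarith
  induction t with
  | zero => simp [cnt]
  | succ t ih =>
    rw [cum_succ, cnt_succ]
    have hx := cnt_nonneg p t
    by_cases hp : p t
    · rw [ind_pos hp, mul_one]
      set x := cnt p t
      have h1 : 1 / (x + 1) ^ 2 ≤ 2 / (x + 1) - 2 / (x + 1 + 1) := by
        rw [div_sub_div _ _ (by positivity) (by positivity), div_le_div_iff₀ (by positivity)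
          (by positivity)]
        nlinarith [mul_nonneg hx hx, mul_nonneg (mul_nonneg hx hx) hx]
      linarith
    · rw [ind_neg hp]; simpa using ih

/-- A nonnegative sum is controlled by the sum scaled down by a growing factor. -/
lemma cum_le_mul_cum_div {f g : ℕ → ℝ} (hf : ∀ r, 0 ≤ f r) (hg : Monotone g) (hg0 : ∀ r, 0 ≤ g r)
    (hfg : ∀ r, g r = 0 → f r = 0) (t : ℕ) :
    cum f t ≤ g t * cum (fun r => f r / g r) t := by
  rw [← cum_mul]
  refine Finset.sum_le_sum fun r hr => ?_
  rcases (hg0 r).eq_or_lt with h0 | h0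
  · rw [hfg r h0.symm]; simp
  · rw [mul_div_assoc', le_div_iff₀ h0]
    have := hg (Finset.mem_range.mp hr).le
    have := hf r
    nlinarith

/-- A bounded count means that p holds only finitely often, so even unbounded costs have bounded
sums. -/
lemma exists_bound_of_cnt_le {p : ℕ → Prop} {B : ℝ} (h : ∀ t, cnt p t ≤ B) {f : ℕ → ℝ} :
    ∃ B', ∀ t, cum (fun r => f r * ind (p r)) t ≤ B' := by
  have hev : ∃ t₀, ∀ r, t₀ ≤ r → ¬ p r := by
    by_contra hcon
    push Not at hcon
    have : ∀ k : ℕ, ∃ t, (k : ℝ) ≤ cnt p t := by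
      intro k
      induction k with
      | zero => exact ⟨0, by simp [cnt]⟩
      | succ k ih =>
        obtain ⟨t, ht⟩ := ih
        obtain ⟨r, hr, hp⟩ := hcon t
        refine ⟨r + 1, ?_⟩
        rw [cnt_succ, ind_pos hp]
        push_cast
        linarith [cnt_mono p hr]
    obtain ⟨k, hk⟩ := exists_nat_gt B
    obtain ⟨t, ht⟩ := this k
    linarith [h t]
  obtain ⟨t₀, ht₀⟩ := hev
  have hconst : ∀ j, cum (fun r => f r * ind (p r)) (t₀ + j) = cum (fun r => f r * ind (p r)) t₀ := by
    intro j
    induction j with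
    | zero => rfl
    | succ j ih => rw [← add_assoc, cum_succ, ih, ind_neg (ht₀ _ (by omega))]; simp
  refine ⟨∑ r ∈ Finset.range t₀, |f r|, fun t => ?_⟩
  have habs : ∀ s ≤ t₀, cum (fun r => f r * ind (p r)) s ≤ ∑ r ∈ Finset.range t₀, |f r| := by
    intro s hs
    refine le_trans (Finset.sum_le_sum fun r _ => ?_)
      (Finset.sum_le_sum_of_subset_of_nonneg (Finset.range_subset_range.mpr hs)
        fun r _ _ => abs_nonneg (f r))
    by_cases hp : p r
    · rw [ind_pos hp, mul_one]; exact le_abs_self _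
    · rw [ind_neg hp, mul_zero]; exact abs_nonneg _
  rcases le_total t t₀ with hle | hle
  · exact habs t hle
  · obtain ⟨j, rfl⟩ := Nat.exists_eq_add_of_le hle
    rw [hconst j]; exact habs t₀ le_rfl

end Sums

/-! ### Inactivations, resets and slots of typical executions -/

section Deterministic

variable {c : ℝ} {q : ℕ → State} {v : ℕ → View}

lemma inj_mono (h : IsPath q v) : Monotone (inj q) :=
  monotone_nat_of_le_succ fun t => by
    unfold inj; rw [h.succ]; exact Nat.le_add_right _ _

lemma periods_mono (h : IsPath q v) : Monotone (periods q v) :=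
  monotone_nat_of_le_succ fun t => by
    have : inj q t ≤ inj q (t + 1) := inj_mono h (Nat.le_succ t)
    simp only [periods, inact, Finset.sum_range_succ]
    omega

/-- If all ages exceeded the number of injected packets, X would be a sum of that many terms, each
at most its reciprocal, hence at most 1. -/
lemma exists_young (h : IsPath q v) {t : ℕ} (hX : 1 < X (q t)) :
    ∃ i s e, (q t).packet i = .active s e ∧ s ≤ inj q t := by
  by_contra hcon
  push Not at hcon
  have hinj : 0 < inj q t := by
    obtain ⟨i, s, e, hi⟩ := hasActive_of_X_pos (by linarith : 0 < X (q t))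
    exact Nat.pos_of_ne_zero fun h0 => by
      have := (h.inv t).lt_injected hi
      unfold inj at h0; omega
  have hinj' : (0 : ℝ) < inj q t := by exact_mod_cast hinj
  have : X (q t) ≤ ∑ i ∈ Finset.range (q t).injected, 1 / (inj q t : ℝ) := by
    unfold X wsum psum
    refine Finset.sum_le_sum fun i _ => ?_
    cases hp : (q t).packet i with
    | active s e =>
      have h1 : (inj q t : ℝ) ≤ s := by exact_mod_cast (hcon i s e hp).le
      exact one_div_le_one_div_of_le hinj' h1
    | _ => simp [Packet.wt]
  rw [Finset.sum_const, Finset.card_range, nsmul_eq_mul] at this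
  have h2 : ((q t).injected : ℝ) * (1 / (inj q t : ℝ)) = 1 := by
    rw [mul_one_div]; exact div_self hinj'.ne'
  linarith

/-- Slots of extreme contention are rare. -/
lemma extreme_slots_le (h : IsPath q v) (t : ℕ) :
    cnt (fun r => 2 * √(periods q v r : ℝ) < X (q r) / 2) t ≤
      ((periods q v t : ℝ) + 1) * periods q v t := by
  classical
  -- An extreme slot contains an active packet of age at most the number of periods, and one period
  -- has at most `periods` + 1 slots of such ages.
  let w : ℕ → ℝ := fun a => ind (a ≤ periods q v t)
  have hw : ∀ a, 0 ≤ w a := fun a => ind_nonneg _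
  have hW : ∀ n, ∑ a ∈ Finset.range n, w a ≤ (periods q v t : ℝ) + 1 := by
    intro n
    have h1 : ∑ a ∈ Finset.range n, w a =
        (((Finset.range n).filter fun a => a ≤ periods q v t).card : ℝ) := by
      rw [Finset.natCast_card_filter]
      exact Finset.sum_congr rfl fun a _ => by simp only [w, ind]; congr
    rw [h1]
    have h2 : ((Finset.range n).filter fun a => a ≤ periods q v t) ⊆
        Finset.range (periods q v t + 1) := by
      intro a ha
      simp at ha ⊢; omega
    have := Finset.card_le_card h2
    rw [Finset.card_range] at this
    exact_mod_cast this
  have key := cum_wsum_le h hw hW t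
  have hp : (periods q v t : ℝ) = inj q t + inact q v t := by simp [periods]
  rw [← hp] at key
  refine le_trans ?_ key
  unfold cnt cum
  refine Finset.sum_le_sum fun r hr => ?_
  by_cases hr' : 2 * √(periods q v r : ℝ) < X (q r) / 2
  · rw [ind_pos hr']
    have hXpos : 0 < X (q r) := by linarith [Real.sqrt_nonneg (periods q v r : ℝ)]
    have hX : 1 < X (q r) := by
      have h1 : 1 ≤ √(periods q v r : ℝ) := by
        rw [Real.one_le_sqrt]
        obtain ⟨i, s, e, hi⟩ := hasActive_of_X_pos hXpos
        have := (h.inv r).lt_injected hi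
        have h2 : 1 ≤ periods q v r := by unfold periods inj; omega
        exact_mod_cast h2
      linarith
    obtain ⟨i, s, e, hi, hs⟩ := exists_young h hX
    have h1 := le_wsum (h.inv r) hw hi
    have h2 : s ≤ periods q v t := by
      have := periods_mono h (Finset.mem_range.mp hr).le
      have h3 : inj q r ≤ periods q v r := Nat.le_add_right _ _
      omega
    simpa [w, ind_pos h2] using h1
  · rw [ind_neg hr']
    exact wsum_nonneg hw

/-- With m periods at most m(m + 1) extreme slots have occurred, while exp(√m) ≥ m⁴/8!. The charge
is thus at most 9·8!/(x + 1)² after x extreme slots, and the sum of 1/(x + 1)² is at most 2. -/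
lemma extreme_charge_le (h : IsPath q v) (t : ℕ) :
    cum (fun r => Real.exp (-√(periods q v r : ℝ)) *
      ind (2 * √(periods q v r : ℝ) < X (q r) / 2)) t ≤ 725760 := by
  have h1 := cum_div_sq_le (fun r => 2 * √(periods q v r : ℝ) < X (q r) / 2) t
  have h2 : cum (fun r => Real.exp (-√(periods q v r : ℝ)) *
      ind (2 * √(periods q v r : ℝ) < X (q r) / 2)) t ≤ 362880 *
      cum (fun r => 1 / (cnt (fun r => 2 * √(periods q v r : ℝ) < X (q r) / 2) r + 1) ^ 2 *
        ind (2 * √(periods q v r : ℝ) < X (q r) / 2)) t := by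
    rw [← cum_mul]
    refine cum_le_cum (fun r => ?_) t
    by_cases hr : 2 * √(periods q v r : ℝ) < X (q r) / 2
    · rw [ind_pos hr, mul_one, mul_one, mul_one_div]
      have hXpos : 0 < X (q r) := by linarith [Real.sqrt_nonneg (periods q v r : ℝ)]
      have hm : (1 : ℝ) ≤ periods q v r := by
        obtain ⟨i, s, e, hi⟩ := hasActive_of_X_pos hXpos
        have := (h.inv r).lt_injected hi
        have h2 : 1 ≤ periods q v r := by unfold periods inj; omega
        exact_mod_cast h2
      have hcnt := extreme_slots_le h r
      have hc0 := cnt_nonneg (fun r => 2 * √(periods q v r : ℝ) < X (q r) / 2) r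
      set x := cnt (fun r => 2 * √(periods q v r : ℝ) < X (q r) / 2) r
      set m : ℝ := (periods q v r : ℝ)
      have h3 : m ^ 4 / 40320 ≤ Real.exp (√m) := by
        have := Real.pow_div_factorial_le_exp (√m) (Real.sqrt_nonneg m) 8
        have h8 : √m ^ 8 = m ^ 4 := by
          rw [show (8 : ℕ) = 2 * 4 by norm_num, pow_mul, Real.sq_sqrt (by linarith)]
        rw [h8] at this
        norm_num [Nat.factorial] at this
        exact this
      have h4 : x + 1 ≤ 3 * m ^ 2 := by nlinarith
      have h5 : (x + 1) ^ 2 ≤ 9 * m ^ 4 := by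
        calc (x + 1) ^ 2 ≤ (3 * m ^ 2) ^ 2 := by gcongr
          _ = 9 * m ^ 4 := by ring
      rw [Real.exp_neg, inv_eq_one_div, div_le_div_iff₀ (Real.exp_pos _) (by positivity)]
      linarith
    · rw [ind_neg hr]; simp
  linarith

/-- The number of inactivations is at most proportional to the number of packets. -/
lemma inact_le_inj (h : IsPath q v) (hT : Typical c q v) :
    ∃ B, ∀ t, (inact q v t : ℝ) ≤ 1200 * inj q t + B := by
  obtain ⟨B, hB⟩ := hT.emptySuc
  refine ⟨288 * (|B| + 725760) ^ 2, fun t => ?_⟩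
  have h1 := hB t
  have h2 := extreme_charge_le h t
  rw [cum_sub] at h1
  have hsplit : cum (fun r => (X (q r) / 2 * ind (v r).Emp / 4 - ind (v r).Suc) /
      √(periods q v r : ℝ)) t = cum (fun r => X (q r) / 2 * ind (v r).Emp / 4 /
      √(periods q v r : ℝ)) t - cum (fun r => ind (v r).Suc / √(periods q v r : ℝ)) t := by
    rw [← cum_sub]
    congr 1
    ext r
    rw [sub_div]
  rw [hsplit] at h1
  have hnn : ∀ r, 0 ≤ X (q r) / 2 * ind (v r).Emp / 4 := fun r => by
    have := X_nonneg (q r)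
    have := ind_nonneg (v r).Emp
    positivity
  have h3 := cum_le_mul_cum_div hnn (g := fun r => √(periods q v r : ℝ))
    (fun a b hab => Real.sqrt_le_sqrt (by exact_mod_cast periods_mono h hab))
    (fun r => Real.sqrt_nonneg _) (fun r hr => by
      have h0 : periods q v r = 0 := by
        rw [Real.sqrt_eq_zero (by positivity)] at hr
        exact_mod_cast hr
      have hna : ¬ HasActive (q r) := by
        rintro ⟨i, s, e, hi⟩
        have := (h.inv r).lt_injected hi
        unfold periods inj at h0
        omega
      have hX0 : X (q r) = 0 := wsum_eq_zero hna _
      rw [hX0]; simp) t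
  have h4 : cum (fun r => X (q r) / 2 * ind (v r).Emp / 4) t =
      1 / 4 * cum (fun r => X (q r) / 2 * ind (v r).Emp) t := by
    rw [← cum_mul]; congr 1; ext r; ring
  have h5 := inact_le h t
  -- At a success, the earlier successes plus one are at most the packets injected, hence at most
  -- the periods.
  have h6 : cum (fun r => ind (v r).Suc / √(periods q v r : ℝ)) t ≤ 2 * √(inj q t : ℝ) := by
    refine le_trans (cum_le_cum (fun r => ?_) t) ((cum_div_sqrt_le (fun r => (v r).Suc) t).trans ?_)
    · by_cases hs : (v r).Suc
      · rw [ind_pos hs, mul_one]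
        have := succ_count_le h r
        rw [ind_pos hs] at this
        have hle : (inj q r : ℝ) ≤ periods q v r := by
          exact_mod_cast (Nat.le_add_right (inj q r) (inact q v r))
        have h0 := cnt_nonneg (fun r => (v r).Suc) r
        exact one_div_le_one_div_of_le (Real.sqrt_pos.mpr (by linarith))
          (Real.sqrt_le_sqrt (this.trans hle))
      · rw [ind_neg hs]; simp
    · have := succ_count_le h t
      have := ind_nonneg (v t).Suc
      gcongr
      linarith
  have hp : (periods q v t : ℝ) = inj q t + inact q v t := by simp [periods]
  have hy0 := Real.sqrt_nonneg (periods q v t : ℝ)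
  have hy2 : √(periods q v t : ℝ) ^ 2 = inj q t + inact q v t := by
    rw [Real.sq_sqrt (by positivity), hp]
  have hz0 := Real.sqrt_nonneg (inj q t : ℝ)
  have hz2 : √(inj q t : ℝ) ^ 2 = inj q t := Real.sq_sqrt (by positivity)
  set y := √(periods q v t : ℝ)
  set z := √(inj q t : ℝ)
  set D := |B| + 725760 with hD
  have h7 : cum (fun r => X (q r) / 2 * ind (v r).Emp / 4 / √(periods q v r : ℝ)) t ≤ D + 2 * z := by
    linarith [le_abs_self B]
  have h8 : (inact q v t : ℝ) ≤ 12 * y * (D + 2 * z) := by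
    have h9 := mul_le_mul_of_nonneg_left h7 hy0
    have h10 : (0 : ℝ) ≤ inact q v t := by positivity
    linarith
  -- By the inequality of means, 12y(D + 2z) ≤ y²/2 + 144D² + 576z². Since y² is packets plus
  -- inactivations, half of the inactivations is absorbed on the left.
  nlinarith [sq_nonneg (y - 12 * (D + 2 * z)), sq_nonneg (D - 2 * z)]

/-- The time lost by resets under high contention. -/
lemma bad_le (h : IsPath q v) (hT : Typical c q v) :
    ∃ B, ∀ t, bad 8 q v (fun r => Reset (v r) (clock v r)) t ≤
      1 / 3 * cnt (fun r => 8 ≤ X (q r)) t + B := by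
  obtain ⟨B1, h1⟩ := hT.highEmpty
  obtain ⟨B2, h2⟩ := hT.reset
  obtain ⟨B3, h3⟩ := hT.lateReset
  have hN : ∀ r, ((highCount 8 q r + 1 : ℕ) : ℝ) = cnt (fun r => 8 ≤ X (q r)) r + 1 := fun r => by
    push_cast; rw [highCount_cast]
  -- Late resets are finitely many, so their total cost is bounded although no single cost is.
  have hlate : ∀ t, cnt (fun r => 8 ≤ X (q r) ∧ (v r).CEmp ∧
      highCount 8 q r + 1 < (clock v r).1 ^ 2) t ≤ B3 + 2 := by
    intro t
    have h4 := h3 t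
    rw [cum_sub] at h4
    simp only [hN] at h4
    have h5 := cum_div_sq_le (fun r => 8 ≤ X (q r)) t
    unfold cnt at h5 ⊢
    unfold cnt at h4
    linarith
  obtain ⟨B4, h4⟩ := exists_bound_of_cnt_le hlate (f := fun r => ((clock v r).1 : ℝ))
  -- Undoing the scaling turns (1/8)√(V+1) + B2 into (V+1)/8 + B2·√(V+1), and the mixed term is at
  -- most (V+1)/16 + 4·B2². Together with 1/15 for resets caused by empty data slots, the fraction
  -- stays below 1/3.
  have hearly : ∀ t, cum (fun r => (clock v r).1 * ind (8 ≤ X (q r) ∧ (v r).CEmp ∧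
      (clock v r).1 ^ 2 ≤ highCount 8 q r + 1)) t ≤
      3 / 16 * cnt (fun r => 8 ≤ X (q r)) t + (3 / 16 + 4 * B2 ^ 2) := by
    intro t
    have h5 := h2 t
    rw [cum_sub] at h5
    simp only [hN] at h5
    have h6 := cum_div_sqrt_le (fun r => 8 ≤ X (q r)) t
    have h7 : cum (fun r => 1 / 16 / √(cnt (fun r => 8 ≤ X (q r)) r + 1) * ind (8 ≤ X (q r))) t =
        1 / 16 * cum (fun r => 1 / √(cnt (fun r => 8 ≤ X (q r)) r + 1) * ind (8 ≤ X (q r))) t := by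
      rw [← cum_mul]; congr 1; ext r; ring
    have h8 := cum_le_mul_cum_div (f := fun r => (clock v r).1 * ind (8 ≤ X (q r) ∧ (v r).CEmp ∧
      (clock v r).1 ^ 2 ≤ highCount 8 q r + 1))
      (g := fun r => √(cnt (fun r => 8 ≤ X (q r)) r + 1))
      (fun r => mul_nonneg (by positivity) (ind_nonneg _))
      (fun a b hab => Real.sqrt_le_sqrt (by linarith [cnt_mono (fun r => 8 ≤ X (q r)) hab]))
      (fun r => Real.sqrt_nonneg _) (fun r hr => by
        have := cnt_nonneg (fun r => 8 ≤ X (q r)) r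
        have h0 : 0 < √(cnt (fun r => 8 ≤ X (q r)) r + 1) := Real.sqrt_pos.mpr (by linarith)
        exact absurd hr h0.ne') t
    have h9 : cum (fun r => (clock v r).1 * ind (8 ≤ X (q r) ∧ (v r).CEmp ∧
        (clock v r).1 ^ 2 ≤ highCount 8 q r + 1) / √(cnt (fun r => 8 ≤ X (q r)) r + 1)) t =
        cum (fun r => (clock v r).1 / √(cnt (fun r => 8 ≤ X (q r)) r + 1) *
        ind (8 ≤ X (q r) ∧ (v r).CEmp ∧ (clock v r).1 ^ 2 ≤ highCount 8 q r + 1)) t := by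
      congr 1; ext r; ring
    rw [h9] at h8
    have hV := cnt_nonneg (fun r => 8 ≤ X (q r)) t
    set V := cnt (fun r => 8 ≤ X (q r)) t
    have hs0 := Real.sqrt_nonneg (V + 1)
    have hs2 : √(V + 1) ^ 2 = V + 1 := Real.sq_sqrt (by linarith)
    have hs3 : √V ≤ √(V + 1) := Real.sqrt_le_sqrt (by linarith)
    have h10 : √(V + 1) * cum (fun r => (clock v r).1 / √(cnt (fun r => 8 ≤ X (q r)) r + 1) *
        ind (8 ≤ X (q r) ∧ (v r).CEmp ∧ (clock v r).1 ^ 2 ≤ highCount 8 q r + 1)) t ≤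
        √(V + 1) * (1 / 8 * √(V + 1) + B2) :=
      mul_le_mul_of_nonneg_left (by linarith) hs0
    have h11 := h8.trans h10
    nlinarith [sq_nonneg (√(V + 1) - 8 * B2)]
  refine ⟨(3 / 16 + 4 * B2 ^ 2) + B4 + 16 / 15 * B1, fun t => ?_⟩
  have h5 := bad_data_le h 8 t
  have h6 := h1 t
  rw [cum_sub, cum_mul] at h6
  have h7 : bad 8 q v (fun r => Reset (v r) (clock v r)) t ≤
      cum (fun r => (clock v r).1 * ind (8 ≤ X (q r) ∧ (v r).CEmp ∧
      (clock v r).1 ^ 2 ≤ highCount 8 q r + 1)) t + cum (fun r => (clock v r).1 *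
      ind (8 ≤ X (q r) ∧ (v r).CEmp ∧ highCount 8 q r + 1 < (clock v r).1 ^ 2)) t +
      bad 8 q v (fun r => ¬ (v r).CEmp ∧ Reset (v r) (clock v r)) t := by
    unfold bad
    rw [← cum_add, ← cum_add]
    refine cum_le_cum (fun r => ?_) t
    have hk : (0 : ℝ) ≤ (clock v r).1 := by positivity
    have i1 := ind_nonneg (8 ≤ X (q r) ∧ (v r).CEmp ∧
      (clock v r).1 ^ 2 ≤ highCount 8 q r + 1)
    have i2 := ind_nonneg (8 ≤ X (q r) ∧ (v r).CEmp ∧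
      highCount 8 q r + 1 < (clock v r).1 ^ 2)
    have i3 := ind_nonneg (8 ≤ X (q r) ∧ ¬ (v r).CEmp ∧ Reset (v r) (clock v r))
    have : ind (8 ≤ X (q r) ∧ Reset (v r) (clock v r)) ≤ ind (8 ≤ X (q r) ∧ (v r).CEmp ∧
      (clock v r).1 ^ 2 ≤ highCount 8 q r + 1) + ind (8 ≤ X (q r) ∧ (v r).CEmp ∧
      highCount 8 q r + 1 < (clock v r).1 ^ 2) +
      ind (8 ≤ X (q r) ∧ ¬ (v r).CEmp ∧ Reset (v r) (clock v r)) := by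
      by_cases hR : 8 ≤ X (q r) ∧ Reset (v r) (clock v r)
      · rw [ind_pos hR]
        by_cases hce : (v r).CEmp
        · rcases le_or_gt ((clock v r).1 ^ 2) (highCount 8 q r + 1) with hk | hk
          · rw [ind_pos (p := _ ∧ _ ∧ _ ≤ _) ⟨hR.1, hce, hk⟩]; linarith
          · rw [ind_pos (p := _ ∧ _ ∧ _ < _) ⟨hR.1, hce, hk⟩]; linarith
        · rw [ind_pos (p := _ ∧ ¬ _ ∧ _) ⟨hR.1, hce, hR.2⟩]; linarith
      · rw [ind_neg hR]; linarith
    nlinarith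
  have h8 : (0 : ℝ) ≤ (clock v t).2 * ind (8 ≤ X (q t)) := mul_nonneg (by positivity) (ind_nonneg _)
  have h9 := hearly t
  have h10 := h4 t
  have hV := cnt_nonneg (fun r => 8 ≤ X (q r)) t
  unfold cnt at *
  linarith

/-- The constant in the bound on the number of slots. -/
def slotConst : ℝ := 1000 * (1 + 2 / midProb 8)

lemma slotConst_ge : 1000 ≤ slotConst := by
  have := midProb_pos 8
  unfold slotConst
  have : 0 ≤ 2 / midProb 8 := by positivity
  linarith

/-- At settled times, the number of slots is proportional to the number of successes and
disruptions. -/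
lemma slots_le (h : IsPath q v) (hT : Typical c q v) :
    ∃ B, ∀ t, ((clock v t).1 = 1 ∨ X (q t) < 8) → cnt (fun r => Live (q r) (v r)) t ≤
      slotConst * (cnt (fun r => (v r).Suc) t + cnt (fun r => Live (q r) (v r) ∧ (v r).Dis) t) + B := by
  obtain ⟨B1, h1⟩ := hT.low
  obtain ⟨B2, h2⟩ := hT.mid
  obtain ⟨B3, h3⟩ := bad_le h hT
  refine ⟨1000 * (|B1| + |B3| + 1 + 2 / midProb 8 * |B2|), fun t ht => ?_⟩
  have g1 := h1 t
  rw [cum_sub, cum_mul] at g1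
  have g2 := h2 t
  rw [cum_sub, cum_mul] at g2
  have g3 := h3 t
  have hhigh := high_slots_le (b := 8) (by norm_num) h ht
  have hact := active_slots_le h t
  have hidle := idle_slots_le h t
  have hlast := ind_le_one (1 ≤ X (q t))
  have hHA : ∀ r, 1 / 64 ≤ X (q r) → HasActive (q r) := fun r hr =>
    hasActive_of_X_pos (by linarith)
  have hD : cnt (fun r => HasActive (q r) ∧ (v r).Dis) t ≤
      cnt (fun r => Live (q r) (v r) ∧ (v r).Dis) t :=
    cnt_le_cnt (fun r hr => ⟨hr.1.live (h.inv r) _, hr.2⟩) t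
  have hV : cnt (fun r => 8 ≤ X (q r)) t ≤ cnt (fun r => 8 ≤ X (q r) ∧ X (q r) ≤ 2 * 8) t +
      cnt (fun r => 2 * 8 < X (q r)) t :=
    cnt_le_add (fun r hr => (le_or_gt (X (q r)) (2 * 8)).imp (fun h' => ⟨hr, h'⟩) id) t
  have hM : cnt (fun r => 8 ≤ X (q r) ∧ X (q r) ≤ 2 * 8) t ≤ cnt (fun r => Mid 8 (q r) (v r)) t +
      cnt (fun r => HasActive (q r) ∧ (v r).Dis) t := by
    refine cnt_le_add (fun r hr => ?_) t
    by_cases hd : (v r).Dis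
    · exact Or.inr ⟨hHA r (by linarith [hr.1]), hd⟩
    · exact Or.inl ⟨hd, by linarith [hr.1], hr.2⟩
  have hmh : ∀ r, ¬ (v r).Dis → 1 / 64 ≤ X (q r) → Mid 8 (q r) (v r) ∨ 2 * 8 < X (q r) :=
    fun r hd hr => (le_or_gt (X (q r)) (2 * 8)).imp (fun h' => ⟨hd, hr, h'⟩) id
  have hU : cnt (fun r => ¬ (v r).Dis ∧ 1 ≤ X (q r)) t ≤ cnt (fun r => Mid 8 (q r) (v r)) t +
      cnt (fun r => 2 * 8 < X (q r)) t :=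
    cnt_le_add (fun r hr => hmh r hr.1 (by linarith [hr.2])) t
  have hF : cnt (fun r => HasActive (q r) ∧ ¬ (v r).Emp) t ≤
      cnt (fun r => Low (q r) (v r) ∧ ¬ (v r).Emp) t +
      (cnt (fun r => HasActive (q r) ∧ (v r).Dis) t + (cnt (fun r => Mid 8 (q r) (v r)) t +
        cnt (fun r => 2 * 8 < X (q r)) t)) := by
    refine (cnt_le_add (p₁ := fun r => Low (q r) (v r) ∧ ¬ (v r).Emp)
      (p₂ := fun r => (HasActive (q r) ∧ (v r).Dis) ∨
      (¬ (v r).Dis ∧ 1 / 64 ≤ X (q r))) (fun r hr => ?_) t).trans ?_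
    · by_cases hd : (v r).Dis
      · exact Or.inr (Or.inl ⟨hr.1, hd⟩)
      · rcases lt_or_ge (X (q r)) (1 / 64) with hx | hx
        · exact Or.inl ⟨⟨hd, hr.1, hx⟩, hr.2⟩
        · exact Or.inr (Or.inr ⟨hd, hx⟩)
    · refine add_le_add_right ((cnt_le_add (fun r hr => hr) t).trans ?_) _
      exact add_le_add_right (cnt_le_add (fun r hr => hmh r hr.1 hr.2) t) _
  have hE : cnt (fun r => (v r).Emp ∧ 1 ≤ X (q r)) t ≤
      cnt (fun r => HasActive (q r) ∧ (v r).Dis) t +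
      cnt (fun r => ¬ (v r).Dis ∧ 1 ≤ X (q r)) t := by
    refine cnt_le_add (fun r hr => ?_) t
    by_cases hd : (v r).Dis
    · exact Or.inl ⟨hHA r (by linarith [hr.2]), hd⟩
    · exact Or.inr ⟨hd, hr.2⟩
  have hL : cnt (fun r => Live (q r) (v r)) t ≤ cnt (fun r => Live (q r) (v r) ∧ (v r).Dis) t +
      (cnt (fun r => Live (q r) (v r) ∧ ¬ (v r).Dis ∧ ¬ HasActive (q r)) t +
      cnt (fun r => HasActive (q r)) t) := by
    refine (cnt_le_add (p₂ := fun r => (Live (q r) (v r) ∧ ¬ (v r).Dis ∧ ¬ HasActive (q r)) ∨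
      HasActive (q r)) (fun r hr => ?_) t).trans (add_le_add_right (cnt_le_add (fun r hr => hr) t) _)
    by_cases hd : (v r).Dis
    · exact Or.inl ⟨hr, hd⟩
    · by_cases ha : HasActive (q r)
      · exact Or.inr (Or.inr ha)
      · exact Or.inr (Or.inl ⟨hr, hd, ha⟩)
  have hLow : cnt (fun r => Low (q r) (v r)) t ≤ cnt (fun r => HasActive (q r)) t :=
    cnt_le_cnt (fun r hr => hr.2.1) t
  have hS0 := cnt_nonneg (fun r => (v r).Suc) t
  have hD0 := cnt_nonneg (fun r => Live (q r) (v r) ∧ (v r).Dis) t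
  have hmp := midProb_pos 8
  have hMid : cnt (fun r => Mid 8 (q r) (v r)) t ≤
      2 / midProb 8 * (cnt (fun r => (v r).Suc) t + |B2|) := by
    rw [div_mul_eq_mul_div, le_div_iff₀ hmp]
    have : cnt (fun r => (v r).Suc) t = cum (fun r => ind (v r).Suc) t := rfl
    have : cnt (fun r => Mid 8 (q r) (v r)) t = cum (fun r => ind (Mid 8 (q r) (v r))) t := rfl
    have := le_abs_self B2
    nlinarith
  have hg1 : cnt (fun r => Low (q r) (v r) ∧ ¬ (v r).Emp) t ≤
      1 / 32 * cnt (fun r => Low (q r) (v r)) t + |B1| := by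
    have := le_abs_self B1
    unfold cnt
    linarith
  have hB3 := le_abs_self B3
  have hB3' := abs_nonneg B3
  have hMid0 := cnt_nonneg (fun r => Mid 8 (q r) (v r)) t
  -- Low-contention slots enter with factor 16 · (1/32) = 1/2, so half of the active slots is
  -- absorbed on the left.
  have hHA0 : cnt (fun r => HasActive (q r)) t ≤ 34 * (cnt (fun r => Live (q r) (v r) ∧ (v r).Dis) t +
      cnt (fun r => Mid 8 (q r) (v r)) t + cnt (fun r => 2 * 8 < X (q r)) t) + 32 * |B1| := by
    linarith
  -- Resets cost at most 1/3 of the slots with X ≥ 8; the share of those with X > 16 is absorbed on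
  -- the left.
  have hHi : cnt (fun r => 2 * 8 < X (q r)) t ≤ 2 * (cnt (fun r => Mid 8 (q r) (v r)) t +
      cnt (fun r => Live (q r) (v r) ∧ (v r).Dis) t) + 2 * cnt (fun r => (v r).Suc) t + 2 * |B3| := by
    linarith
  have hK : 0 ≤ 2 / midProb 8 := by positivity
  have hSL : cnt (fun r => Live (q r) (v r)) t ≤ 150 * (cnt (fun r => (v r).Suc) t +
      cnt (fun r => Live (q r) (v r) ∧ (v r).Dis) t + cnt (fun r => Mid 8 (q r) (v r)) t)
      + 100 * (|B1| + |B3| + 1) := by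
    have := abs_nonneg B1
    have := abs_nonneg B3
    linarith
  unfold slotConst
  set κ := 2 / midProb 8
  have e1 : 0 ≤ κ * cnt (fun r => (v r).Suc) t := mul_nonneg hK hS0
  have e2 : 0 ≤ κ * cnt (fun r => Live (q r) (v r) ∧ (v r).Dis) t := mul_nonneg hK hD0
  have e3 : 0 ≤ κ * |B2| := mul_nonneg hK (abs_nonneg _)
  have := abs_nonneg B1
  have := abs_nonneg B3
  nlinarith

end Deterministic

/-! ### Broadcast probabilities summed over ages -/

section Weights

lemma sendProb_le {c : ℝ} (hc : 1 ≤ c) (ch : Channel) {a : ℕ} (ha : 1 ≤ a) :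
    sendProb c ch a ≤ c * (1 + Real.log a) / a := by
  have ha' : (1 : ℝ) ≤ a := by exact_mod_cast ha
  have hl := Real.log_nonneg ha'
  cases ch with
  | data =>
    simp only [sendProb]
    gcongr
    nlinarith
  | control =>
    simp only [sendProb]
    refine (min_le_right _ _).trans ?_
    gcongr
    exact max_le (by linarith) (by linarith)

@[simp] lemma sendProb_zero (c : ℝ) (ch : Channel) : sendProb c ch 0 = 0 := by
  cases ch <;> simp [sendProb]

/-- The expected number of broadcasts at ages up to `A`. -/
lemma sum_sendProb_le {c : ℝ} (hc : 1 ≤ c) (ch : Channel) {A : ℕ} (hA : 1 ≤ A) (n : ℕ) :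
    ∑ a ∈ Finset.range n, sendProb c ch a * ind (a ≤ A) ≤ c * (1 + Real.log A) ^ 2 := by
  have hc0 : 0 ≤ c := by linarith
  have hA' : (1 : ℝ) ≤ A := by exact_mod_cast hA
  have hl := Real.log_nonneg hA'
  have h1 : ∑ a ∈ Finset.range n, sendProb c ch a * ind (a ≤ A) ≤
      ∑ a ∈ Finset.Icc 1 A, sendProb c ch a := by
    have hterm : ∀ a, 0 ≤ sendProb c ch a * ind (a ≤ A) := fun a =>
      mul_nonneg (sendProb_nonneg hc0 ch a) (ind_nonneg _)
    calc ∑ a ∈ Finset.range n, sendProb c ch a * ind (a ≤ A)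
        = ∑ a ∈ (Finset.range n).filter (· ∈ Finset.Icc 1 A), sendProb c ch a * ind (a ≤ A) := by
          refine (Finset.sum_filter_of_ne fun a _ ha => ?_).symm
          rw [Finset.mem_Icc]
          constructor
          · by_contra h0
            exact ha (by simp [show a = 0 by omega])
          · by_contra h0
            exact ha (by rw [ind_neg h0, mul_zero])
      _ ≤ ∑ a ∈ Finset.Icc 1 A, sendProb c ch a * ind (a ≤ A) :=
          Finset.sum_le_sum_of_subset_of_nonneg (fun a ha => (Finset.mem_filter.mp ha).2)
            fun a _ _ => hterm a
      _ ≤ _ := Finset.sum_le_sum fun a _ =>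
          mul_le_of_le_one_right (sendProb_nonneg hc0 ch a) (ind_le_one _)
  have h2 : ∑ a ∈ Finset.Icc 1 A, sendProb c ch a ≤
      ∑ a ∈ Finset.Icc 1 A, c * (1 + Real.log A) * (a : ℝ)⁻¹ := by
    refine Finset.sum_le_sum fun a ha => ?_
    rw [Finset.mem_Icc] at ha
    refine (sendProb_le hc ch ha.1).trans ?_
    rw [← div_eq_mul_inv]
    have ha0 : (0 : ℝ) < a := by exact_mod_cast ha.1
    have : Real.log a ≤ Real.log A := Real.log_le_log ha0 (by exact_mod_cast ha.2)
    gcongr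
  rw [← Finset.mul_sum] at h2
  have h3 : ∑ a ∈ Finset.Icc 1 A, (a : ℝ)⁻¹ ≤ 1 + Real.log A := by
    have := harmonic_le_one_add_log A
    rw [harmonic_eq_sum_Icc] at this
    push_cast at this
    exact this
  have h4 : 0 ≤ c * (1 + Real.log A) := by positivity
  calc _ ≤ _ := h1
    _ ≤ _ := h2
    _ ≤ c * (1 + Real.log A) * (1 + Real.log A) := mul_le_mul_of_nonneg_left h3 h4
    _ = _ := by ring

/-- From ln a ≤ 2(√a − 1) the probability is at most 2c/√a, and √a ≥ m². -/
lemma sendProb_le_of_old {c : ℝ} (hc : 1 ≤ c) (ch : Channel) {a m : ℕ} (hm : 1 ≤ m)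
    (ha : m ^ 4 < a) : sendProb c ch a ≤ 2 * c / (m : ℝ) ^ 2 := by
  have hm' : (1 : ℝ) ≤ m := by exact_mod_cast hm
  have ha1 : 1 ≤ a := by omega
  have ha' : (1 : ℝ) ≤ a := by exact_mod_cast ha1
  have ha4 : (m : ℝ) ^ 4 ≤ a := by exact_mod_cast ha.le
  have hs0 : 0 < √(a : ℝ) := Real.sqrt_pos.mpr (by linarith)
  have hs2 : √(a : ℝ) ^ 2 = a := Real.sq_sqrt (by linarith)
  have hms : (m : ℝ) ^ 2 ≤ √(a : ℝ) := by
    refine Real.le_sqrt_of_sq_le ?_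
    calc ((m : ℝ) ^ 2) ^ 2 = (m : ℝ) ^ 4 := by ring
      _ ≤ (a : ℝ) := ha4
  have hlog : Real.log a ≤ 2 * (√(a : ℝ) - 1) := by
    have : Real.log a = 2 * Real.log (√(a : ℝ)) := by
      rw [Real.log_sqrt (by linarith)]; ring
    rw [this]
    have := Real.log_le_sub_one_of_pos hs0
    linarith
  refine (sendProb_le hc ch ha1).trans ?_
  rw [div_le_div_iff₀ (by linarith) (by positivity)]
  have hc0 : 0 ≤ c := by linarith
  calc c * (1 + Real.log a) * (m : ℝ) ^ 2 ≤ c * (2 * √(a : ℝ)) * √(a : ℝ) := by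
        gcongr; linarith
    _ = 2 * c * √(a : ℝ) ^ 2 := by ring
    _ = 2 * c * a := by rw [hs2]

/-- 1 + N + D ≤ 3·max(1,N)·max(1,D), and the convention log 0 = 0 agrees with log max(1,0). Using
log 3 ≤ 2, the left side is at most (9 + 4a + 4b)² ≤ 3(81 + 16a² + 16b²). -/
lemma one_add_log_sq_le (N D : ℕ) : (1 + Real.log (((1 + N + D) ^ 4 : ℕ) : ℝ)) ^ 2 ≤
    243 * (1 + Real.log N ^ 2 + Real.log D ^ 2) := by
  have hlog : ∀ n : ℕ, Real.log (max 1 n : ℕ) = Real.log n := by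
    intro n
    rcases Nat.eq_zero_or_pos n with rfl | hn
    · simp
    · rw [max_eq_right hn]
  have hle : 1 + N + D ≤ 3 * (max 1 N * max 1 D) := by
    have h1 : 1 ≤ max 1 N := le_max_left _ _
    have h2 : 1 ≤ max 1 D := le_max_left _ _
    have h3 : N ≤ max 1 N := le_max_right _ _
    have h4 : D ≤ max 1 D := le_max_right _ _
    nlinarith
  have hN : (0 : ℝ) < (max 1 N : ℕ) := by exact_mod_cast (lt_max_of_lt_left Nat.one_pos)
  have hD : (0 : ℝ) < (max 1 D : ℕ) := by exact_mod_cast (lt_max_of_lt_left Nat.one_pos)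
  have h1 : Real.log ((1 + N + D : ℕ) : ℝ) ≤ 2 + Real.log N + Real.log D := by
    have : ((1 + N + D : ℕ) : ℝ) ≤ 3 * ((max 1 N : ℕ) * (max 1 D : ℕ)) := by exact_mod_cast hle
    calc _ ≤ Real.log (3 * ((max 1 N : ℕ) * (max 1 D : ℕ))) :=
          Real.log_le_log (by positivity) this
      _ = Real.log 3 + (Real.log N + Real.log D) := by
          rw [Real.log_mul (by norm_num) (by positivity), Real.log_mul hN.ne' hD.ne', hlog, hlog]
      _ ≤ _ := by
          have := Real.log_le_sub_one_of_pos (show (0 : ℝ) < 3 by norm_num)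
          linarith
  have h0 : 0 ≤ Real.log ((1 + N + D : ℕ) : ℝ) := Real.log_natCast_nonneg _
  rw [Nat.cast_pow, Real.log_pow]
  set a := Real.log (N : ℝ)
  set b := Real.log (D : ℝ)
  set l := Real.log ((1 + N + D : ℕ) : ℝ)
  have h2 : (1 + ((4 : ℕ) : ℝ) * l) ^ 2 ≤ (9 + 4 * a + 4 * b) ^ 2 := by
    push_cast
    exact pow_le_pow_left₀ (by positivity) (by linarith) 2
  nlinarith [sq_nonneg (9 - 4 * a), sq_nonneg (9 - 4 * b), sq_nonneg (a - b), sq_nonneg a, sq_nonneg b]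

end Weights

/-! ### Total broadcasts and waste -/

section Deterministic

variable {c : ℝ} {q : ℕ → State} {v : ℕ → View}

open Classical in
/-- The live packets of a slot. -/
def liveSet (q : State) (v : View) : Finset ℕ :=
  (Finset.range (q.injected + v.arr)).filter fun i => q.packet i ≠ Packet.done

lemma liveSet_nonempty {q : State} {v : View} : (liveSet q v).Nonempty ↔ Live q v := by
  simp [liveSet, Live, Finset.Nonempty]

lemma wsum_le_mul_card {q : State} (v : View) {w : ℕ → ℝ} {δ : ℝ} (hδ : 0 ≤ δ) (hw : ∀ a, w a ≤ δ) :
    wsum q w ≤ δ * (liveSet q v).card := by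
  classical
  have h1 : wsum q w ≤ ∑ i ∈ Finset.range q.injected, δ * ind (q.packet i ≠ Packet.done) := by
    unfold wsum psum
    refine Finset.sum_le_sum fun i _ => ?_
    cases hp : q.packet i with
    | done => rw [ind_neg (by simp)]; simp [Packet.wt]
    | inactive => rw [ind_pos (by simp)]; simpa [Packet.wt] using hδ
    | active s e => rw [ind_pos (by simp)]; simpa [Packet.wt] using hw s
  have h2 : ∑ i ∈ Finset.range q.injected, δ * ind (q.packet i ≠ Packet.done) ≤
      ∑ i ∈ Finset.range (q.injected + v.arr), δ * ind (q.packet i ≠ Packet.done) :=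
    Finset.sum_le_sum_of_subset_of_nonneg (Finset.range_subset_range.mpr (by omega))
      fun i _ _ => mul_nonneg hδ (ind_nonneg _)
  have h3 : ∑ i ∈ Finset.range (q.injected + v.arr), δ * ind (q.packet i ≠ Packet.done) =
      δ * (liveSet q v).card := by
    rw [← Finset.mul_sum, liveSet, Finset.natCast_card_filter]
    congr 1
    refine Finset.sum_congr rfl fun i _ => ?_
    unfold ind
    congr
  linarith

lemma wsum_old_le {q : State} (v : View) {w : ℕ → ℝ} {δ : ℝ} (hδ : 0 ≤ δ) (hw : ∀ a, w a ≤ δ)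
    {N : ℕ} (hN : (liveSet q v).card ≤ N) : wsum q w ≤ δ * N * ind (Live q v) := by
  have h := wsum_le_mul_card (q := q) v hδ hw
  by_cases hL : Live q v
  · rw [ind_pos hL, mul_one]
    exact h.trans (mul_le_mul_of_nonneg_left (by exact_mod_cast hN) hδ)
  · have : liveSet q v = ∅ := by
      rw [← Finset.not_nonempty_iff_eq_empty, liveSet_nonempty]; exact hL
    rw [this] at h
    rw [ind_neg hL, mul_zero]
    simpa using h

/-- The sum of the broadcasting probabilities. -/
lemma cum_psum_pr_le (h : IsPath q v) (hT : Typical c q v) (hc : 1 ≤ c) (ch : Channel) :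
    ∃ B, 0 ≤ B ∧ ∀ t, ((clock v t).1 = 1 ∨ X (q t) < 8) → ∀ N D : ℕ,
      (∀ r < t, (liveSet (q r) (v r)).card ≤ N) →
      cnt (fun r => Live (q r) (v r) ∧ (v r).Dis) t ≤ D →
      cum (fun r => psum (q r) (Packet.pr c ch)) t ≤
        c * (1201 + 2 * slotConst) * (1 + Real.log (((1 + N + D) ^ 4 : ℕ) : ℝ)) ^ 2 * (inj q t + B) := by
  obtain ⟨B1, h1⟩ := inact_le_inj h hT
  obtain ⟨B2, h2⟩ := slots_le h hT
  refine ⟨|B1| + |B2| + 1, by positivity, fun t ht N D hN hD => ?_⟩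
  have hc0 : 0 ≤ c := by linarith
  have hK := slotConst_ge
  -- Ages are split at m⁴: young ages are summed over periods, old ones over live slots, where the
  -- probability is at most 2c/m².
  set m := 1 + N + D with hm
  have hm1 : 1 ≤ m := by omega
  have hA : 1 ≤ m ^ 4 := Nat.one_le_pow _ _ hm1
  have hyoung := cum_wsum_le h (w := fun a => sendProb c ch a * ind (a ≤ m ^ 4))
    (fun a => mul_nonneg (sendProb_nonneg hc0 ch a) (ind_nonneg _)) (sum_sendProb_le hc ch hA) t
  set δ := 2 * c / (m : ℝ) ^ 2 with hδ
  have hδ0 : 0 ≤ δ := by positivity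
  have hold : cum (fun r => wsum (q r) fun a => sendProb c ch a * ind (¬ a ≤ m ^ 4)) t ≤
      cum (fun r => δ * N * ind (Live (q r) (v r))) t := by
    unfold cum
    refine Finset.sum_le_sum fun r hr => wsum_old_le (v r) hδ0 (fun a => ?_)
      (hN r (Finset.mem_range.mp hr))
    by_cases ha : a ≤ m ^ 4
    · rw [ind_neg (by simpa using ha), mul_zero]; exact hδ0
    · rw [ind_pos ha, mul_one]
      exact sendProb_le_of_old hc ch hm1 (by omega)
  have hsplit : cum (fun r => psum (q r) (Packet.pr c ch)) t =
      cum (fun r => wsum (q r) fun a => sendProb c ch a * ind (a ≤ m ^ 4)) t +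
      cum (fun r => wsum (q r) fun a => sendProb c ch a * ind (¬ a ≤ m ^ 4)) t := by
    rw [← cum_add]
    congr 1
    ext r
    unfold wsum psum
    rw [← Finset.sum_add_distrib]
    refine Finset.sum_congr rfl fun i _ => ?_
    cases (q r).packet i with
    | active s e =>
      simp only [Packet.pr, Packet.wt]
      by_cases hs : s ≤ m ^ 4
      · rw [ind_pos hs, ind_neg (by simpa using hs)]; ring
      · rw [ind_neg hs, ind_pos hs]; ring
    | _ => simp [Packet.pr, Packet.wt]
  rw [cum_mul] at hold
  have hslots := h2 t ht
  change _ ≤ δ * N * cnt (fun r => Live (q r) (v r)) t at hold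
  have hsuc : cnt (fun r => (v r).Suc) t ≤ inj q t := by
    have := succ_count_le h t
    have := ind_nonneg (v t).Suc
    linarith
  have hin := h1 t
  have hP : (0 : ℝ) ≤ inj q t := by positivity
  set P : ℝ := (inj q t : ℝ)
  set l := Real.log ((m ^ 4 : ℕ) : ℝ)
  have hl : 0 ≤ l := Real.log_natCast_nonneg _
  have hmR : (m : ℝ) = 1 + N + D := by rw [hm]; push_cast; ring
  have hN0 : (0 : ℝ) ≤ N := by positivity
  have hD0 : (0 : ℝ) ≤ D := by positivity
  have hδN : δ * N ≤ 2 * c := by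
    rw [hδ, div_mul_eq_mul_div, div_le_iff₀ (by positivity), hmR]
    have : (N : ℝ) ≤ (1 + N + D) ^ 2 := by nlinarith
    exact mul_le_mul_of_nonneg_left this (by linarith)
  have hδND : δ * N * D ≤ 2 * c := by
    rw [hδ, div_mul_eq_mul_div, div_mul_eq_mul_div, div_le_iff₀ (by positivity), hmR, mul_assoc]
    have : (N : ℝ) * D ≤ (1 + N + D) ^ 2 := by nlinarith
    exact mul_le_mul_of_nonneg_left this (by linarith)
  have hδN0 : 0 ≤ δ * N := by positivity
  have hB1 := le_abs_self B1
  have hB2 := le_abs_self B2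
  have hB1' := abs_nonneg B1
  have hB2' := abs_nonneg B2
  -- Both N and ND are at most m², so the slots due to disruptions contribute only a constant and no
  -- factor D survives.
  have hold' : δ * N * cnt (fun r => Live (q r) (v r)) t ≤ 2 * c * (slotConst * (P + 1) + |B2|) := by
    have e1 : cnt (fun r => Live (q r) (v r)) t ≤ slotConst * (P + D) + |B2| := by nlinarith
    calc _ ≤ δ * N * (slotConst * (P + D) + |B2|) := mul_le_mul_of_nonneg_left e1 hδN0
      _ = slotConst * P * (δ * N) + slotConst * (δ * N * D) + |B2| * (δ * N) := by ring
      _ ≤ slotConst * P * (2 * c) + slotConst * (2 * c) + |B2| * (2 * c) := by gcongr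
      _ = _ := by ring
  have hyoung' : c * (1 + l) ^ 2 * (P + inact q v t) ≤ c * (1 + l) ^ 2 * (1201 * P + |B1|) :=
    mul_le_mul_of_nonneg_left (by linarith) (by positivity)
  rw [hsplit]
  have hl1 : 1 ≤ (1 + l) ^ 2 := by nlinarith
  calc _ ≤ c * (1 + l) ^ 2 * (1201 * P + |B1|) + 2 * c * (slotConst * (P + 1) + |B2|) * 1 := by
        linarith
    _ ≤ c * (1 + l) ^ 2 * (1201 * P + |B1|) +
        2 * c * (slotConst * (P + 1) + |B2|) * (1 + l) ^ 2 := by gcongr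
    _ = c * (1 + l) ^ 2 * (1201 * P + |B1| + 2 * slotConst * (P + 1) + 2 * |B2|) := by ring
    _ ≤ c * (1 + l) ^ 2 * ((1201 + 2 * slotConst) * (P + (|B1| + |B2| + 1))) := by
        gcongr
        nlinarith
    _ = _ := by ring

/-- The constant in the bound on the number of access attempts. -/
def attemptConst (c : ℝ) : ℝ := 4 * c * (1201 + 2 * slotConst) + 1

lemma attemptConst_pos {c : ℝ} (hc : 1 ≤ c) : 0 < attemptConst c := by
  have := slotConst_ge
  unfold attemptConst
  positivity

lemma attempts_le (h : IsPath q v) (hT : Typical c q v) (hc : 1 ≤ c) :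
    ∃ B, 0 ≤ B ∧ ∀ t, ((clock v t).1 = 1 ∨ X (q t) < 8) → ∀ N D : ℕ,
      (∀ r < t, (liveSet (q r) (v r)).card ≤ N) →
      cnt (fun r => Live (q r) (v r) ∧ (v r).Dis) t ≤ D →
      cum (fun r => ((v r).sd.card : ℝ) + (v r).sc.card) t ≤
        attemptConst c * (1 + Real.log (((1 + N + D) ^ 4 : ℕ) : ℝ)) ^ 2 * (inj q t + B) := by
  obtain ⟨B1, hB1, h1⟩ := cum_psum_pr_le h hT hc .data
  obtain ⟨B2, hB2, h2⟩ := cum_psum_pr_le h hT hc .control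
  obtain ⟨B3, h3⟩ := hT.attempts .data
  obtain ⟨B4, h4⟩ := hT.attempts .control
  refine ⟨B1 + B2 + |B3| + |B4|, by positivity, fun t ht N D hN hD => ?_⟩
  have g1 := h1 t ht N D hN hD
  have g2 := h2 t ht N D hN hD
  have g3 := h3 t
  have g4 := h4 t
  rw [cum_sub, cum_mul] at g3 g4
  simp only [snd] at g3 g4
  rw [cum_add]
  set l := Real.log (((1 + N + D) ^ 4 : ℕ) : ℝ)
  have hl : 0 ≤ l := Real.log_natCast_nonneg _
  have hl1 : 1 ≤ (1 + l) ^ 2 := by nlinarith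
  have hP : (0 : ℝ) ≤ inj q t := by positivity
  have hK := slotConst_ge
  set P : ℝ := (inj q t : ℝ)
  set κ := c * (1201 + 2 * slotConst) with hκ
  have hκ0 : 0 ≤ κ := by positivity
  have e0 : attemptConst c = 4 * κ + 1 := by rw [attemptConst, hκ]; ring
  have a3 := le_abs_self B3
  have a4 := le_abs_self B4
  have b3 := abs_nonneg B3
  have b4 := abs_nonneg B4
  have e1 : κ * (1 + l) ^ 2 * (P + B1) ≤ κ * (1 + l) ^ 2 * (P + (B1 + B2 + |B3| + |B4|)) := by
    gcongr; linarith
  have e2 : κ * (1 + l) ^ 2 * (P + B2) ≤ κ * (1 + l) ^ 2 * (P + (B1 + B2 + |B3| + |B4|)) := by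
    gcongr; linarith
  have e3 : P + (B1 + B2 + |B3| + |B4|) ≤ (1 + l) ^ 2 * (P + (B1 + B2 + |B3| + |B4|)) :=
    le_mul_of_one_le_left (by positivity) hl1
  rw [e0]
  have e4 : (4 * κ + 1) * (1 + l) ^ 2 * (P + (B1 + B2 + |B3| + |B4|)) =
    4 * (κ * (1 + l) ^ 2 * (P + (B1 + B2 + |B3| + |B4|))) +
      (1 + l) ^ 2 * (P + (B1 + B2 + |B3| + |B4|)) := by ring
  rw [e4]
  linarith

/-- A packet is live in the slot of its injection, so without live slots nothing is injected any
more. -/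
lemma exists_live (h : IsPath q v) (hinj : ∀ k, ∃ t, k ≤ inj q t) (t₀ : ℕ) :
    ∃ t, t₀ ≤ t ∧ Live (q t) (v t) := by
  by_contra hcon
  push Not at hcon
  have hconst : ∀ j, inj q (t₀ + j) = inj q t₀ := by
    intro j
    induction j with
    | zero => rfl
    | succ j ih =>
      have harr : (v (t₀ + j)).arr = 0 := by
        by_contra h0
        refine hcon (t₀ + j) (by omega) ⟨(q (t₀ + j)).injected, by omega, ?_⟩
        rw [(h.inv _).inactive _ le_rfl]; simp
      rw [← ih, ← add_assoc]
      unfold inj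
      rw [h.succ]
      simp [step, harr]
  obtain ⟨t, ht⟩ := hinj (inj q t₀ + 1)
  rcases le_total t t₀ with hle | hle
  · have := inj_mono h hle; omega
  · obtain ⟨j, rfl⟩ := Nat.exists_eq_add_of_le hle
    have := hconst j; omega

lemma exists_cnt_live_ge (h : IsPath q v) (hinj : ∀ k, ∃ t, k ≤ inj q t) (B : ℝ) :
    ∃ t₀, ∀ t, t₀ ≤ t → B ≤ cnt (fun r => Live (q r) (v r)) t := by
  have hn : ∀ n : ℕ, ∃ t, (n : ℝ) ≤ cnt (fun r => Live (q r) (v r)) t := by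
    intro n
    induction n with
    | zero => exact ⟨0, by simp [cnt]⟩
    | succ n ih =>
      obtain ⟨t₀, h0⟩ := ih
      obtain ⟨t, ht, hL⟩ := exists_live h hinj t₀
      refine ⟨t + 1, ?_⟩
      rw [cnt_succ, ind_pos hL]
      have := cnt_mono (fun r => Live (q r) (v r)) ht
      push_cast
      linarith
  obtain ⟨n, hB⟩ := exists_nat_ge B
  obtain ⟨t₀, h0⟩ := hn n
  exact ⟨t₀, fun t ht => hB.trans (h0.trans (cnt_mono _ ht))⟩

lemma suc_live (h : IsPath q v) {r : ℕ} (hs : (v r).Suc) : Live (q r) (v r) := by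
  obtain ⟨i, _, hi⟩ := hs
  have := (h.compat r).sd i (by rw [hi]; simp)
  exact HasActive.live (h.inv r) ⟨i, this⟩ _

/-- A bound on the fraction of wasted slots. -/
def wasteBound : ℝ := 1 - 1 / (4 * slotConst)

/-- Successful slots and disrupted live slots each number at most L − W. They are bounded separately
because a success under a disrupted control channel is both. With B ≤ L/2 this gives L ≤ 4K(L − W),
where K is `slotConst`. -/
lemma wasted_le (h : IsPath q v) {t : ℕ} {B : ℝ}
    (hs : cnt (fun r => Live (q r) (v r)) t ≤
      slotConst * (cnt (fun r => (v r).Suc) t + cnt (fun r => Live (q r) (v r) ∧ (v r).Dis) t) + B)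
    (hB : 2 * B ≤ cnt (fun r => Live (q r) (v r)) t) :
    cnt (fun r => Live (q r) (v r) ∧ ¬ (v r).Dis ∧ ¬ (v r).Suc) t ≤
      wasteBound * cnt (fun r => Live (q r) (v r)) t := by
  have h1 : cnt (fun r => Live (q r) (v r) ∧ ¬ (v r).Dis ∧ ¬ (v r).Suc) t +
      cnt (fun r => (v r).Suc) t ≤ cnt (fun r => Live (q r) (v r)) t := by
    unfold cnt
    rw [← cum_add]
    refine cum_le_cum (fun r => ?_) t
    by_cases hs : (v r).Suc
    · rw [ind_pos hs, ind_pos (suc_live h hs), ind_neg (fun hh => hh.2.2 hs)]; simp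
    · rw [ind_neg hs, add_zero]; exact ind_mono fun hh => hh.1
  have h2 : cnt (fun r => Live (q r) (v r) ∧ ¬ (v r).Dis ∧ ¬ (v r).Suc) t +
      cnt (fun r => Live (q r) (v r) ∧ (v r).Dis) t ≤ cnt (fun r => Live (q r) (v r)) t := by
    unfold cnt
    rw [← cum_add]
    refine cum_le_cum (fun r => ?_) t
    by_cases hd : Live (q r) (v r) ∧ (v r).Dis
    · rw [ind_pos hd, ind_pos hd.1, ind_neg (fun hh => hh.2.1 hd.2)]; simp
    · rw [ind_neg hd, add_zero]; exact ind_mono fun hh => hh.1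
  have hK : (0 : ℝ) < slotConst := by linarith [slotConst_ge]
  set L := cnt (fun r => Live (q r) (v r)) t
  set W := cnt (fun r => Live (q r) (v r) ∧ ¬ (v r).Dis ∧ ¬ (v r).Suc) t
  have h3 : L ≤ (L - W) * (4 * slotConst) := by nlinarith
  have h4 : L / (4 * slotConst) ≤ L - W := by
    rw [div_le_iff₀ (by positivity)]; exact h3
  have h5 : wasteBound * L = L - L / (4 * slotConst) := by unfold wasteBound; ring
  linarith

end Deterministic

/-! ### Existence of good times -/

section Path

variable {c : ℝ} {x : ℕ → SlotInput}

/-- The views of the slots of an execution. -/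
def viewAt (c : ℝ) (x : ℕ → SlotInput) (t : ℕ) : View := viewOf c (x t) (run c x t)

lemma livePackets_eq (t : ℕ) : livePackets (x t) (run c x t) = liveSet (run c x t) (viewAt c x t) := rfl

lemma slotLive_iff (t : ℕ) : SlotLive (x t) (run c x t) ↔ Live (run c x t) (viewAt c x t) := by
  rw [SlotLive, livePackets_eq, liveSet_nonempty]

lemma slotsBefore_cast (t : ℕ) : (slotsBefore c x t : ℝ) =
    cnt (fun r => Live (run c x r) (viewAt c x r)) t := by
  classical
  rw [cnt_eq_card, slotsBefore]
  congr 2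
  ext r
  simp only [Finset.mem_filter, slotLive_iff]

lemma disruptedBefore_cast (t : ℕ) : (disruptedBefore c x t : ℝ) =
    cnt (fun r => Live (run c x r) (viewAt c x r) ∧ (viewAt c x r).Dis) t := by
  classical
  rw [cnt_eq_card, disruptedBefore]
  congr 2
  ext r
  simp only [Finset.mem_filter, slotLive_iff]
  rfl

lemma wastedBefore_cast (t : ℕ) : (wastedBefore c x t : ℝ) =
    cnt (fun r => Live (run c x r) (viewAt c x r) ∧ ¬ (viewAt c x r).Dis ∧ ¬ (viewAt c x r).Suc) t := by
  classical
  rw [cnt_eq_card, wastedBefore]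
  congr 2
  ext r
  simp only [Finset.mem_filter, slotLive_iff]
  rfl

lemma attemptsBefore_cast (t : ℕ) : (attemptsBefore c x t : ℝ) =
    cum (fun r => ((viewAt c x r).sd.card : ℝ) + (viewAt c x r).sc.card) t := by
  unfold attemptsBefore cum
  push_cast
  rfl

/-- The requirements on the random time. -/
structure GoodTime (c : ℝ) (x : ℕ → SlotInput) (s t : ℕ) : Prop where
  slots : s < slotsBefore c x t
  waste : waste c x t ≤ wasteBound
  attempts : averageAttempts c x t ≤ 486 * attemptConst c *
    (1 + Real.log (maxConcurrent c x t) ^ 2 + Real.log (disruptedBefore c x t) ^ 2)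

/-- The additive constants are fixed by the outcome before the time is chosen. Once at least B2
packets are injected, P + B2 ≤ 2P, which turns 243 into 486; enough live slots absorb B1. A settled
time is then taken beyond both thresholds. -/
lemma exists_goodTime (hc : 1 ≤ c) (hT : Typical c (run c x) (viewAt c x))
    (hinj : ∀ k : ℕ, ∃ t : ℕ, k ≤ packetsBefore c x t) (s : ℕ) : ∃ t, GoodTime c x s t := by
  have h : IsPath (run c x) (viewAt c x) := isPath_run c x
  obtain ⟨B1, h1⟩ := slots_le h hT
  obtain ⟨B2, hB0, h2⟩ := attempts_le h hT hc
  obtain ⟨n, hn⟩ := exists_nat_ge (max B2 1)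
  obtain ⟨t₁, ht₁⟩ := hinj n
  obtain ⟨t₂, ht₂⟩ := exists_cnt_live_ge h hinj (max (2 * B1) (s + 1))
  obtain ⟨t, ht, hset⟩ := exists_settled h (b := 8) (by norm_num) (max t₁ t₂)
  have hL := ht₂ t ((le_max_right _ _).trans ht)
  have hP : (n : ℝ) ≤ inj (run c x) t := by
    exact_mod_cast ht₁.trans (inj_mono h ((le_max_left _ _).trans ht))
  have hB2 : B2 ≤ inj (run c x) t := (le_max_left _ _).trans (hn.trans hP)
  have hP1 : (1 : ℝ) ≤ inj (run c x) t := (le_max_right _ _).trans (hn.trans hP)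
  have hs1 : (s : ℝ) + 1 ≤ slotsBefore c x t := by
    rw [slotsBefore_cast]; exact (le_max_right _ _).trans hL
  refine ⟨t, ?_, ?_, ?_⟩
  · exact_mod_cast hs1
  · have hw := wasted_le h (h1 t hset) ((le_max_left _ _).trans hL)
    rw [← wastedBefore_cast, ← slotsBefore_cast] at hw
    have h0 : (0 : ℝ) < slotsBefore c x t := by
      have : (0 : ℝ) ≤ s := by positivity
      linarith
    rw [ReBackoff.waste, div_le_iff₀ h0]
    exact hw
  · have ha := h2 t hset (maxConcurrent c x t) (disruptedBefore c x t)
      (fun r hr => by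
        have := Finset.le_sup (f := fun r => (livePackets (x r) (run c x r)).card)
          (Finset.mem_range.mpr hr)
        exact this)
      (by rw [disruptedBefore_cast])
    rw [← attemptsBefore_cast] at ha
    have hlog := one_add_log_sq_le (maxConcurrent c x t) (disruptedBefore c x t)
    have hA := attemptConst_pos hc
    have hP0 : (0 : ℝ) < inj (run c x) t := by linarith
    rw [averageAttempts, div_le_iff₀ (show (0 : ℝ) < packetsBefore c x t from hP0)]
    change _ ≤ _ * (inj (run c x) t : ℝ)
    calc _ ≤ _ := ha
      _ ≤ attemptConst c * (243 * (1 + Real.log (maxConcurrent c x t) ^ 2 +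
          Real.log (disruptedBefore c x t) ^ 2)) * (2 * inj (run c x) t) := by
            gcongr
            linarith
      _ = _ := by ring

end Path

/-! ### Measurability of the set of good times -/

section Measurability

variable {Ω : Type*} [mΩ : MeasurableSpace Ω] {μ : Measure Ω}
  {ℱ : Filtration ℕ mΩ} {coin : ℕ → Channel → ℕ → Ω → ℝ}
variable (hfc : FairCoins μ ℱ coin) (c : ℝ) (adv : Adversary ℱ)

include hfc in
lemma measurable_slot {β : Type*} [MeasurableSpace β] (F : State → View → β) (t : ℕ) :
    Measurable fun ω => F (run c (adv.inputs coin ω) t) (viewAt c (adv.inputs coin ω) t) := by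
  have h := adapt_state_view hfc c adv t
  exact (((h.1.mono (ℱ.le t)).prodMk (h.2.mono (ℱ.le (t + 1)))).comp fun y => F y.1 y.2).measurable

include hfc in
lemma measurable_cnt (P : State → View → Prop) (t : ℕ) : Measurable fun ω => cnt (fun r =>
    P (run c (adv.inputs coin ω) r) (viewAt c (adv.inputs coin ω) r)) t := by
  unfold cnt cum
  exact Finset.measurable_sum _ fun r _ => measurable_slot hfc c adv (fun q v => ind (P q v)) r

include hfc in
lemma measurable_maxConcurrent (t : ℕ) : Measurable fun ω => maxConcurrent c (adv.inputs coin ω) t := by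
  induction t with
  | zero => exact measurable_const
  | succ t ih =>
    have h : (fun ω => maxConcurrent c (adv.inputs coin ω) (t + 1)) = fun ω =>
        (liveSet (run c (adv.inputs coin ω) t) (viewAt c (adv.inputs coin ω) t)).card ⊔
          maxConcurrent c (adv.inputs coin ω) t := by
      ext ω
      rw [maxConcurrent, Finset.range_add_one, Finset.sup_insert]
      rfl
    rw [h]
    exact (measurable_slot hfc c adv (fun q v => (liveSet q v).card) t).sup ih

include hfc in
lemma measurableSet_goodTime (s t : ℕ) : MeasurableSet {ω | GoodTime c (adv.inputs coin ω) s t} := by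
  have h1 : Measurable fun ω => (slotsBefore c (adv.inputs coin ω) t : ℝ) := by
    simp only [slotsBefore_cast]
    exact measurable_cnt hfc c adv Live t
  have h2 : Measurable fun ω => (wastedBefore c (adv.inputs coin ω) t : ℝ) := by
    simp only [wastedBefore_cast]
    exact measurable_cnt hfc c adv (fun q v => Live q v ∧ ¬ v.Dis ∧ ¬ v.Suc) t
  have h3 : Measurable fun ω => (disruptedBefore c (adv.inputs coin ω) t : ℝ) := by
    simp only [disruptedBefore_cast]
    exact measurable_cnt hfc c adv (fun q v => Live q v ∧ v.Dis) t
  have h4 : Measurable fun ω => (attemptsBefore c (adv.inputs coin ω) t : ℝ) := by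
    simp only [attemptsBefore_cast]
    unfold cum
    exact Finset.measurable_sum _ fun r _ =>
      measurable_slot hfc c adv (fun _ v => (v.sd.card : ℝ) + v.sc.card) r
  have h5 : Measurable fun ω => (packetsBefore c (adv.inputs coin ω) t : ℝ) :=
    measurable_slot hfc c adv (fun q _ => (q.injected : ℝ)) t
  have h6 : Measurable fun ω => (maxConcurrent c (adv.inputs coin ω) t : ℝ) :=
    measurable_from_nat.comp (measurable_maxConcurrent hfc c adv t)
  have h7 : {ω | GoodTime c (adv.inputs coin ω) s t} =
      {ω | (s : ℝ) < slotsBefore c (adv.inputs coin ω) t} ∩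
      ({ω | waste c (adv.inputs coin ω) t ≤ wasteBound} ∩
      {ω | averageAttempts c (adv.inputs coin ω) t ≤ 486 * attemptConst c *
        (1 + Real.log (maxConcurrent c (adv.inputs coin ω) t) ^ 2 +
          Real.log (disruptedBefore c (adv.inputs coin ω) t) ^ 2)}) := by
    ext ω
    simp only [Set.mem_inter_iff, Set.mem_ofPred_eq, Nat.cast_lt]
    exact ⟨fun h => ⟨h.1, h.2, h.3⟩, fun h => ⟨h.1, h.2.1, h.2.2⟩⟩
  rw [h7]
  refine (measurableSet_lt measurable_const h1).inter
    ((measurableSet_le (h2.div h1) measurable_const).inter (measurableSet_le (h4.div h5) ?_))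
  exact measurable_const.mul ((measurable_const.add
    ((Real.measurable_log.comp h6).pow_const 2)).add ((Real.measurable_log.comp h3).pow_const 2))

end Measurability

end ReBackoff

end

/-- The constants `w` and `C` depend only on the protocol's constant `c`. The time `T` is a random
variable. The last clause says that the conditional expectation of the average number of access
attempts per packet at time `T`, given the values `𝒩_T = n` and `D_T = m`, is at most
`C (1 + log² n + log² m)`. -/
theorem mainTheorem3 :
    ∃ c₀ : ℝ, ∀ c : ℝ, c₀ ≤ c → ∃ w : ℝ, w < 1 ∧ ∃ C : ℝ,
      ∀ (Ω : Type*) [mΩ : MeasurableSpace Ω] (μ : Measure Ω) [IsProbabilityMeasure μ]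
        (ℱ : Filtration ℕ mΩ) (coin : ℕ → ReBackoff.Channel → ℕ → Ω → ℝ)
        (_ : ReBackoff.FairCoins μ ℱ coin) (adv : ReBackoff.Adversary ℱ)
        (_ : ∀ᵐ ω ∂μ, ∀ k : ℕ, ∃ t : ℕ, k ≤ ReBackoff.packetsBefore c (adv.inputs coin ω) t)
        (s : ℕ),
        ∃ T : Ω → ℕ, Measurable T ∧
          (∀ᵐ ω ∂μ, s ≤ ReBackoff.slotsBefore c (adv.inputs coin ω) (T ω) ∧
            ReBackoff.waste c (adv.inputs coin ω) (T ω) ≤ w) ∧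
          ∀ n m : ℕ,
            ∫⁻ ω in {ω | ReBackoff.maxConcurrent c (adv.inputs coin ω) (T ω) = n ∧
                ReBackoff.disruptedBefore c (adv.inputs coin ω) (T ω) = m},
              ENNReal.ofReal (ReBackoff.averageAttempts c (adv.inputs coin ω) (T ω)) ∂μ ≤
            ENNReal.ofReal (C * (1 + Real.log n ^ 2 + Real.log m ^ 2)) *
              μ {ω | ReBackoff.maxConcurrent c (adv.inputs coin ω) (T ω) = n ∧
                ReBackoff.disruptedBefore c (adv.inputs coin ω) (T ω) = m} := by
  refine ⟨1, fun c hc => ⟨ReBackoff.wasteBound, ?_, 486 * ReBackoff.attemptConst c, ?_⟩⟩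
  · have := ReBackoff.slotConst_ge
    have : 0 < 1 / (4 * ReBackoff.slotConst) := by positivity
    unfold ReBackoff.wasteBound
    linarith
  intro Ω mΩ μ _ ℱ coin hfc adv hinj s
  classical
  -- The second alternative makes the least time defined on the null set of outcomes without good
  -- times, while keeping it measurable.
  let p : Ω → ℕ → Prop := fun ω t => ReBackoff.GoodTime c (adv.inputs coin ω) s t ∨
    ∀ t', ¬ ReBackoff.GoodTime c (adv.inputs coin ω) s t'
  have hp : ∀ ω, ∃ t, p ω t := fun ω => by
    by_cases h : ∃ t, ReBackoff.GoodTime c (adv.inputs coin ω) s t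
    · exact h.imp fun t ht => Or.inl ht
    · exact ⟨0, Or.inr (not_exists.mp h)⟩
  have hm : ∀ t, MeasurableSet {ω | p ω t} := fun t => by
    refine (ReBackoff.measurableSet_goodTime hfc c adv s t).union ?_
    have : {ω | ∀ t', ¬ ReBackoff.GoodTime c (adv.inputs coin ω) s t'} =
        ⋂ t', {ω | ReBackoff.GoodTime c (adv.inputs coin ω) s t'}ᶜ := by
      ext ω; simp
    change MeasurableSet {ω | ∀ t', ¬ ReBackoff.GoodTime c (adv.inputs coin ω) s t'}
    rw [this]
    exact MeasurableSet.iInter fun t' =>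
      (ReBackoff.measurableSet_goodTime hfc c adv s t').compl
  have hgood : ∀ᵐ ω ∂μ, ReBackoff.GoodTime c (adv.inputs coin ω) s (Nat.find (hp ω)) := by
    filter_upwards [ReBackoff.ae_typical hfc hc adv, hinj] with ω hT hi
    obtain ⟨t, ht⟩ := ReBackoff.exists_goodTime hc hT hi s
    exact (Nat.find_spec (hp ω)).resolve_right fun h => h t ht
  refine ⟨fun ω => Nat.find (hp ω), measurable_find hp hm, ?_, fun n m => ?_⟩
  · filter_upwards [hgood] with ω h
    exact ⟨h.slots.le, h.waste⟩
  -- The bound at a good time is pointwise, so on the event where both values are fixed the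
  -- integrand is almost surely at most a constant.
  · rw [← setLIntegral_const]
    refine setLIntegral_mono_ae measurable_const.aemeasurable ?_
    filter_upwards [hgood] with ω h hω
    refine ENNReal.ofReal_le_ofReal ?_
    rw [← hω.1, ← hω.2]
    exact h.attempts
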